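/- Let $(V,\Omega)$ be a finite-dimensional real symplectic vector space, and let $\hbar>0$, $h=2\pi\hbar$. A compatible complex structure is a linear map $\tilde\jmath:V\to V$ with $\Omega(\tilde\jmath v,\tilde\jmath w)=\Omega(v,w)$ and $\tilde\jmath^2=-\mathrm{Id}$; it is positive if $\Omega(v,\tilde\jmath v)>0$ for all $v\ne0$. $Sp(V,\Omega)$ is the symplectic group and $U(V,\Omega,\tilde\jmath)=\{g\in Sp(V,\Omega)\mid g\tilde\jmath=\tilde\jmath g\}$. For a positive compatible complex structure $j$ regard $V$ as a complex vector space of dimension $n$ through $j$, with the Hermitian inner product $\langle v,w\rangle_j=\Omega(v,jw)-i\Omega(v,w)$ and norm $|v|_j$. Let $\mathcal H(V,\Omega,j)$ be the space of holomorphic functions $f$ on $(V,j)$ with $\|f\|_j^2=h^{-n}\int_V|f(z)|^2e^{-|z|_j^2/2\hbar}\,dz<\infty$, where $dz$ is the Lebesgue measure normalised by $|\cdot|_j$. The Heisenberg group $H(V,\Omega)=V\times\mathbb R$, with product $(v_1,t_1)(v_2,t_2)=(v_1+v_2,\,t_1+t_2-\tfrac12\Omega(v_1,v_2))$, acts unitarily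 on it by $$(U_j(v,t)f)(z)=e^{-it/\hbar+\langle z,v\rangle_j/2\hbar-|v|_j^2/4\hbar}f(z-v).$$ $Mp^c(V,\Omega,j)$ is the group of pairs $(U,g)$ of a unitary operator $U$ of $\mathcal H(V,\Omega,j)$ and $g\in Sp(V,\Omega)$ with $U_j(gv,t)=U\,U_j(v,t)\,U^{-1}$ for all $(v,t)$, and $\sigma(U,g)=g$. For $g\in Sp(V,\Omega)$ put $C_g=\tfrac12(g-jgj)$, which is $j$-linear and invertible, and $Z_g=C_g^{-1}\cdot\tfrac12(g+jgj)$. An element $(U,g)$ has parameters $(g,\lambda)$, $\lambda\in\mathbb C$, if $|\lambda^2\operatorname{Det}_jC_g|=1$ and, with $e_v(z)=e^{\langle z,v\rangle_j/2\hbar}$, for all $z,v\in V$ $$(Ue_v)(z)=\lambda\exp\tfrac1{4\hbar}\bigl\{2\langle C_g^{-1}z,v\rangle_j-\langle z,Z_{g^{-1}}z\rangle_j-\langle Z_gv,v\rangle_j\bigr\}.$$ The smooth structure of $Mp^c(V,\Omega,j)$ is that of the submanifold $\{(g,\lambda)\in Sp(V,\Omega)\times\mathbb C\mid|\lambda^2\operatorname{Det}_jC_g|=1\}$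 of $\operatorname{End}(V)\times\mathbb C$. **Proposition.** Let $\tilde\jmath$ be a (not necessarily positive) compatible complex structure on $(V,\Omega)$. There is a positive compatible complex structure commuting with $\tilde\jmath$. For every positive compatible complex structure $j$ commuting with $\tilde\jmath$, there is an injective smooth group homomorphism $$F:U(V,\Omega,\tilde\jmath)\to Mp^c(V,\Omega,j)$$ lifting the inclusion $U(V,\Omega,\tilde\jmath)\subset Sp(V,\Omega)$, i.e. $\sigma(F(g))=g$, such that for every $g$ the element $F(g)$ has parameters $\bigl(g,(\operatorname{Det}_jC_g^-)^{-1}\bigr)$, where $C_g^-$ is the restriction of $C_g$ to its invariant subspace $V_-=\{v\in V\mid\tilde\jmath v=-jv\}$. -/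

import Mathlib

open MeasureTheory
open scoped ContDiff ComplexConjugate

set_option linter.unusedSectionVars false

noncomputable section

namespace Mpc

/-! ### Symplectic linear algebra -/

/-- A symplectic form on a real vector space. -/
structure SymplecticForm (V : Type*) [AddCommGroup V] [Module ℝ V] where
  form : V →ₗ[ℝ] V →ₗ[ℝ] ℝ
  alt : form.IsAlt
  nondegenerate : form.Nondegenerate

variable {V : Type*} [AddCommGroup V] [Module ℝ V]

lemma SymplecticForm.neg_swap (Ω : SymplecticForm V) (v w : V) : -Ω.form v w = Ω.form w v :=
  Ω.alt.neg v w

/-- The symplectic group `Sp(V,Ω)`. -/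
def Sp (Ω : SymplecticForm V) : Subgroup (V ≃ₗ[ℝ] V) where
  carrier := {g | ∀ v w, Ω.form (g v) (g w) = Ω.form v w}
  one_mem' := fun _ _ => rfl
  mul_mem' := by
    intro g h hg hh v w
    have := hg (h v) (h w)
    simpa [hh v w] using this
  inv_mem' := by
    intro g hg v w
    have := hg (g⁻¹ v) (g⁻¹ w)
    have e : ∀ x, g (g⁻¹ x) = x := fun x => g.apply_symm_apply x
    simpa [e] using this.symm

/-- A compatible complex structure: a symplectic linear map `j` with `j² = -Id`. -/
structure CompatibleComplexStructure (Ω : SymplecticForm V) where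
  toLin : V →ₗ[ℝ] V
  map_form : ∀ v w, Ω.form (toLin v) (toLin w) = Ω.form v w
  sq_eq : ∀ v, toLin (toLin v) = -v

/-- A positive compatible complex structure: `G_j(v,w) = Ω(v,jw)` is positive definite. -/
structure PCCS (Ω : SymplecticForm V) extends CompatibleComplexStructure Ω where
  pos : ∀ v, v ≠ 0 → 0 < Ω.form v (toLin v)

/-- The pseudo-unitary group `U(V,Ω,j̃)` of symplectic maps commuting with `j̃`. -/
def pseudoUnitary {Ω : SymplecticForm V} (jt : CompatibleComplexStructure Ω) :
    Subgroup (Sp Ω) where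
  carrier := {g | ∀ v, g.1 (jt.toLin v) = jt.toLin (g.1 v)}
  one_mem' := fun _ => rfl
  mul_mem' := by
    intro g h hg hh v
    change g.1 (h.1 (jt.toLin v)) = jt.toLin (g.1 (h.1 v))
    rw [hh, hg]
  inv_mem' := by
    intro g hg v
    apply g.1.injective
    have e : ∀ x, g.1 ((g⁻¹).1 x) = x := fun x => g.1.apply_symm_apply x
    rw [hg, e, e]

variable {Ω : SymplecticForm V}

/-! ### The complex Hilbert space `(V,Ω,j)` -/

/-- The real vector space `V` regarded as a complex vector space through `j`. -/
def PCCS.Space (_j : PCCS Ω) : Type _ := V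

instance (j : PCCS Ω) : AddCommGroup j.Space := inferInstanceAs (AddCommGroup V)

/-- The identity map from `V` to `(V,j)`. -/
def PCCS.up (j : PCCS Ω) : V ≃+ j.Space := AddEquiv.refl V

/-- The identity map from `(V,j)` to `V`. -/
def PCCS.down (j : PCCS Ω) : j.Space ≃+ V := AddEquiv.refl V

@[simp] lemma PCCS.up_down (j : PCCS Ω) (v : j.Space) : j.up (j.down v) = v := rfl
@[simp] lemma PCCS.down_up (j : PCCS Ω) (v : V) : j.down (j.up v) = v := rfl

/-- `(a + ib) • v = a v + b j v`. -/
instance (j : PCCS Ω) : Module ℂ j.Space where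
  smul z v := j.up (z.re • j.down v + z.im • j.toLin (j.down v))
  one_smul v := by
    change (1 : ℝ) • j.down v + (0 : ℝ) • j.toLin (j.down v) = j.down v
    simp
  mul_smul z w v := by
    change (z * w).re • j.down v + (z * w).im • j.toLin (j.down v)
      = z.re • (w.re • j.down v + w.im • j.toLin (j.down v))
        + z.im • j.toLin (w.re • j.down v + w.im • j.toLin (j.down v))
    simp only [Complex.mul_re, Complex.mul_im, map_add, map_smul, j.sq_eq]
    module
  smul_zero z := by
    change z.re • (0 : V) + z.im • j.toLin (0 : V) = 0
    simp
  smul_add z v w := by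
    change z.re • (j.down v + j.down w) + z.im • j.toLin (j.down v + j.down w)
      = (z.re • j.down v + z.im • j.toLin (j.down v)) + (z.re • j.down w + z.im • j.toLin (j.down w))
    simp only [map_add]
    module
  add_smul z w v := by
    change (z + w).re • j.down v + (z + w).im • j.toLin (j.down v)
      = (z.re • j.down v + z.im • j.toLin (j.down v)) + (w.re • j.down v + w.im • j.toLin (j.down v))
    simp only [Complex.add_re, Complex.add_im]
    module
  zero_smul v := by
    change (0 : ℝ) • j.down v + (0 : ℝ) • j.toLin (j.down v) = 0
    simp

lemma PCCS.down_smul (j : PCCS Ω) (z : ℂ) (v : j.Space) :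
    j.down (z • v) = z.re • j.down v + z.im • j.toLin (j.down v) := rfl

/-- The Hermitian form `⟨v,w⟩_j = Ω(v,jw) - iΩ(v,w)`, linear in `v` and antilinear in `w`. -/
def PCCS.herm (j : PCCS Ω) (v w : j.Space) : ℂ :=
  (Ω.form (j.down v) (j.toLin (j.down w)) : ℂ) - Complex.I * (Ω.form (j.down v) (j.down w) : ℂ)

lemma PCCS.form_symm (j : PCCS Ω) (v w : V) : Ω.form v (j.toLin w) = Ω.form w (j.toLin v) := by
  rw [← j.map_form v (j.toLin w), j.sq_eq]
  have := Ω.neg_swap (j.toLin v) w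
  simpa using this

lemma PCCS.form_left (j : PCCS Ω) (v w : V) : Ω.form (j.toLin v) w = -Ω.form v (j.toLin w) := by
  rw [j.form_symm v w, Ω.neg_swap]

/-- Mathlib's inner products are linear in the second variable. -/
@[reducible] def PCCS.core (j : PCCS Ω) : InnerProductSpace.Core ℂ j.Space where
  inner v w := j.herm w v
  conj_inner_symm v w := by
    simp only [PCCS.herm, map_sub, map_mul, Complex.conj_ofReal, Complex.conj_I]
    rw [j.form_symm (j.down v), ← Ω.neg_swap (j.down w) (j.down v)]
    push_cast
    ring
  re_inner_nonneg v := by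
    have h0 : Ω.form (j.down v) (j.down v) = 0 := Ω.alt _
    simp only [PCCS.herm, h0]
    by_cases h : j.down v = 0
    · simp [h]
    · simpa using (j.pos _ h).le
  add_left u v w := by
    simp only [PCCS.herm, map_add, Complex.ofReal_add]
    ring
  smul_left v w z := by
    simp only [PCCS.herm, PCCS.down_smul, map_add, map_smul, smul_eq_mul, j.sq_eq, map_neg]
    apply Complex.ext <;> simp <;> ring
  definite v h := by
    by_contra hv
    have h1 : 0 < Ω.form (j.down v) (j.toLin (j.down v)) := j.pos _ (by simpa using hv)
    have h0 : Ω.form (j.down v) (j.down v) = 0 := Ω.alt _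
    simp only [PCCS.herm, h0] at h
    have h2 : ((Ω.form (j.down v) (j.toLin (j.down v)) : ℝ) : ℂ) = 0 := by simpa using h
    exact h1.ne' (by exact_mod_cast h2)

instance (j : PCCS Ω) : NormedAddCommGroup j.Space :=
  @InnerProductSpace.Core.toNormedAddCommGroup ℂ j.Space _ _ _ j.core

instance (j : PCCS Ω) : InnerProductSpace ℂ j.Space := InnerProductSpace.ofCore j.core.toCore

instance (j : PCCS Ω) : InnerProductSpace ℝ j.Space := InnerProductSpace.complexToReal

lemma PCCS.inner_eq (j : PCCS Ω) (v w : j.Space) : inner ℂ v w = j.herm w v := rfl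

instance [FiniteDimensional ℝ V] (j : PCCS Ω) : FiniteDimensional ℂ j.Space := by
  obtain ⟨s, hs⟩ := Module.finite_def.1 (inferInstance : Module.Finite ℝ V)
  refine Module.finite_def.2 ⟨show Finset j.Space from s, ?_⟩
  rw [eq_top_iff]
  rintro v -
  have hv : j.down v ∈ Submodule.span ℝ (s : Set V) := by rw [hs]; trivial
  have key : ∀ x : V, x ∈ Submodule.span ℝ (s : Set V) →
      j.up x ∈ Submodule.span ℂ (show Set j.Space from (s : Set V)) := by
    intro x hx
    induction hx using Submodule.span_induction with
    | mem x h => exact Submodule.subset_span h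
    | zero => exact Submodule.zero_mem _
    | add x y _ _ hx hy => exact Submodule.add_mem _ hx hy
    | smul a x _ hx =>
      have : j.up (a • x) = (a : ℂ) • j.up x := by
        change a • x = a • x + (0 : ℝ) • j.toLin x
        simp
      rw [this]
      exact Submodule.smul_mem _ _ hx
  exact key _ hv

instance (j : PCCS Ω) : MeasurableSpace j.Space := borel _
instance (j : PCCS Ω) : BorelSpace j.Space := ⟨rfl⟩

/-! ### The parameters `C_g`, `Z_g` -/

/-- The `j`-linear part `C_g = (g - jgj)/2`, as a complex linear map of `(V,j)`. -/
def PCCS.linPart (j : PCCS Ω) (g : V →ₗ[ℝ] V) : j.Space →ₗ[ℂ] j.Space where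
  toFun v := j.up ((1 / 2 : ℝ) • (g (j.down v) - j.toLin (g (j.toLin (j.down v)))))
  map_add' v w := by
    change (1 / 2 : ℝ) • (g (j.down (v + w)) - j.toLin (g (j.toLin (j.down (v + w)))))
      = (1 / 2 : ℝ) • (g (j.down v) - j.toLin (g (j.toLin (j.down v))))
        + (1 / 2 : ℝ) • (g (j.down w) - j.toLin (g (j.toLin (j.down w))))
    simp only [map_add]
    module
  map_smul' z v := by
    apply j.down.injective
    rw [RingHom.id_apply, PCCS.down_smul]
    simp only [PCCS.down_up, PCCS.down_smul, map_add, map_smul, map_sub, j.sq_eq, map_neg]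
    module

/-- The `j`-antilinear part `D_g = (g + jgj)/2`. -/
def PCCS.antiPart (j : PCCS Ω) (g : V →ₗ[ℝ] V) : j.Space →ₗ⋆[ℂ] j.Space where
  toFun v := j.up ((1 / 2 : ℝ) • (g (j.down v) + j.toLin (g (j.toLin (j.down v)))))
  map_add' v w := by
    change (1 / 2 : ℝ) • (g (j.down (v + w)) + j.toLin (g (j.toLin (j.down (v + w)))))
      = (1 / 2 : ℝ) • (g (j.down v) + j.toLin (g (j.toLin (j.down v))))
        + (1 / 2 : ℝ) • (g (j.down w) + j.toLin (g (j.toLin (j.down w))))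
    simp only [map_add]
    module
  map_smul' z v := by
    apply j.down.injective
    rw [PCCS.down_smul]
    simp only [PCCS.down_up, PCCS.down_smul, map_add, map_smul, j.sq_eq, map_neg,
      Complex.conj_re, Complex.conj_im]
    module

lemma PCCS.linPart_injective (j : PCCS Ω) (g : Sp Ω) :
    Function.Injective (j.linPart (g.1 : V →ₗ[ℝ] V)) := by
  rw [← LinearMap.ker_eq_bot, LinearMap.ker_eq_bot']
  intro v hv
  have hg : ∀ x y, Ω.form (g.1 x) (g.1 y) = Ω.form x y := g.2
  have h : g.1 (j.down v) = j.toLin (g.1 (j.toLin (j.down v))) := by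
    have h1 : (1 / 2 : ℝ) • (g.1 (j.down v) - j.toLin (g.1 (j.toLin (j.down v)))) = (0 : V) := hv
    rcases smul_eq_zero.1 h1 with h2 | h2
    · norm_num at h2
    · exact sub_eq_zero.1 h2
  by_contra hv0
  have h1 : 0 < Ω.form (j.down v) (j.toLin (j.down v)) := j.pos _ (by simpa using hv0)
  set x := g.1 (j.toLin (j.down v)) with hx
  have h2 : Ω.form (j.toLin x) x = Ω.form (j.down v) (j.toLin (j.down v)) := by rw [← h, hx]; exact hg _ _
  rw [j.form_left] at h2
  by_cases hx0 : x = 0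
  · simp [hx0] at h2
    linarith
  · have := j.pos x hx0
    linarith

section Parameters

variable [FiniteDimensional ℝ V]

/-- For symplectic `g` the map `C_g` is invertible. -/
def PCCS.C (j : PCCS Ω) (g : Sp Ω) : j.Space ≃ₗ[ℂ] j.Space :=
  LinearEquiv.ofInjectiveEndo (j.linPart (g.1 : V →ₗ[ℝ] V)) (j.linPart_injective g)

lemma PCCS.C_apply (j : PCCS Ω) (g : Sp Ω) (v : j.Space) :
    j.C g v = j.up ((1 / 2 : ℝ) • (g.1 (j.down v) - j.toLin (g.1 (j.toLin (j.down v))))) := rfl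

/-- `Z_g = C_g⁻¹ D_g`. -/
def PCCS.Z (j : PCCS Ω) (g : Sp Ω) : j.Space →ₗ⋆[ℂ] j.Space :=
  ((j.C g).symm : j.Space →ₗ[ℂ] j.Space).comp (j.antiPart (g.1 : V →ₗ[ℝ] V))

end Parameters

/-- The subspace `V_- = {v | j̃v = -jv}`, a complex subspace of `(V,j)` when `j̃j = jj̃`. -/
def PCCS.minus (j : PCCS Ω) (jt : CompatibleComplexStructure Ω)
    (hcomm : ∀ v, jt.toLin (j.toLin v) = j.toLin (jt.toLin v)) : Submodule ℂ j.Space where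
  carrier := {v | jt.toLin (j.down v) = -j.toLin (j.down v)}
  zero_mem' := by simp
  add_mem' := by
    intro v w hv hw
    simp only [Set.mem_ofPred_eq, map_add] at *
    rw [hv, hw]
    abel
  smul_mem' := by
    intro z v hv
    simp only [Set.mem_ofPred_eq] at *
    simp only [PCCS.down_smul, map_add, map_smul, hcomm, hv, map_neg]
    module

lemma PCCS.C_mem_minus [FiniteDimensional ℝ V] (j : PCCS Ω) (jt : CompatibleComplexStructure Ω)
    (hcomm : ∀ v, jt.toLin (j.toLin v) = j.toLin (jt.toLin v)) (g : pseudoUnitary jt) :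
    ∀ v ∈ j.minus jt hcomm, (j.C g.1 : j.Space →ₗ[ℂ] j.Space) v ∈ j.minus jt hcomm := by
  intro v hv
  have hg : ∀ x, g.1.1 (jt.toLin x) = jt.toLin (g.1.1 x) := g.2
  have hv' : jt.toLin (j.down v) = -j.toLin (j.down v) := hv
  change jt.toLin ((1 / 2 : ℝ) • (g.1.1 (j.down v) - j.toLin (g.1.1 (j.toLin (j.down v)))))
    = -j.toLin ((1 / 2 : ℝ) • (g.1.1 (j.down v) - j.toLin (g.1.1 (j.toLin (j.down v)))))
  simp only [map_smul, map_sub, hcomm, ← hg, hv', map_neg, j.sq_eq]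
  module

/-- The restriction `C_g^-` of `C_g` to `V_-`. -/
def PCCS.CMinus [FiniteDimensional ℝ V] (j : PCCS Ω) (jt : CompatibleComplexStructure Ω)
    (hcomm : ∀ v, jt.toLin (j.toLin v) = j.toLin (jt.toLin v)) (g : pseudoUnitary jt) :
    j.minus jt hcomm →ₗ[ℂ] j.minus jt hcomm :=
  (j.C g.1 : j.Space →ₗ[ℂ] j.Space).restrict (j.C_mem_minus jt hcomm g)

/-! ### The Heisenberg group -/

/-- The Heisenberg group `H(V,Ω) = V × ℝ`. -/
@[ext] structure Heisenberg (Ω : SymplecticForm V) where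
  vec : V
  central : ℝ

instance : Group (Heisenberg Ω) where
  mul a b := ⟨a.vec + b.vec, a.central + b.central - (1 / 2) * Ω.form a.vec b.vec⟩
  one := ⟨0, 0⟩
  inv a := ⟨-a.vec, -a.central⟩
  mul_assoc a b c := by
    change Heisenberg.mk (a.vec + b.vec + c.vec)
        (a.central + b.central - (1 / 2) * Ω.form a.vec b.vec + c.central
          - (1 / 2) * Ω.form (a.vec + b.vec) c.vec)
      = Heisenberg.mk (a.vec + (b.vec + c.vec))
        (a.central + (b.central + c.central - (1 / 2) * Ω.form b.vec c.vec)
          - (1 / 2) * Ω.form a.vec (b.vec + c.vec))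
    ext
    · exact add_assoc _ _ _
    · simp only [map_add, LinearMap.add_apply]
      ring
  one_mul a := by
    change Heisenberg.mk (0 + a.vec) (0 + a.central - (1 / 2) * Ω.form 0 a.vec) = a
    ext <;> simp
  mul_one a := by
    change Heisenberg.mk (a.vec + 0) (a.central + 0 - (1 / 2) * Ω.form a.vec 0) = a
    ext <;> simp
  inv_mul_cancel a := by
    change Heisenberg.mk (-a.vec + a.vec) (-a.central + a.central - (1 / 2) * Ω.form (-a.vec) a.vec)
      = Heisenberg.mk 0 0
    have h0 : Ω.form a.vec a.vec = 0 := Ω.alt _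
    ext <;> simp [h0]

/-- The action `g·(v,t) = (gv,t)` of the symplectic group on the Heisenberg group. -/
def Sp.act (g : Sp Ω) (a : Heisenberg Ω) : Heisenberg Ω := ⟨g.1 a.vec, a.central⟩

/-! ### The Fock space -/

/-- The Gaussian density `h^{-n} e^{-|z|²/2ħ}`, where `h = 2πħ` and `n = dim_ℂ (V,j)`. -/
def fockDensity (j : PCCS Ω) (hbar : ℝ) (z : j.Space) : ℝ :=
  ((2 * Real.pi * hbar) ^ Module.finrank ℂ j.Space)⁻¹ * Real.exp (-‖z‖ ^ 2 / (2 * hbar))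

lemma fockDensity_pos (j : PCCS Ω) {hbar : ℝ} (h : 0 < hbar) (z : j.Space) :
    0 < fockDensity j hbar z := by
  have := Real.pi_pos
  unfold fockDensity
  positivity

lemma measurable_fockDensity (j : PCCS Ω) (hbar : ℝ) : Measurable (fockDensity j hbar) := by
  unfold fockDensity
  fun_prop

lemma differentiable_herm (j : PCCS Ω) (v : j.Space) :
    Differentiable ℂ fun z : j.Space => j.herm z v :=
  (innerSL ℂ v).differentiable

lemma differentiable_herm_div (j : PCCS Ω) (v : j.Space) (c : ℂ) :
    Differentiable ℂ fun z : j.Space => j.herm z v / c := by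
  simp_rw [div_eq_mul_inv]
  exact (differentiable_herm j v).mul_const _

section Fock

variable [FiniteDimensional ℝ V]

/-- The measure `h^{-n} e^{-|z|²/2ħ} dz` on `V`, where `dz` is the Lebesgue measure normalised by
the norm `|·|_j`. -/
def fockMeasure (j : PCCS Ω) (hbar : ℝ) : Measure j.Space :=
  (volume : Measure j.Space).withDensity fun z => ENNReal.ofReal (fockDensity j hbar z)

/-- The space `H(V,Ω,j)` of holomorphic functions on `(V,j)` that are square integrable for
`h^{-n} e^{-|z|²/2ħ} dz`. -/
def Fock (j : PCCS Ω) (hbar : ℝ) : Submodule ℂ (j.Space → ℂ) where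
  carrier := {f | Differentiable ℂ f ∧ MemLp f 2 (fockMeasure j hbar)}
  zero_mem' := ⟨differentiable_const 0, MemLp.zero⟩
  add_mem' := fun hf hg => ⟨hf.1.add hg.1, hf.2.add hg.2⟩
  smul_mem' := fun c _ hf => ⟨hf.1.const_smul c, hf.2.const_smul c⟩

variable (j : PCCS Ω) (hbar : ℝ)

/-- The class of a function of the Fock space in `L²`. -/
def Fock.toLp : Fock j hbar →ₗ[ℂ] Lp ℂ 2 (fockMeasure j hbar) where
  toFun f := f.2.2.toLp f.1
  map_add' f g := MemLp.toLp_add f.2.2 g.2.2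
  map_smul' c f := MemLp.toLp_const_smul c f.2.2

variable [hpos : Fact (0 < hbar)]

lemma Fock.toLp_injective : Function.Injective (Fock.toLp j hbar) := by
  intro f g h
  have h1 : f.1 =ᵐ[fockMeasure j hbar] g.1 := (MemLp.toLp_eq_toLp_iff f.2.2 g.2.2).1 h
  have h2 : f.1 =ᵐ[volume] g.1 := by
    unfold fockMeasure at h1
    have h3 := (ae_withDensity_iff (measurable_fockDensity j hbar).ennreal_ofReal).1 h1
    filter_upwards [h3] with z hz
    exact hz (by simpa using fockDensity_pos j hpos.out z)
  exact Subtype.ext (Continuous.ae_eq_iff_eq volume f.2.1.continuous g.2.1.continuous |>.1 h2)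

instance : NormedAddCommGroup (Fock j hbar) :=
  NormedAddCommGroup.induced _ _ (Fock.toLp j hbar) (Fock.toLp_injective j hbar)

/-- The inner product of the Fock space is the one of `L²(h^{-n} e^{-|z|²/2ħ} dz)`. -/
instance : InnerProductSpace ℂ (Fock j hbar) where
  toNormedSpace := NormedSpace.induced ℂ _ _ (Fock.toLp j hbar)
  inner f g := inner ℂ (Fock.toLp j hbar f) (Fock.toLp j hbar g)
  norm_sq_eq_re_inner f := norm_sq_eq_re_inner (𝕜 := ℂ) (Fock.toLp j hbar f)
  conj_inner_symm f g := inner_conj_symm (𝕜 := ℂ) (Fock.toLp j hbar f) (Fock.toLp j hbar g)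
  add_left f g h := by rw [map_add, inner_add_left]
  smul_left f g c := by rw [map_smul, inner_smul_left]

lemma Fock.inner_eq_integral (f g : Fock j hbar) :
    inner ℂ f g = ∫ z, conj (f.1 z) * g.1 z ∂(fockMeasure j hbar) := by
  change inner ℂ (Fock.toLp j hbar f) (Fock.toLp j hbar g) = _
  rw [L2.inner_def]
  apply integral_congr_ae
  have hf : (Fock.toLp j hbar f : j.Space → ℂ) =ᵐ[fockMeasure j hbar] f.1 := MemLp.coeFn_toLp f.2.2
  have hg : (Fock.toLp j hbar g : j.Space → ℂ) =ᵐ[fockMeasure j hbar] g.1 := MemLp.coeFn_toLp g.2.2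
  filter_upwards [hf, hg] with z h1 h2
  rw [h1, h2, RCLike.inner_apply, mul_comm]

/-! ### The Fock representation of the Heisenberg group -/

lemma memLp_fock_iff {j : PCCS Ω} {hbar : ℝ} [hpos : Fact (0 < hbar)] {f : j.Space → ℂ} (hf : Continuous f) :
    MemLp f 2 (fockMeasure j hbar) ↔ Integrable (fun z => ‖f z‖ ^ 2 * fockDensity j hbar z) := by
  rw [memLp_two_iff_integrable_sq_norm hf.aestronglyMeasurable, fockMeasure,
    integrable_withDensity_iff (measurable_fockDensity j hbar).ennreal_ofReal (by simp)]
  simp_rw [ENNReal.toReal_ofReal (fockDensity_pos j hpos.out _).le]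

/-- `‖f‖_j² = h^{-n} ∫ |f(z)|² e^{-|z|²/2ħ} dz`. -/
lemma Fock.norm_sq_eq (f : Fock j hbar) :
    ‖f‖ ^ 2 = ∫ z, ‖f.1 z‖ ^ 2 * fockDensity j hbar z := by
  have h1 : (‖f‖ ^ 2 : ℝ) = RCLike.re (inner ℂ f f) := norm_sq_eq_re_inner f
  have h2 : inner ℂ f f = ((∫ z, ‖f.1 z‖ ^ 2 ∂(fockMeasure j hbar) : ℝ) : ℂ) := by
    rw [Fock.inner_eq_integral, ← integral_complex_ofReal]
    congr 1
    ext z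
    rw [mul_comm, Complex.mul_conj, Complex.normSq_eq_norm_sq]
  rw [h1, h2, fockMeasure, integral_withDensity_eq_integral_toReal_smul
    (measurable_fockDensity j hbar).ennreal_ofReal (by simp)]
  change ∫ z, _ = _
  congr 1
  ext z
  rw [ENNReal.toReal_ofReal (fockDensity_pos j hpos.out _).le, smul_eq_mul, mul_comm]

/-- `(U_j(v,t)f)(z) = exp(-it/ħ + ⟨z,v⟩_j/2ħ - |v|²/4ħ) f(z - v)`, on arbitrary functions. -/
def heisenbergFun (a : Heisenberg Ω) (f : j.Space → ℂ) (z : j.Space) : ℂ :=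
  Complex.exp (-(Complex.I * a.central) / hbar + j.herm z (j.up a.vec) / (2 * hbar)
    - (‖j.up a.vec‖ : ℂ) ^ 2 / (4 * hbar)) * f (z - j.up a.vec)

lemma heisenbergFun_norm (a : Heisenberg Ω) (f : j.Space → ℂ) (z : j.Space) :
    ‖heisenbergFun j hbar a f z‖ ^ 2 * fockDensity j hbar z
      = ‖f (z - j.up a.vec)‖ ^ 2 * fockDensity j hbar (z - j.up a.vec) := by
  have hb := hpos.out.ne'
  have hre : (j.herm z (j.up a.vec)).re = RCLike.re (inner ℂ z (j.up a.vec)) := by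
    rw [← j.inner_eq, inner_re_symm]
    rfl
  have hn := norm_sub_sq (𝕜 := ℂ) z (j.up a.vec)
  rw [← hre] at hn
  have hexp : (-(Complex.I * a.central) / hbar + j.herm z (j.up a.vec) / (2 * hbar)
      - (‖j.up a.vec‖ : ℂ) ^ 2 / (4 * hbar)).re
      = (j.herm z (j.up a.vec)).re / (2 * hbar) - ‖j.up a.vec‖ ^ 2 / (4 * hbar) := by
    have e1 : ((2 : ℂ) * hbar) = ((2 * hbar : ℝ) : ℂ) := by push_cast; ring
    have e2 : (‖j.up a.vec‖ : ℂ) ^ 2 / (4 * hbar) = ((‖j.up a.vec‖ ^ 2 / (4 * hbar) : ℝ) : ℂ) := by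
      push_cast; ring
    rw [e1, e2, Complex.sub_re, Complex.add_re, Complex.div_ofReal_re, Complex.div_ofReal_re,
      Complex.ofReal_re]
    simp
  unfold heisenbergFun fockDensity
  rw [norm_mul, Complex.norm_exp, hexp, hn, mul_pow, ← Real.exp_nat_mul]
  have : Real.exp (-(‖z‖ ^ 2 - 2 * (j.herm z (j.up a.vec)).re + ‖j.up a.vec‖ ^ 2) / (2 * hbar))
      = Real.exp ((2 : ℕ) * ((j.herm z (j.up a.vec)).re / (2 * hbar)
          - ‖j.up a.vec‖ ^ 2 / (4 * hbar))) * Real.exp (-‖z‖ ^ 2 / (2 * hbar)) := by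
    rw [← Real.exp_add]
    congr 1
    push_cast
    field_simp
    ring
  rw [this]
  ring

lemma heisenbergFun_mem (a : Heisenberg Ω) (f : Fock j hbar) :
    heisenbergFun j hbar a f.1 ∈ Fock j hbar := by
  have hd : Differentiable ℂ (heisenbergFun j hbar a f.1) := by
    have h1 := differentiable_herm_div j (j.up a.vec) (2 * (hbar : ℂ))
    have h2 : Differentiable ℂ fun z : j.Space => f.1 (z - j.up a.vec) :=
      f.2.1.comp (differentiable_id.sub_const _)
    exact (((h1.const_add _).sub_const _).cexp).mul h2
  refine ⟨hd, (memLp_fock_iff hd.continuous).2 ?_⟩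
  simp_rw [heisenbergFun_norm]
  exact ((memLp_fock_iff f.2.1.continuous).1 f.2.2).comp_sub_right (j.up a.vec)

lemma heisenbergFun_mul (a b : Heisenberg Ω) (f : j.Space → ℂ) :
    heisenbergFun j hbar (a * b) f = heisenbergFun j hbar a (heisenbergFun j hbar b f) := by
  have hb := hpos.out.ne'
  ext z
  have hv : (a * b).vec = a.vec + b.vec := rfl
  have ht : (a * b).central = a.central + b.central - (1 / 2) * Ω.form a.vec b.vec := rfl
  have hup : j.up (a.vec + b.vec) = j.up a.vec + j.up b.vec := rfl
  have hn := norm_add_sq (𝕜 := ℂ) (j.up a.vec) (j.up b.vec)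
  have hin : RCLike.re (inner ℂ (j.up a.vec) (j.up b.vec)) = Ω.form a.vec (j.toLin b.vec) := by
    rw [inner_re_symm, j.inner_eq]
    simp [PCCS.herm]
  have hn' : (‖j.up a.vec + j.up b.vec‖ : ℂ) ^ 2 = (‖j.up a.vec‖ : ℂ) ^ 2
      + 2 * (Ω.form a.vec (j.toLin b.vec) : ℂ) + (‖j.up b.vec‖ : ℂ) ^ 2 := by
    rw [hin] at hn
    exact_mod_cast hn
  unfold heisenbergFun
  rw [← mul_assoc, ← Complex.exp_add, hv, ht, hup, hn', sub_sub]
  congr 2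
  have hb' : (hbar : ℂ) ≠ 0 := by exact_mod_cast hb
  simp only [PCCS.herm, map_add, map_sub, LinearMap.sub_apply, PCCS.down_up]
  push_cast
  field_simp
  ring

lemma heisenbergFun_one (f : j.Space → ℂ) : heisenbergFun j hbar 1 f = f := by
  ext z
  have hv : (1 : Heisenberg Ω).vec = 0 := rfl
  have ht : (1 : Heisenberg Ω).central = 0 := rfl
  simp [heisenbergFun, hv, ht, PCCS.herm]

/-- The Fock representation `U_j` of the Heisenberg group by unitary operators of `H(V,Ω,j)`. -/
def fockRep : Heisenberg Ω →* (Fock j hbar ≃ₗᵢ[ℂ] Fock j hbar) where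
  toFun a :=
    { toFun := fun f => ⟨heisenbergFun j hbar a f.1, heisenbergFun_mem j hbar a f⟩
      invFun := fun f => ⟨heisenbergFun j hbar a⁻¹ f.1, heisenbergFun_mem j hbar a⁻¹ f⟩
      map_add' := by
        intro f g
        ext z
        exact mul_add _ _ _
      map_smul' := by
        intro c f
        ext z
        exact mul_left_comm _ _ _
      left_inv := by
        intro f
        apply Subtype.ext
        change heisenbergFun j hbar a⁻¹ (heisenbergFun j hbar a f.1) = f.1
        rw [← heisenbergFun_mul, inv_mul_cancel, heisenbergFun_one]
      right_inv := by
        intro f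
        apply Subtype.ext
        change heisenbergFun j hbar a (heisenbergFun j hbar a⁻¹ f.1) = f.1
        rw [← heisenbergFun_mul, mul_inv_cancel, heisenbergFun_one]
      norm_map' := by
        intro f
        rw [← sq_eq_sq₀ (norm_nonneg _) (norm_nonneg _), Fock.norm_sq_eq, Fock.norm_sq_eq]
        change ∫ z, ‖heisenbergFun j hbar a f.1 z‖ ^ 2 * fockDensity j hbar z = _
        simp_rw [heisenbergFun_norm]
        exact integral_sub_right_eq_self
          (fun z => ‖f.1 z‖ ^ 2 * fockDensity j hbar z) (j.up a.vec) }
  map_one' := by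
    ext f z
    exact congrFun (heisenbergFun_one j hbar f.1) z
  map_mul' a b := by
    ext f z
    exact congrFun (heisenbergFun_mul j hbar a b f.1) z

/-! ### The group `Mp^c` and its parameters -/

/-- The group `Mp^c(V,Ω,j)` of pairs `(U,g)` with `U` a unitary operator of `H(V,Ω,j)`, `g`
symplectic and `U_j(g(v),t) = U U_j(v,t) U⁻¹` for all `(v,t)`. -/
def MpC : Subgroup ((Fock j hbar ≃ₗᵢ[ℂ] Fock j hbar) × Sp Ω) where
  carrier := {p | ∀ a : Heisenberg Ω,
    fockRep j hbar (Sp.act p.2 a) = p.1 * fockRep j hbar a * p.1⁻¹}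
  one_mem' := fun a => by
    change fockRep j hbar a = 1 * fockRep j hbar a * 1⁻¹
    simp
  mul_mem' := by
    intro p q hp hq a
    change fockRep j hbar (Sp.act p.2 (Sp.act q.2 a))
      = (p.1 * q.1) * fockRep j hbar a * (p.1 * q.1)⁻¹
    rw [hp, hq]
    group
  inv_mem' := by
    intro p hp a
    have h := hp (Sp.act p.2⁻¹ a)
    have e : Sp.act p.2 (Sp.act p.2⁻¹ a) = a := by
      ext
      · exact p.2.1.apply_symm_apply a.vec
      · rfl
    rw [e] at h
    change fockRep j hbar (Sp.act p.2⁻¹ a) = p.1⁻¹ * fockRep j hbar a * (p.1⁻¹)⁻¹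
    rw [h]
    group

/-- The homomorphism `σ : Mp^c(V,Ω,j) → Sp(V,Ω)`, `(U,g) ↦ g`. -/
def MpC.σ : MpC j hbar →* Sp Ω := (MonoidHom.snd _ _).comp (MpC j hbar).subtype

/-- The coherent state `e_v(z) = exp(⟨z,v⟩_j/2ħ)`. -/
def coherent (v : j.Space) : Fock j hbar :=
  ⟨fun z => Complex.exp (j.herm z v / (2 * hbar)), by
    have hd : Differentiable ℂ fun z : j.Space => Complex.exp (j.herm z v / (2 * hbar)) :=
      (differentiable_herm_div j v (2 * (hbar : ℂ))).cexp
    refine ⟨hd, (memLp_fock_iff hd.continuous).2 ?_⟩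
    have hb := hpos.out
    have h := GaussianFourier.integrable_cexp_neg_mul_sq_norm_add (V := j.Space)
      (b := ((1 / (2 * hbar) : ℝ) : ℂ)) (by simpa using hb) ((1 / hbar : ℝ) : ℂ) v
    have h2 := (h.norm).const_mul ((2 * Real.pi * hbar) ^ Module.finrank ℂ j.Space)⁻¹
    refine h2.congr (Filter.Eventually.of_forall fun z => ?_)
    have hre : (inner ℝ v z : ℝ) = (j.herm z v).re := rfl
    have e1 : (j.herm z v / (2 * hbar)).re = (j.herm z v).re / (2 * hbar) := by
      have : ((2 : ℂ) * hbar) = ((2 * hbar : ℝ) : ℂ) := by push_cast; ring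
      rw [this, Complex.div_ofReal_re]
    have e2 : (-((1 / (2 * hbar) : ℝ) : ℂ) * (‖z‖ : ℂ) ^ 2
        + ((1 / hbar : ℝ) : ℂ) * ((inner ℝ v z : ℝ) : ℂ))
        = ((-(1 / (2 * hbar)) * ‖z‖ ^ 2 + (1 / hbar) * (j.herm z v).re : ℝ) : ℂ) := by
      rw [hre]; push_cast; ring
    beta_reduce
    rw [Complex.norm_exp, Complex.norm_exp, e1]
    erw [e2]
    rw [Complex.ofReal_re, fockDensity, ← Real.exp_nat_mul, mul_left_comm, ← Real.exp_add]
    congr 2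
    push_cast
    field_simp
    ring⟩

variable {j hbar}

/-- The Berezin kernel `A(z,v) = (A e_v)(z)` of an operator on `H(V,Ω,j)`. -/
def berezin (A : Fock j hbar ≃ₗᵢ[ℂ] Fock j hbar) (z v : j.Space) : ℂ :=
  (A (coherent j hbar v)).1 z

/-- `(g, λ)` are the parameters of `(U,g)`: `|λ² Det_j C_g| = 1` and `U` has Berezin kernel
`λ exp (1/4ħ) {2⟨C_g⁻¹z,v⟩_j - ⟨z, Z_{g⁻¹}z⟩_j - ⟨Z_g v,v⟩_j}`. -/
def MpC.HasParameters (x : MpC j hbar) (g : Sp Ω) (lam : ℂ) : Prop :=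
  MpC.σ j hbar x = g ∧
  ‖lam ^ 2 * LinearMap.det (j.C g : j.Space →ₗ[ℂ] j.Space)‖ = 1 ∧
  ∀ z v : j.Space, berezin x.1.1 z v =
    lam * Complex.exp (1 / (4 * hbar) *
      (2 * j.herm ((j.C g).symm z) v - j.herm z (j.Z g⁻¹ z) - j.herm (j.Z g v) v))

/-- The second parameter `λ = (U e_0)(0)` of `(U,g)`. -/
def MpC.lam (x : MpC j hbar) : ℂ := berezin x.1.1 0 0

/-- A map `F` from a subgroup `H` of `Sp(V,Ω)`, viewed in linear coordinates `e` of `End(V)`, into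
`Mp^c(V,Ω,j)`, whose smooth structure is the one of the submanifold
`{(g,λ) | |λ² Det_j C_g| = 1}` of `End(V) × ℂ`, is smooth. -/
def IsSmooth {H : Subgroup (Sp Ω)} (F : H → MpC j hbar) : Prop :=
  ∀ e : (V →ₗ[ℝ] V) ≃ₗ[ℝ] (Fin (Module.finrank ℝ (V →ₗ[ℝ] V)) → ℝ),
    ∃ Φ : (Fin (Module.finrank ℝ (V →ₗ[ℝ] V)) → ℝ) →
        (Fin (Module.finrank ℝ (V →ₗ[ℝ] V)) → ℝ) × ℂ,
      ContDiffOn ℝ ∞ Φ (Set.range fun h : H => e (h.1.1 : V →ₗ[ℝ] V)) ∧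
      ∀ h : H, Φ (e (h.1.1 : V →ₗ[ℝ] V)) =
        (e ((MpC.σ j hbar (F h)).1 : V →ₗ[ℝ] V), MpC.lam (F h))

end Fock

end Mpc

end

open MeasureTheory
open scoped ContDiff ComplexConjugate

set_option linter.unusedSectionVars false

noncomputable section

namespace Mpc

variable {V : Type*} [AddCommGroup V] [Module ℝ V] {Ω : SymplecticForm V}

/-! ### Algebra of the parameters -/

/-! A bounded operator on the Fock space is determined by its values on the coherent states, since
⟨e_v, f⟩ = f(v) makes them total. The parameters force F(g)e_v = λ_g φ_g(v), where φ_g(v) is the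
Gaussian built from C_g and Z_g. Compatibility with the Heisenberg group is an identity between
exponents, valid whatever the scalar λ_g (`fockShift_gaussVec`). What remains is that λ_g = (Det
C_g^-)⁻¹ makes these operators unitary and multiplicative in g. By `exists_unitary_of_kernel` both
follow from the single identity ⟨λ_g φ_g(w), λ_h φ_h(v)⟩ = ⟨e_w, λ_k φ_k(v)⟩ with k = g⁻¹h
(`inner_liftVec`).

The left side is a Gaussian integral, which in general involves the square root of a determinant.
For maps commuting with j̃ no root occurs: Z_g is j-antilinear and commutes with j̃, hence exchanges
V_+ and V_-. On V with the complex structure j̃ and the same norm, the quadratic exponent therefore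
becomes a sesquilinear expression ⟨Mx,x⟩ with M linear for j̃, and exp(-⟨Mx,x⟩) has integral π^n /
Det M (`integral_cexp_neg_herm`). A Heisenberg translation moves w into V_+ and v into V_-
(`exists_act_mem`). The remaining factor of the integrand is then, up to conjugation,
j̃-holomorphic, and the mean value property replaces it by its value at 0
(`integral_mul_of_rotation_invariant`).

Let m(g) be the j̃-determinant of the map equal to C_g on V_- and to 1 on V_+. Since j̃ = -j on V_-,
its conjugate is Det_j C_g^-. Factoring the operator of the integral (`PCCS.mixed_mul`) and
discarding unipotent factors gives the determinant m(g⁻¹h) / (conj m(g) · m(h)) (`PCCS.det_mixed`),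
which is what the scalars λ compensate. The same calculus gives |Det_j C_g| = |m(g)|², the
normalisation of the parameters.

Smoothness holds because Det C_g^- is the determinant of a map affine in g. A positive j commuting
with j̃ is found by diagonalising the Hermitian form of j̃ and reversing j̃ on the negative lines
(`exists_commuting_pccs`). -/

lemma Sp.form_left (g : Sp Ω) (v w : V) : Ω.form (g.1 v) w = Ω.form v ((g⁻¹).1 w) := by
  have e : g.1 ((g⁻¹).1 w) = w := g.1.apply_symm_apply w
  have := g.2 v ((g⁻¹).1 w)
  rwa [e] at this

lemma Sp.apply_inv (g : Sp Ω) (v : V) : g.1 ((g⁻¹).1 v) = v := g.1.apply_symm_apply v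

lemma Sp.inv_apply (g : Sp Ω) (v : V) : (g⁻¹).1 (g.1 v) = v := g.1.symm_apply_apply v

lemma PCCS.herm_conj (j : PCCS Ω) (v w : j.Space) : conj (j.herm v w) = j.herm w v :=
  inner_conj_symm (𝕜 := ℂ) v w

lemma PCCS.herm_self (j : PCCS Ω) (v : j.Space) : j.herm v v = (‖v‖ : ℂ) ^ 2 :=
  inner_self_eq_norm_sq_to_K (𝕜 := ℂ) v

lemma PCCS.herm_add_left (j : PCCS Ω) (u v w : j.Space) :
    j.herm (u + v) w = j.herm u w + j.herm v w := inner_add_right (𝕜 := ℂ) w u v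

lemma PCCS.herm_add_right (j : PCCS Ω) (u v w : j.Space) :
    j.herm u (v + w) = j.herm u v + j.herm u w := inner_add_left (𝕜 := ℂ) v w u

lemma PCCS.herm_sub_left (j : PCCS Ω) (u v w : j.Space) :
    j.herm (u - v) w = j.herm u w - j.herm v w := inner_sub_right (𝕜 := ℂ) w u v

lemma PCCS.herm_sub_right (j : PCCS Ω) (u v w : j.Space) :
    j.herm u (v - w) = j.herm u v - j.herm u w := inner_sub_left (𝕜 := ℂ) v w u

lemma PCCS.herm_neg_left (j : PCCS Ω) (u v : j.Space) :
    j.herm (-u) v = -j.herm u v := inner_neg_right (𝕜 := ℂ) v u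

lemma PCCS.herm_smul_left (j : PCCS Ω) (c : ℂ) (u v : j.Space) :
    j.herm (c • u) v = c * j.herm u v := inner_smul_right (𝕜 := ℂ) v u c

lemma PCCS.herm_smul_right (j : PCCS Ω) (c : ℂ) (u v : j.Space) :
    j.herm u (c • v) = conj c * j.herm u v := inner_smul_left (𝕜 := ℂ) v u c

lemma PCCS.herm_zero_right (j : PCCS Ω) (u : j.Space) : j.herm u 0 = 0 :=
  inner_zero_left (𝕜 := ℂ) u

lemma PCCS.herm_zero_left (j : PCCS Ω) (u : j.Space) : j.herm 0 u = 0 :=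
  inner_zero_right (𝕜 := ℂ) u

/-- The action of a symplectic map on `(V,j)`. -/
def PCCS.act (j : PCCS Ω) (g : Sp Ω) (v : j.Space) : j.Space := j.up (g.1 (j.down v))

section

variable [FiniteDimensional ℝ V] (j : PCCS Ω) (g : Sp Ω)

/-- The antilinear part `D_g` of a symplectic map. -/
abbrev PCCS.D : j.Space →ₗ⋆[ℂ] j.Space := j.antiPart (g.1 : V →ₗ[ℝ] V)

lemma PCCS.D_apply (v : j.Space) :
    j.D g v = j.up ((1 / 2 : ℝ) • (g.1 (j.down v) + j.toLin (g.1 (j.toLin (j.down v))))) := rfl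

lemma PCCS.act_eq (v : j.Space) : j.act g v = j.C g v + j.D g v := by
  apply j.down.injective
  rw [map_add, C_apply, D_apply]
  simp only [PCCS.act, PCCS.down_up]
  module

/-- The Ω-adjoint of g is g⁻¹, and passing to j-linear parts respects adjoints. -/
lemma PCCS.herm_C_left (v w : j.Space) : j.herm (j.C g v) w = j.herm v (j.C g⁻¹ w) := by
  simp only [PCCS.herm, C_apply, PCCS.down_up, map_smul, map_sub, LinearMap.smul_apply,
    LinearMap.sub_apply, smul_eq_mul, Sp.form_left, j.form_left, j.sq_eq, map_neg]
  push_cast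
  ring

lemma PCCS.herm_D_left (v w : j.Space) : j.herm (j.D g v) w = -j.herm (j.D g⁻¹ w) v := by
  rw [← j.herm_conj v]
  simp only [PCCS.herm, D_apply, PCCS.down_up, map_smul, map_add, LinearMap.smul_apply,
    LinearMap.add_apply, smul_eq_mul, Sp.form_left, j.form_left, j.sq_eq, map_neg, map_sub, map_mul,
    Complex.conj_I, Complex.conj_ofReal]
  push_cast
  ring

lemma PCCS.act_inv_act (v : j.Space) : j.act g⁻¹ (j.act g v) = v := g.1.symm_apply_apply v

/-- This is the j-linear part of g⁻¹g = 1; `PCCS.C_inv_D` is its antilinear part. -/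
lemma PCCS.C_inv_C (v : j.Space) : j.C g⁻¹ (j.C g v) + j.D g⁻¹ (j.D g v) = v := by
  apply j.down.injective
  rw [map_add, C_apply, D_apply, C_apply, D_apply]
  simp only [PCCS.down_up, map_smul, map_add, map_sub, j.sq_eq, Sp.inv_apply, map_neg]
  module

lemma PCCS.C_inv_D (v : j.Space) : j.C g⁻¹ (j.D g v) = -j.D g⁻¹ (j.C g v) := by
  apply j.down.injective
  rw [map_neg, C_apply, D_apply, C_apply, D_apply]
  simp only [PCCS.down_up, map_smul, map_add, map_sub, j.sq_eq, Sp.inv_apply, map_neg]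
  module

lemma PCCS.Z_apply (v : j.Space) : j.Z g v = (j.C g).symm (j.D g v) := rfl

lemma PCCS.herm_C_symm_left (v w : j.Space) :
    j.herm ((j.C g).symm v) w = j.herm v ((j.C g⁻¹).symm w) := by
  obtain ⟨v, rfl⟩ := (j.C g).surjective v
  obtain ⟨w, rfl⟩ := (j.C g⁻¹).surjective w
  simp [herm_C_left]

lemma PCCS.Z_inv_C (v : j.Space) : j.Z g⁻¹ (j.C g v) = -j.D g v := by
  rw [Z_apply, LinearEquiv.symm_apply_eq, map_neg, C_inv_D, neg_neg]

lemma PCCS.Z_symm (v w : j.Space) : j.herm v (j.Z g w) = j.herm w (j.Z g v) := by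
  rw [← herm_conj, ← j.herm_conj (j.Z g v)]
  congr 1
  obtain ⟨w', rfl⟩ := (j.C g⁻¹).surjective v
  rw [Z_apply, herm_C_symm_left, LinearEquiv.symm_apply_apply, herm_D_left]
  have := j.Z_inv_C g⁻¹ w'
  rw [inv_inv] at this
  rw [this, herm_neg_left]

lemma PCCS.norm_C_sq (v : j.Space) : ‖j.C g v‖ ^ 2 = ‖v‖ ^ 2 + ‖j.D g v‖ ^ 2 := by
  have h : ((‖j.C g v‖ ^ 2 : ℝ) : ℂ) = ((‖v‖ ^ 2 + ‖j.D g v‖ ^ 2 : ℝ) : ℂ) := by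
    push_cast
    rw [← herm_self, ← herm_self, ← herm_self, herm_C_left, herm_D_left]
    have := j.C_inv_C g v
    rw [← eq_sub_iff_add_eq] at this
    rw [this, herm_sub_right, herm_self, ← j.herm_conj v (j.D g⁻¹ _)]
    have h2 : j.herm v (j.D g⁻¹ (j.D g v)) = -(‖j.D g v‖ ^ 2 : ℝ) := by
      rw [← herm_conj, herm_D_left, inv_inv, herm_self]
      simp
    rw [h2]
    simp
  exact_mod_cast h

lemma PCCS.norm_Z_inv_sq (v : j.Space) :
    ‖j.Z g⁻¹ v‖ ^ 2 = ‖v‖ ^ 2 - ‖(j.C g).symm v‖ ^ 2 := by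
  obtain ⟨v, rfl⟩ := (j.C g).surjective v
  rw [Z_inv_C, norm_neg, norm_C_sq, LinearEquiv.symm_apply_apply]
  ring

lemma PCCS.C_symm_act (v : j.Space) : (j.C g).symm (j.act g v) = v + j.Z g v := by
  rw [act_eq, map_add, LinearEquiv.symm_apply_apply, Z_apply]

lemma PCCS.act_add_Z_inv (v : j.Space) :
    j.act g v + j.Z g⁻¹ (j.act g v) = (j.C g⁻¹).symm v := by
  have := j.C_symm_act g⁻¹ (j.act g v)
  rw [act_inv_act] at this
  exact this.symm

/-- Z is a strict contraction: |Zz|² falls short of |z|² by |C_g⁻¹z|², which is bounded below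
because C_g is bounded. This yields both the square integrability of the Gaussians and the
positivity needed for the Gaussian integral. -/
lemma PCCS.exists_re_herm_Z_le : ∃ c > 0, ∀ z : j.Space,
    |(j.herm z (j.Z g⁻¹ z)).re| ≤ (1 - c) * ‖z‖ ^ 2 := by
  obtain ⟨K, hK0, hK⟩ : ∃ K > 0, ∀ z, ‖j.C g z‖ ≤ K * ‖z‖ :=
    (LinearMap.toContinuousLinearMap (j.C g : j.Space →ₗ[ℂ] j.Space)).bound
  have hle : ∀ z, ‖z‖ ≤ K * ‖(j.C g).symm z‖ := fun z => by
    simpa using hK ((j.C g).symm z)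
  -- Here |Zz|² ≤ (1 - 1/K²)|z|², and |z||Zz| ≤ (|z|² + |Zz|²)/2 halves the gain.
  refine ⟨1 / (2 * K ^ 2), by positivity, fun z => ?_⟩
  have h1 : |(j.herm z (j.Z g⁻¹ z)).re| ≤ ‖z‖ * ‖j.Z g⁻¹ z‖ := by
    refine (Complex.abs_re_le_norm _).trans ?_
    rw [mul_comm]
    exact norm_inner_le_norm (𝕜 := ℂ) (j.Z g⁻¹ z) z
  have h2 := j.norm_Z_inv_sq g z
  have h3 : ‖z‖ ^ 2 ≤ K ^ 2 * ‖(j.C g).symm z‖ ^ 2 := by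
    rw [← mul_pow]
    exact pow_le_pow_left₀ (norm_nonneg _) (hle z) 2
  have h4 : 1 / K ^ 2 * ‖z‖ ^ 2 ≤ ‖(j.C g).symm z‖ ^ 2 := by
    rw [one_div, inv_mul_le_iff₀ (by positivity)]
    exact h3
  have h5 : 1 / (2 * K ^ 2) * ‖z‖ ^ 2 = (1 / K ^ 2 * ‖z‖ ^ 2) / 2 := by
    field_simp
  nlinarith [sq_nonneg (‖z‖ - ‖j.Z g⁻¹ z‖)]

end

/-! ### The mean value property -/

section MeanValue

variable [FiniteDimensional ℝ V] (j : PCCS Ω)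

/-- Multiplication by a complex number of modulus one, as a real isometry. -/
def PCCS.rotation (c : ℂ) (hc : ‖c‖ = 1) : j.Space ≃ₗᵢ[ℝ] j.Space where
  toLinearEquiv := (LinearEquiv.smulOfNeZero ℂ j.Space c (by
    rintro rfl
    simp at hc)).restrictScalars ℝ
  norm_map' z := by
    change ‖c • z‖ = ‖z‖
    rw [norm_smul, hc, one_mul]

lemma PCCS.measurePreserving_smul (c : ℂ) (hc : ‖c‖ = 1) :
    MeasurePreserving (fun z : j.Space => c • z) volume volume :=
  (j.rotation c hc).measurePreserving

/-- The one-variable mean value property on the complex line through z. -/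
lemma integral_circle_smul {f : j.Space → ℂ} (hf : Differentiable ℂ f) (z : j.Space) :
    ∫ θ in Set.Ioc 0 (2 * Real.pi), f (Complex.exp (θ * Complex.I) • z) = 2 * Real.pi * f 0 := by
  have hd : Differentiable ℂ fun ζ : ℂ => f (ζ • z) := hf.comp (differentiable_id.smul_const z)
  have h := DiffContOnCl.circleAverage (f := fun ζ : ℂ => f (ζ • z)) (c := 0) (R := 1)
    hd.diffContOnCl
  rw [Real.circleAverage_def, intervalIntegral.integral_of_le (by positivity)] at h
  simp only [circleMap, zero_add, Complex.ofReal_one, one_mul, zero_smul] at h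
  rw [← h, Complex.real_smul]
  push_cast
  rw [← mul_assoc, mul_inv_cancel₀ (by simp [Real.pi_ne_zero]), one_mul]

/-- Rotations by e^{iθ} preserve both the Lebesgue measure and ρ, so the integral equals its average
over θ. By Fubini the average may be taken pointwise, where it turns f into f(0). -/
lemma integral_mul_of_rotation_invariant {f ρ : j.Space → ℂ} (hf : Differentiable ℂ f)
    (hρ : Continuous ρ) (hrot : ∀ (c : ℂ), ‖c‖ = 1 → ∀ z, ρ (c • z) = ρ z)
    (hint : Integrable fun z => f z * ρ z) :
    ∫ z, f z * ρ z = f 0 * ∫ z, ρ z := by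
  have hpi := Real.pi_pos
  set μ := (volume : Measure ℝ).restrict (Set.Ioc 0 (2 * Real.pi)) with hμ
  have hnorm (θ : ℝ) : ‖Complex.exp (θ * Complex.I)‖ = 1 := Complex.norm_exp_ofReal_mul_I θ
  let F : ℝ → j.Space → ℂ := fun θ z => f (Complex.exp (θ * Complex.I) • z) * ρ z
  have hF (θ : ℝ) : F θ = fun z => (fun z => f z * ρ z) (Complex.exp (θ * Complex.I) • z) := by
    ext z
    simp only [F, hrot _ (hnorm θ)]
  have hmp (θ : ℝ) := j.measurePreserving_smul _ (hnorm θ)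
  have hemb (θ : ℝ) : MeasurableEmbedding fun z : j.Space => Complex.exp (θ * Complex.I) • z :=
    (j.rotation _ (hnorm θ)).toHomeomorph.measurableEmbedding
  have hFi (θ : ℝ) : ∫ z, F θ z = ∫ z, f z * ρ z := by
    rw [hF]
    exact (hmp θ).integral_comp (hemb θ) (fun z => f z * ρ z)
  have hFn (θ : ℝ) : ∫ z, ‖F θ z‖ = ∫ z, ‖f z * ρ z‖ := by
    rw [hF]
    exact (hmp θ).integral_comp (hemb θ) (fun z => ‖f z * ρ z‖)
  have hFint (θ : ℝ) : Integrable (F θ) := by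
    rw [hF]
    exact ((hmp θ).integrable_comp_emb (hemb θ)).2 hint
  have hcont : Continuous (Function.uncurry F) := by
    have h1 : Continuous fun p : ℝ × j.Space => Complex.exp (p.1 * Complex.I) • p.2 := by fun_prop
    exact (hf.continuous.comp h1).mul (hρ.comp continuous_snd)
  have hprod : Integrable (Function.uncurry F) (μ.prod volume) := by
    rw [integrable_prod_iff hcont.aestronglyMeasurable]
    refine ⟨Filter.Eventually.of_forall hFint, ?_⟩
    simp only [Function.uncurry, hFn]
    exact integrable_const _
  have hswap := integral_integral_swap hprod
  simp only [hFi] at hswap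
  simp only [F, integral_mul_const, hμ, integral_circle_smul j hf] at hswap
  rw [integral_const_mul] at hswap
  simp only [integral_const, measureReal_restrict_apply_univ, Real.volume_real_Ioc, sub_zero,
    Complex.real_smul, max_eq_left (by positivity : 0 ≤ 2 * Real.pi)] at hswap
  push_cast at hswap
  have : (2 * Real.pi : ℂ) ≠ 0 := by simp [Real.pi_ne_zero]
  exact mul_left_cancel₀ this (by linear_combination hswap)

end MeanValue

/-! ### The reproducing property -/

section Reproducing

variable [FiniteDimensional ℝ V] (j : PCCS Ω) (hbar : ℝ)

lemma finrank_real_space : Module.finrank ℝ j.Space = 2 * Module.finrank ℂ j.Space :=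
  finrank_real_of_complex j.Space

lemma fockDensity_smul (c : ℂ) (hc : ‖c‖ = 1) (z : j.Space) :
    fockDensity j hbar (c • z) = fockDensity j hbar z := by
  rw [fockDensity, norm_smul, hc, one_mul, fockDensity]

lemma continuous_fockDensity : Continuous (fockDensity j hbar) := by
  unfold fockDensity
  fun_prop

variable [hpos : Fact (0 < hbar)]

lemma integral_fockDensity : ∫ z, fockDensity j hbar z = 1 := by
  have hb := hpos.out
  have hpi := Real.pi_pos
  unfold fockDensity
  rw [integral_const_mul]
  have h := GaussianFourier.integral_rexp_neg_mul_sq_norm (V := j.Space)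
    (b := 1 / (2 * hbar)) (by positivity)
  have e : (fun z : j.Space => Real.exp (-‖z‖ ^ 2 / (2 * hbar)))
      = fun z => Real.exp (-(1 / (2 * hbar)) * ‖z‖ ^ 2) := by
    ext z
    congr 1
    ring
  rw [e, h, finrank_real_space]
  have e2 : Real.pi / (1 / (2 * hbar)) = 2 * Real.pi * hbar := by
    field_simp
  rw [e2]
  push_cast
  rw [mul_div_cancel_left₀ _ (by norm_num : (2 : ℝ) ≠ 0), Real.rpow_natCast]
  exact inv_mul_cancel₀ (by positivity)

lemma integral_fockMeasure (f : j.Space → ℂ) :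
    ∫ z, f z ∂(fockMeasure j hbar) = ∫ z, f z * (fockDensity j hbar z : ℂ) := by
  rw [fockMeasure, integral_withDensity_eq_integral_toReal_smul
    (measurable_fockDensity j hbar).ennreal_ofReal (by simp)]
  congr 1
  ext z
  rw [ENNReal.toReal_ofReal (fockDensity_pos j hpos.out _).le, Complex.real_smul, mul_comm]

/-- Finiteness of the measure puts L² inside L¹, so the mean value property applies to every Fock
function. -/
instance : IsProbabilityMeasure (fockMeasure j hbar) where
  measure_univ := by
    -- The integral of a non-integrable function is 0 by convention, whereas this one is 1.
    have h0 : Integrable (fockDensity j hbar) := by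
      by_contra h
      have := integral_fockDensity j hbar
      rw [integral_undef h] at this
      norm_num at this
    rw [fockMeasure, withDensity_apply _ MeasurableSet.univ, Measure.restrict_univ,
      ← ofReal_integral_eq_lintegral_ofReal h0
        (Filter.Eventually.of_forall fun z => (fockDensity_pos j hpos.out z).le),
      integral_fockDensity]
    simp

lemma integrable_fockMeasure_iff (f : j.Space → ℂ) :
    Integrable f (fockMeasure j hbar) ↔ Integrable fun z => f z * (fockDensity j hbar z : ℂ) := by
  rw [fockMeasure, integrable_withDensity_iff_integrable_smul'
    (measurable_fockDensity j hbar).ennreal_ofReal (by simp)]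
  simp_rw [ENNReal.toReal_ofReal (fockDensity_pos j hpos.out _).le, Complex.real_smul, mul_comm]

lemma integral_fock (f : Fock j hbar) : ∫ z, f.1 z ∂(fockMeasure j hbar) = f.1 0 := by
  have hi : Integrable f.1 (fockMeasure j hbar) := f.2.2.integrable (by norm_num)
  rw [integral_fockMeasure, integral_mul_of_rotation_invariant j
    (ρ := fun z => (fockDensity j hbar z : ℂ)) f.2.1
    (Complex.continuous_ofReal.comp (continuous_fockDensity j hbar))
    (fun c hc z => by rw [fockDensity_smul j hbar c hc])
    ((integrable_fockMeasure_iff j hbar _).1 hi), integral_complex_ofReal, integral_fockDensity]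
  simp

lemma inner_coherent_zero (f : Fock j hbar) : inner ℂ (coherent j hbar 0) f = f.1 0 := by
  rw [Fock.inner_eq_integral, ← integral_fock]
  simp [coherent, PCCS.herm]

/-- The scalar in `U_j(a) e_v = s e_{v+a}`. -/
def shiftFactor (a v : j.Space) : ℂ :=
  Complex.exp (-(‖a‖ : ℂ) ^ 2 / (4 * hbar) - j.herm a v / (2 * hbar))

/-- The translation `U_j(a,0)`. -/
def fockShift (a : j.Space) : Fock j hbar ≃ₗᵢ[ℂ] Fock j hbar := fockRep j hbar ⟨j.down a, 0⟩

lemma fockShift_apply (a : j.Space) (f : Fock j hbar) (z : j.Space) :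
    (fockShift j hbar a f).1 z
      = Complex.exp (j.herm z a / (2 * hbar) - (‖a‖ : ℂ) ^ 2 / (4 * hbar)) * f.1 (z - a) := by
  change Complex.exp (-(Complex.I * ((0 : ℝ) : ℂ)) / hbar + j.herm z a / (2 * hbar)
    - (‖a‖ : ℂ) ^ 2 / (4 * hbar)) * f.1 (z - a) = _
  simp

lemma fockShift_coherent (a v : j.Space) :
    fockShift j hbar a (coherent j hbar v) = shiftFactor j hbar a v • coherent j hbar (v + a) := by
  ext z
  rw [fockShift_apply]
  change _ * Complex.exp _ = Complex.exp _ * Complex.exp _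
  rw [← Complex.exp_add, ← Complex.exp_add, PCCS.herm_sub_left, PCCS.herm_add_right]
  congr 1
  ring

/-- The reproducing property of the coherent states. -/
lemma inner_coherent (v : j.Space) (f : Fock j hbar) :
    inner ℂ (coherent j hbar v) f = f.1 v := by
  -- Translation by -v carries e_v to a multiple of e_0 = 1, for which the claim is the mean value
  -- property.
  have h := (fockShift j hbar (-v)).inner_map_map (coherent j hbar v) f
  rw [fockShift_coherent, add_neg_cancel, inner_smul_left, inner_coherent_zero,
    fockShift_apply] at h
  rw [← h, shiftFactor, ← Complex.exp_conj, ← mul_assoc, ← Complex.exp_add, PCCS.herm_neg_left,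
    PCCS.herm_zero_left, PCCS.herm_self]
  have e : (starRingEnd ℂ) (-(‖-v‖ : ℂ) ^ 2 / (4 * hbar) - -(‖v‖ : ℂ) ^ 2 / (2 * hbar))
      + (0 / (2 * hbar) - (‖-v‖ : ℂ) ^ 2 / (4 * hbar)) = 0 := by
    simp only [norm_neg, map_sub, map_div₀, map_neg, map_pow, Complex.conj_ofReal, map_mul,
      map_ofNat]
    ring
  rw [e]
  simp

/-- Cauchy–Schwarz with ‖e_z‖² = e_z(z) = exp(|z|²/2ħ). Point evaluations are thus bounded uniformly
on balls. -/
lemma norm_apply_le (f : Fock j hbar) (z : j.Space) :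
    ‖f.1 z‖ ≤ Real.exp (‖z‖ ^ 2 / (4 * hbar)) * ‖f‖ := by
  rw [← inner_coherent]
  refine (norm_inner_le_norm _ _).trans (mul_le_mul_of_nonneg_right (le_of_eq ?_) (norm_nonneg _))
  have h : ((‖coherent j hbar z‖ : ℂ)) ^ 2 = ((Real.exp (‖z‖ ^ 2 / (4 * hbar)) ^ 2 : ℝ) : ℂ) := by
    have := inner_self_eq_norm_sq_to_K (𝕜 := ℂ) (coherent j hbar z)
    rw [inner_coherent] at this
    rw [← Real.exp_nat_mul]
    refine this.symm.trans ?_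
    change Complex.exp (j.herm z z / (2 * hbar)) = _
    rw [PCCS.herm_self]
    push_cast
    congr 1
    ring
  rw [← sq_eq_sq₀ (norm_nonneg _) (Real.exp_pos _).le]
  exact_mod_cast h

end Reproducing

/-! ### Limits of holomorphic functions -/

/-- A Cauchy estimate on the unit ball; the factor 2 comes from bounding f(w) - f(z) instead of
f(w). -/
lemma norm_fderiv_le_of_norm_le {E : Type*} [NormedAddCommGroup E] [NormedSpace ℂ E] {f : E → ℂ}
    (hf : Differentiable ℂ f) {z : E} {C : ℝ} (hC : ∀ w ∈ Metric.ball z 1, ‖f w‖ ≤ C) :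
    ‖fderiv ℂ f z‖ ≤ 2 * C := by
  have h := Complex.norm_fderiv_le_div_of_mapsTo_ball (f := f) (c := z) (R₁ := 1)
    (R₂ := 2 * C) hf.differentiableOn
    (fun w hw => by
      rw [mem_closedBall_iff_norm]
      have h1 := hC w hw
      have h2 := hC z (Metric.mem_ball_self one_pos)
      have h3 := norm_sub_le (f w) (f z)
      linarith) one_pos
  simpa using h

/-- By the Cauchy estimate the derivatives are also uniformly Cauchy on unit balls, so the limit may
be differentiated term by term. -/
lemma differentiable_of_uniformCauchy {E : Type*} [NormedAddCommGroup E] [NormedSpace ℂ E]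
    {u : ℕ → E → ℂ} {f : E → ℂ} (hd : ∀ n, Differentiable ℂ (u n))
    (hf : ∀ z, Filter.Tendsto (fun n => u n z) Filter.atTop (nhds (f z)))
    (hC : ∀ R ε : ℝ, 0 < ε → ∃ N, ∀ m ≥ N, ∀ n ≥ N, ∀ w, ‖w‖ ≤ R → ‖u m w - u n w‖ ≤ ε) :
    Differentiable ℂ f := by
  intro z
  have hU : UniformCauchySeqOn (fun n => fderiv ℂ (u n)) Filter.atTop (Metric.ball z 1) := by
    rw [Metric.uniformCauchySeqOn_iff]
    intro ε hε
    -- A unit ball around a point of the unit ball at z lies within radius ‖z‖ + 2. The Cauchy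
    -- estimate doubles ε/4, which stays below ε.
    obtain ⟨N, hN⟩ := hC (‖z‖ + 2) (ε / 4) (by positivity)
    refine ⟨N, fun m hm n hn w hw => ?_⟩
    rw [dist_eq_norm, ← fderiv_sub (hd m w) (hd n w)]
    refine (norm_fderiv_le_of_norm_le ((hd m).sub (hd n)) (C := ε / 4)
      fun x hx => hN m hm n hn x ?_).trans_lt (by linarith)
    rw [mem_ball_iff_norm] at hw hx
    have h1 := norm_le_norm_add_norm_sub' w z
    have h2 := norm_le_norm_add_norm_sub' x w
    linarith
  have hlim : ∀ w ∈ Metric.ball z 1, ∃ L, Filter.Tendsto (fun n => fderiv ℂ (u n) w)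
      Filter.atTop (nhds L) := fun w hw => cauchySeq_tendsto_of_complete (hU.cauchySeq hw)
  choose! L hL using hlim
  exact (hasFDerivAt_of_tendstoUniformlyOn Metric.isOpen_ball
    (hU.tendstoUniformlyOn_of_tendsto fun w hw => hL w hw)
    (fun n w _ => (hd n w).hasFDerivAt) (fun w _ => hf w)
    (Metric.mem_ball_self one_pos)).differentiableAt

/-! ### Completeness of the Fock space -/

section Complete

variable [FiniteDimensional ℝ V] (j : PCCS Ω) (hbar : ℝ) [hpos : Fact (0 < hbar)]

/-- The topology of the Fock space is the one of its norm, not the one of pointwise convergence. -/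
instance : UniformSpace (Fock j hbar) := PseudoMetricSpace.toUniformSpace

instance : TopologicalSpace (Fock j hbar) := UniformSpace.toTopologicalSpace

lemma Fock.norm_toLp (f : Fock j hbar) : ‖Fock.toLp j hbar f‖ = ‖f‖ := rfl

lemma cauchySeq_fock_apply {u : ℕ → Fock j hbar} (hu : CauchySeq u) (z : j.Space) :
    CauchySeq fun n => (u n).1 z := by
  rw [Metric.cauchySeq_iff] at hu ⊢
  intro ε hε
  obtain ⟨N, hN⟩ := hu (ε / Real.exp (‖z‖ ^ 2 / (4 * hbar))) (by positivity)
  refine ⟨N, fun m hm n hn => ?_⟩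
  have h1 := hN m hm n hn
  rw [dist_eq_norm] at h1 ⊢
  rw [lt_div_iff₀' (Real.exp_pos _)] at h1
  exact (norm_apply_le j hbar (u m - u n) z).trans_lt h1

/-- A norm-Cauchy sequence converges locally uniformly, so its pointwise limit is holomorphic. A
subsequence converges almost everywhere to the L² limit, which is therefore represented by that
holomorphic function. -/
instance : CompleteSpace (Fock j hbar) := by
  refine Metric.complete_of_cauchySeq_tendsto fun u hu => ?_
  have hpt (z : j.Space) := cauchySeq_tendsto_of_complete (cauchySeq_fock_apply j hbar hu z)
  choose f hf using hpt
  have hfd : Differentiable ℂ f := by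
    refine differentiable_of_uniformCauchy (fun n => (u n).2.1) hf fun R ε hε => ?_
    rw [Metric.cauchySeq_iff] at hu
    obtain ⟨N, hN⟩ := hu (ε / Real.exp (R ^ 2 / (4 * hbar))) (by positivity)
    refine ⟨N, fun m hm n hn w hw => ?_⟩
    have h1 := hN m hm n hn
    have hb := hpos.out
    rw [dist_eq_norm, lt_div_iff₀' (Real.exp_pos _)] at h1
    refine (norm_apply_le j hbar (u m - u n) w).trans (le_trans ?_ h1.le)
    gcongr
  have hiso : Isometry (Fock.toLp j hbar) :=
    AddMonoidHomClass.isometry_of_norm _ (Fock.norm_toLp j hbar)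
  obtain ⟨F, hF⟩ := cauchySeq_tendsto_of_complete (hiso.uniformContinuous.comp_cauchySeq hu)
  obtain ⟨ns, hns, hae⟩ := (tendstoInMeasure_of_tendsto_Lp hF).exists_seq_tendsto_ae
  have hcoe : ∀ᵐ z ∂(fockMeasure j hbar), ∀ n, (Fock.toLp j hbar (u n) : j.Space → ℂ) z
      = (u n).1 z := ae_all_iff.2 fun n => MemLp.coeFn_toLp (u n).2.2
  have heq : (F : j.Space → ℂ) =ᵐ[fockMeasure j hbar] f := by
    filter_upwards [hae, hcoe] with z h1 h2
    refine tendsto_nhds_unique h1 (((hf z).comp hns.tendsto_atTop).congr fun n => ?_)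
    exact (h2 _).symm
  let f' : Fock j hbar := ⟨f, hfd, (memLp_congr_ae heq).1 (Lp.memLp F)⟩
  have hf' : Fock.toLp j hbar f' = F := by
    apply Lp.ext
    exact (MemLp.coeFn_toLp f'.2.2).trans heq.symm
  refine ⟨f', ?_⟩
  rw [hiso.isEmbedding.tendsto_nhds_iff, hf']
  exact hF

/-- A vector orthogonal to every e_z vanishes at every z. -/
lemma span_coherent_topologicalClosure :
    (Submodule.span ℂ (Set.range (coherent j hbar))).topologicalClosure = ⊤ := by
  rw [Submodule.topologicalClosure_eq_top_iff, Submodule.eq_bot_iff]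
  intro f hf
  ext z
  rw [← inner_coherent]
  exact (Submodule.mem_orthogonal _ _).1 hf _ (Submodule.subset_span ⟨z, rfl⟩)

end Complete

/-! ### Unitary representations from kernels -/

section Kernel

variable {H : Type*} [NormedAddCommGroup H] [InnerProductSpace ℂ H] [CompleteSpace H]
  {ι : Type*} {G : Type*} [Group G]

lemma denseRange_linearCombination {e : ι → H}
    (he : (Submodule.span ℂ (Set.range e)).topologicalClosure = ⊤) :
    DenseRange (Finsupp.linearCombination ℂ e) := by
  rw [← Finsupp.range_linearCombination] at he
  have := congrArg (fun S : Submodule ℂ H => (S : Set H)) he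
  exact dense_iff_closure_eq.2 this

lemma inner_linearCombination_eq {a b : ι → H}
    (h : ∀ v w, inner ℂ (a v) (a w) = inner ℂ (b v) (b w)) (x y : ι →₀ ℂ) :
    inner ℂ (Finsupp.linearCombination ℂ a x) (Finsupp.linearCombination ℂ a y)
      = inner ℂ (Finsupp.linearCombination ℂ b x) (Finsupp.linearCombination ℂ b y) := by
  simp only [Finsupp.linearCombination_apply, Finsupp.sum, sum_inner, inner_sum, inner_smul_left,
    inner_smul_right, h]

/-- The norm of a linear combination depends only on the Gram matrix, so sending a to b is well
defined and isometric on the span, and extends by density. -/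
lemma exists_isometry_of_inner_eq {a b : ι → H}
    (ha : (Submodule.span ℂ (Set.range a)).topologicalClosure = ⊤)
    (h : ∀ v w, inner ℂ (a v) (a w) = inner ℂ (b v) (b w)) :
    ∃ A : H →L[ℂ] H, (∀ x y, inner ℂ (A x) (A y) = inner ℂ x y) ∧ ∀ v, A (a v) = b v := by
  have hd := denseRange_linearCombination ha
  have hn : ∀ x, ‖Finsupp.linearCombination ℂ b x‖ ≤ 1 * ‖Finsupp.linearCombination ℂ a x‖ := by
    intro x
    rw [one_mul, ← sq_le_sq₀ (norm_nonneg _) (norm_nonneg _), norm_sq_eq_re_inner (𝕜 := ℂ),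
      norm_sq_eq_re_inner (𝕜 := ℂ), inner_linearCombination_eq h]
  have hA := LinearMap.extendOfNorm_eq hd ⟨1, hn⟩
  refine ⟨(Finsupp.linearCombination ℂ b).extendOfNorm (Finsupp.linearCombination ℂ a), ?_, ?_⟩
  · intro x y
    refine hd.induction_on₂ (p := fun x y => inner ℂ ((Finsupp.linearCombination ℂ b).extendOfNorm
      (Finsupp.linearCombination ℂ a) x) ((Finsupp.linearCombination ℂ b).extendOfNorm
      (Finsupp.linearCombination ℂ a) y) = inner ℂ x y)
      (isClosed_eq (by fun_prop) (by fun_prop)) (fun x y => ?_) x y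
    rw [hA, hA, inner_linearCombination_eq h]
  · intro v
    have := hA (Finsupp.single v 1)
    simpa using this

lemma eq_of_inner_total {a : ι → H}
    (ha : (Submodule.span ℂ (Set.range a)).topologicalClosure = ⊤) {A B : H →L[ℂ] H}
    (h : ∀ v w, inner ℂ (a v) (A (a w)) = inner ℂ (a v) (B (a w))) : A = B := by
  have hs : Dense ((Submodule.span ℂ (Set.range a) : Submodule ℂ H) : Set H) := by
    rw [dense_iff_closure_eq, ← Submodule.topologicalClosure_coe, ha]
    rfl
  refine ContinuousLinearMap.ext_on hs ?_
  rintro _ ⟨w, rfl⟩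
  refine hs.eq_of_inner_right ℂ fun v hv => ?_
  induction hv using Submodule.span_induction with
  | mem x hx =>
    obtain ⟨v, rfl⟩ := hx
    exact h v w
  | zero => simp
  | add x y _ _ hx hy => rw [inner_add_left, inner_add_left, hx, hy]
  | smul c x _ hx => rw [inner_smul_left, inner_smul_left, hx]

/-- A family of vectors `φ g v` with `⟨φ g w, φ h v⟩ = ⟨φ 1 w, φ (g⁻¹h) v⟩` comes from a unitary
representation. -/
lemma exists_unitary_of_kernel {φ : G → ι → H}
    (htot : (Submodule.span ℂ (Set.range (φ 1))).topologicalClosure = ⊤)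
    (hφ : ∀ g h w v, inner ℂ (φ g w) (φ h v) = inner ℂ (φ 1 w) (φ (g⁻¹ * h) v)) :
    ∃ U : G →* (H ≃ₗᵢ[ℂ] H), ∀ g v, U g (φ 1 v) = φ g v := by
  have hex (g : G) := exists_isometry_of_inner_eq (a := φ 1) (b := φ g) htot fun v w => by
    rw [hφ g g, inv_mul_cancel]
  choose A hA hAφ using hex
  -- In operator form: A_g* A_h = A_{g⁻¹h}.
  have key (g h : G) (x y : H) : inner ℂ (A g x) (A h y) = inner ℂ x (A (g⁻¹ * h) y) := by
    have : (ContinuousLinearMap.adjoint (A g)).comp (A h) = A (g⁻¹ * h) :=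
      eq_of_inner_total htot fun v w => by
        rw [ContinuousLinearMap.comp_apply, ContinuousLinearMap.adjoint_inner_right, hAφ, hAφ, hAφ,
          hφ]
    rw [← this, ContinuousLinearMap.comp_apply, ContinuousLinearMap.adjoint_inner_right]
  have hone : A 1 = ContinuousLinearMap.id ℂ H :=
    eq_of_inner_total htot fun v w => by simp [hAφ]
  -- At g⁻¹ the relation reads A_{g⁻¹}* A_h = A_{gh}, and with 1 in place of h it reads A_{g⁻¹}* =
  -- A_g. The group law then supplies the inverse of each isometry, hence surjectivity.
  have hmul (g h : G) (y : H) : A (g * h) y = A g (A h y) := by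
    refine ext_inner_left ℂ fun x => ?_
    have h1 := key g⁻¹ h x y
    have h2 := key g⁻¹ 1 x (A h y)
    rw [inv_inv] at h1 h2
    rw [hone, mul_one] at h2
    rw [← h1, ← h2]
    rfl
  refine ⟨MonoidHom.mk' (fun g =>
    { toLinearEquiv := LinearEquiv.ofLinearMap (A g).toLinearMap (A g⁻¹).toLinearMap
        (by ext x; simp [← hmul, hone]) (by ext x; simp [← hmul, hone])
      norm_map' := fun x => by
        change ‖A g x‖ = ‖x‖
        rw [← sq_eq_sq₀ (norm_nonneg _) (norm_nonneg _), norm_sq_eq_re_inner (𝕜 := ℂ),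
          norm_sq_eq_re_inner (𝕜 := ℂ) x, hA] }) fun g h => ?_, fun g v => hAφ g v⟩
  ext x
  exact hmul g h x

end Kernel

/-! ### The Gaussian vectors of a symplectic map -/

section Gaussian

variable [FiniteDimensional ℝ V] (j : PCCS Ω) (hbar : ℝ)

/-- The function `exp (1/4ħ) {2⟨C_g⁻¹z,v⟩_j - ⟨z, Z_{g⁻¹}z⟩_j - ⟨Z_g v,v⟩_j}`. -/
def gaussFun (g : Sp Ω) (v z : j.Space) : ℂ :=
  Complex.exp (1 / (4 * hbar) *
    (2 * j.herm ((j.C g).symm z) v - j.herm z (j.Z g⁻¹ z) - j.herm (j.Z g v) v))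

/-- Z and the second slot of the Hermitian form are both antilinear, so ⟨z, Zw⟩ is complex bilinear
and the function a holomorphic quadratic form. -/
lemma differentiable_herm_Z (g : Sp Ω) : Differentiable ℂ fun z : j.Space => j.herm z (j.Z g z) := by
  let B : j.Space →ₗ[ℂ] j.Space →ₗ[ℂ] ℂ := LinearMap.mk₂ ℂ (fun z w => j.herm z (j.Z g w))
    (fun a b c => j.herm_add_left a b _) (fun c a b => j.herm_smul_left c a _)
    (fun a b c => by rw [map_add, j.herm_add_right])
    (fun c a b => by rw [LinearMap.map_smulₛₗ, j.herm_smul_right]; simp)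
  let B' := LinearMap.toContinuousLinearMap
    ((LinearMap.toContinuousLinearMap (𝕜 := ℂ) (E := j.Space) (F' := ℂ)).toLinearMap.comp B)
  exact B'.differentiable.clm_apply differentiable_id

lemma differentiable_gaussFun (g : Sp Ω) (v : j.Space) :
    Differentiable ℂ (gaussFun j hbar g v) := by
  have h1 : Differentiable ℂ fun z : j.Space => j.herm ((j.C g).symm z) v := by
    have : (fun z : j.Space => j.herm ((j.C g).symm z) v)
        = fun z => j.herm z ((j.C g⁻¹).symm v) := by
      ext z
      rw [j.herm_C_symm_left]
    rw [this]
    exact differentiable_herm j _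
  exact ((((h1.const_mul _).sub (differentiable_herm_Z j g⁻¹)).sub_const _).const_mul _).cexp

lemma integrable_rexp_neg_mul_sq_norm_add_herm {b : ℝ} (hb : 0 < b) (c : ℝ) (p : j.Space) :
    Integrable fun z : j.Space => Real.exp (-b * ‖z‖ ^ 2 + c * (j.herm z p).re) := by
  have h := GaussianFourier.integrable_cexp_neg_mul_sq_norm_add (V := j.Space)
      (b := (b : ℂ)) (by simpa using hb) (c : ℂ) p
  refine h.norm.congr (Filter.Eventually.of_forall fun z => ?_)
  have hre : (inner ℝ p z : ℝ) = (j.herm z p).re := rfl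
  have e2 : (-(b : ℂ) * (‖z‖ : ℂ) ^ 2 + (c : ℂ) * ((inner ℝ p z : ℝ) : ℂ))
      = ((-b * ‖z‖ ^ 2 + c * (j.herm z p).re : ℝ) : ℂ) := by
    rw [hre]; push_cast; ring
  beta_reduce
  rw [Complex.norm_exp]
  erw [e2]
  rw [Complex.ofReal_re]

variable [hpos : Fact (0 < hbar)]

/-- Since Z_{g⁻¹} is strictly contracting, the weight dominates the quadratic exponent: the
integrand is bounded by a constant times exp(-c|z|²/2ħ) times the exponential of a real linear form.
-/
lemma gaussFun_mem (g : Sp Ω) (v : j.Space) : gaussFun j hbar g v ∈ Fock j hbar := by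
  have hb := hpos.out
  have hpi := Real.pi_pos
  have hd := differentiable_gaussFun j hbar g v
  refine ⟨hd, (memLp_fock_iff hd.continuous).2 ?_⟩
  obtain ⟨c, hc, hZ⟩ := j.exists_re_herm_Z_le g
  set p := (j.C g⁻¹).symm v
  set K := ((2 * Real.pi * hbar) ^ Module.finrank ℂ j.Space)⁻¹
    * Real.exp (-(j.herm (j.Z g v) v).re / (2 * hbar)) with hK
  have hK0 : 0 ≤ K := by positivity
  have hi := (integrable_rexp_neg_mul_sq_norm_add_herm j (b := c / (2 * hbar)) (by positivity)
    (1 / hbar) p).const_mul K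
  refine hi.mono' ((hd.continuous.norm.pow 2).mul
    (continuous_fockDensity j hbar)).aestronglyMeasurable (Filter.Eventually.of_forall fun z => ?_)
  rw [Real.norm_of_nonneg (mul_nonneg (sq_nonneg _) (fockDensity_pos j hb z).le)]
  have e : (1 / (4 * hbar) * (2 * j.herm ((j.C g).symm z) v - j.herm z (j.Z g⁻¹ z)
      - j.herm (j.Z g v) v) : ℂ).re
      = 1 / (4 * hbar) * (2 * (j.herm z p).re - (j.herm z (j.Z g⁻¹ z)).re
        - (j.herm (j.Z g v) v).re) := by
    have : (1 / (4 * hbar) : ℂ) = ((1 / (4 * hbar) : ℝ) : ℂ) := by push_cast; ring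
    rw [this, Complex.re_ofReal_mul, j.herm_C_symm_left]
    simp [p]
  rw [gaussFun, fockDensity, Complex.norm_exp, e, ← Real.exp_nat_mul, hK]
  rw [mul_left_comm, ← Real.exp_add, mul_assoc (_ ^ _)⁻¹, ← Real.exp_add]
  refine mul_le_mul_of_nonneg_left (Real.exp_le_exp.2 ?_) (by positivity)
  have h2 := (abs_le.1 (hZ z)).1
  have h3 : 0 ≤ 1 / (2 * hbar) * ((j.herm z (j.Z g⁻¹ z)).re + (1 - c) * ‖z‖ ^ 2) := by
    refine mul_nonneg (by positivity) (by linarith)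
  have h4 : -(j.herm (j.Z g v) v).re / (2 * hbar)
        + (-(c / (2 * hbar)) * ‖z‖ ^ 2 + 1 / hbar * (j.herm z p).re)
      - (((2 : ℕ) : ℝ) * (1 / (4 * hbar) * (2 * (j.herm z p).re - (j.herm z (j.Z g⁻¹ z)).re
        - (j.herm (j.Z g v) v).re)) + -‖z‖ ^ 2 / (2 * hbar))
      = 1 / (2 * hbar) * ((j.herm z (j.Z g⁻¹ z)).re + (1 - c) * ‖z‖ ^ 2) := by
    push_cast
    field_simp
    ring
  linarith

/-- The Gaussian function of `g` as a vector of the Fock space. -/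
def gaussVec (g : Sp Ω) (v : j.Space) : Fock j hbar := ⟨gaussFun j hbar g v, gaussFun_mem j hbar g v⟩

/-- The intertwining relation, tested on coherent states: the scalar is the one of
`fockShift_coherent`. It reduces to C_g⁻¹g = 1 + Z_g, to the same relation for g⁻¹, and to the
symmetry of Z. -/
lemma fockShift_gaussVec (g : Sp Ω) (a v : j.Space) :
    fockShift j hbar (j.act g a) (gaussVec j hbar g v)
      = shiftFactor j hbar a v • gaussVec j hbar g (v + a) := by
  have hb : (hbar : ℂ) ≠ 0 := by exact_mod_cast hpos.out.ne'
  ext z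
  rw [fockShift_apply]
  change _ * Complex.exp _ = Complex.exp _ * Complex.exp _
  rw [← Complex.exp_add, ← Complex.exp_add]
  congr 1
  set b := j.act g a with hbdef
  have h1 : j.herm ((j.C g).symm b) v = j.herm a v + j.herm (j.Z g a) v := by
    rw [hbdef, j.C_symm_act, j.herm_add_left]
  have h2 : j.herm z b + j.herm z (j.Z g⁻¹ b) = j.herm ((j.C g).symm z) a := by
    rw [← j.herm_add_right, hbdef, j.act_add_Z_inv, j.herm_C_symm_left]
  have h3 : j.herm b b + j.herm b (j.Z g⁻¹ b) = j.herm a a + j.herm (j.Z g a) a := by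
    rw [← j.herm_add_right, hbdef, j.act_add_Z_inv, ← j.herm_C_symm_left, j.C_symm_act,
      j.herm_add_left]
  have h4 : j.herm b (j.Z g⁻¹ z) = j.herm z (j.Z g⁻¹ b) := j.Z_symm g⁻¹ b z
  have h5 : j.herm (j.Z g v) a = j.herm (j.Z g a) v := by
    rw [← j.herm_conj, j.Z_symm, j.herm_conj]
  rw [map_sub, map_add, map_sub, j.herm_sub_left, j.herm_sub_left, j.herm_sub_right,
    j.herm_sub_right, j.herm_add_right, j.herm_add_left, j.herm_add_right, j.herm_add_right, h1, h4,
    h5, ← j.herm_self, ← j.herm_self]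
  field_simp
  linear_combination 4 * h2 - 2 * h3

end Gaussian

/-! ### Complex Gaussian integrals -/

section GaussianIntegral

open Matrix

variable {ι : Type*} [Fintype ι] [DecidableEq ι]

open scoped MatrixOrder ComplexOrder in
lemma posDef_eq_conjTranspose_mul_self {H : Matrix ι ι ℂ} (hH : H.PosDef) :
    ∃ B : Matrix ι ι ℂ, IsUnit B.det ∧ H = Bᴴ * B := by
  obtain ⟨B, hB⟩ := CStarAlgebra.nonneg_iff_eq_star_mul_self.mp hH.posSemidef.nonneg
  refine ⟨B, ?_, hB⟩
  have h1 : IsUnit H.det := (Matrix.isUnit_iff_isUnit_det _).1 hH.isUnit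
  rw [hB, det_mul] at h1
  exact isUnit_of_mul_isUnit_right h1

open scoped ComplexOrder in
/-- A matrix with positive definite real part is diagonalised by a congruence. -/
lemma exists_congruence_diagonal {A : Matrix ι ι ℂ}
    (hA : ∀ x : ι → ℂ, x ≠ 0 → 0 < (star x ⬝ᵥ A *ᵥ x).re) :
    ∃ (Q : Matrix ι ι ℂ) (d : ι → ℝ), Q.det ≠ 0 ∧
      A = Qᴴ * diagonal (fun k => 1 + Complex.I * d k) * Q := by
  -- A = H + iK with H and K Hermitian and H = B*B positive. Diagonalising (B⁻¹)*KB⁻¹ = U d U* gives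
  -- Q = U*B.
  set H := (1 / 2 : ℂ) • (A + Aᴴ) with hHdef
  set K := (-Complex.I / 2) • (A - Aᴴ) with hKdef
  have hAHK : A = H + Complex.I • K := by
    rw [hHdef, hKdef, smul_smul, show Complex.I * (-Complex.I / 2) = 1 / 2 by
      rw [mul_div_assoc', mul_neg, Complex.I_mul_I]; norm_num, ← smul_add]
    rw [show A + Aᴴ + (A - Aᴴ) = (2 : ℂ) • A by rw [two_smul]; abel, smul_smul]
    norm_num
  have hHh : H.IsHermitian := by
    rw [Matrix.IsHermitian, hHdef, conjTranspose_smul, conjTranspose_add, conjTranspose_conjTranspose,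
      add_comm]
    simp
  have hKh : K.IsHermitian := by
    rw [Matrix.IsHermitian, hKdef, conjTranspose_smul, conjTranspose_sub, conjTranspose_conjTranspose,
      ← neg_sub A, smul_neg, ← neg_smul]
    congr 1
    simp [neg_div]
  have hconj (x : ι → ℂ) : star x ⬝ᵥ Aᴴ *ᵥ x = star (star x ⬝ᵥ A *ᵥ x) := by
    rw [star_dotProduct, star_mulVec, conjTranspose_conjTranspose, ← dotProduct_mulVec]
  have hHp : H.PosDef := by
    refine .of_dotProduct_mulVec_pos hHh fun x hx => ?_
    have e : star x ⬝ᵥ H *ᵥ x = (((star x ⬝ᵥ A *ᵥ x).re : ℝ) : ℂ) := by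
      rw [hHdef, smul_mulVec, dotProduct_smul, add_mulVec, dotProduct_add, hconj, Complex.star_def,
        Complex.add_conj]
      simp
    rw [e]
    exact_mod_cast hA x hx
  obtain ⟨B, hBu, hB⟩ := posDef_eq_conjTranspose_mul_self hHp
  set K' := (B⁻¹)ᴴ * K * B⁻¹ with hK'def
  have hK'h : K'.IsHermitian := isHermitian_conjTranspose_mul_mul _ hKh
  have hBB : B⁻¹ * B = 1 := nonsing_inv_mul _ hBu
  have hK : K = Bᴴ * K' * B := by
    have h2 : Bᴴ * (B⁻¹)ᴴ = 1 := by rw [← conjTranspose_mul, hBB, conjTranspose_one]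
    calc K = (Bᴴ * (B⁻¹)ᴴ) * K * (B⁻¹ * B) := by rw [h2, hBB, one_mul, mul_one]
      _ = _ := by rw [hK'def]; simp only [Matrix.mul_assoc]
  set U : Matrix ι ι ℂ := (hK'h.eigenvectorUnitary : Matrix ι ι ℂ) with hU
  have hUU : U * Uᴴ = 1 := by
    have := Unitary.coe_mul_star_self hK'h.eigenvectorUnitary
    exact this
  have hsp : K' = U * diagonal (fun k => (hK'h.eigenvalues k : ℂ)) * Uᴴ := by
    have := hK'h.spectral_theorem
    rw [Unitary.conjStarAlgAut_apply] at this
    exact this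
  refine ⟨Uᴴ * B, hK'h.eigenvalues, ?_, ?_⟩
  · rw [det_mul, mul_ne_zero_iff]
    refine ⟨fun h => ?_, hBu.ne_zero⟩
    have := congrArg det hUU
    rw [det_mul, h] at this
    simp at this
  · have hd : diagonal (fun k => 1 + Complex.I * (hK'h.eigenvalues k : ℂ))
        = 1 + Complex.I • diagonal (fun k => (hK'h.eigenvalues k : ℂ)) := by
      rw [← diagonal_one, ← diagonal_smul, diagonal_add]
      rfl
    rw [hd, conjTranspose_mul, conjTranspose_conjTranspose, Matrix.mul_add, Matrix.add_mul, mul_one]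
    rw [show Bᴴ * U * (Uᴴ * B) = Bᴴ * (U * Uᴴ) * B by simp only [Matrix.mul_assoc], hUU, mul_one,
      ← hB]
    rw [mul_smul_comm, smul_mul_assoc, hAHK]
    congr 2
    rw [hK]
    refine (congrArg (fun X => Bᴴ * X * B) hsp).trans ?_
    simp only [Matrix.mul_assoc]

lemma integral_cexp_neg_sum_mul_normSq {c : ι → ℂ} (hc : ∀ k, 0 < (c k).re) :
    ∫ w : ι → ℂ, Complex.exp (-∑ k, c k * (‖w k‖ : ℂ) ^ 2) = ∏ k, Real.pi / c k := by
  simp_rw [← Finset.sum_neg_distrib, Complex.exp_sum]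
  rw [integral_fintype_prod_volume_eq_prod fun k (w : ℂ) => Complex.exp (-(c k * (‖w‖ : ℂ) ^ 2))]
  refine Finset.prod_congr rfl fun k _ => ?_
  have := GaussianFourier.integral_cexp_neg_mul_sq_norm (V := ℂ) (hc k)
  simp only [neg_mul] at this
  rw [this, Complex.finrank_real_complex]
  norm_num

/-- The real Jacobian of a complex matrix is the squared modulus of its determinant. -/
lemma integral_comp_mulVec {Q : Matrix ι ι ℂ} (hQ : Q.det ≠ 0) (F : (ι → ℂ) → ℂ) :
    ∫ z, F (Q *ᵥ z) = ((Complex.normSq Q.det)⁻¹ : ℝ) * ∫ w, F w := by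
  let f : (ι → ℂ) →ₗ[ℝ] (ι → ℂ) := (Matrix.toLin' Q).restrictScalars ℝ
  have hdet : LinearMap.det f = Complex.normSq Q.det := by
    rw [LinearMap.det_restrictScalars, LinearMap.det_toLin', Algebra.norm_complex_apply]
  have hpos : 0 < Complex.normSq Q.det := Complex.normSq_pos.2 hQ
  have hmap := Measure.map_linearMap_addHaar_eq_smul_addHaar (volume : Measure (ι → ℂ)) (f := f)
    (by rw [hdet]; exact hpos.ne')
  have hemb : MeasurableEmbedding f := by
    let e : (ι → ℂ) ≃ₗ[ℝ] (ι → ℂ) := LinearEquiv.ofIsUnitDet (f := f)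
      (v := Module.finBasis ℝ (ι → ℂ)) (v' := Module.finBasis ℝ (ι → ℂ)) (by
        rw [LinearMap.det_toMatrix, hdet]; exact hpos.ne'.isUnit)
    exact e.toContinuousLinearEquiv.toHomeomorph.measurableEmbedding
  have h := hemb.integral_map (μ := (volume : Measure (ι → ℂ))) F
  rw [hmap, integral_smul_measure, hdet, abs_of_pos (inv_pos.2 hpos),
    ENNReal.toReal_ofReal (inv_pos.2 hpos).le, Complex.real_smul] at h
  exact h.symm

/-- A congruence splits the integral into planar Gaussians, and its Jacobian is the |det Q|²
occurring in det A. Because the exponent is sesquilinear, each plane contributes a full factor 1/(1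
+ i d_k) and no square root has to be chosen. -/
lemma integral_cexp_neg_dotProduct_mulVec {A : Matrix ι ι ℂ}
    (hA : ∀ x : ι → ℂ, x ≠ 0 → 0 < (star x ⬝ᵥ A *ᵥ x).re) :
    ∫ z : ι → ℂ, Complex.exp (-(star z ⬝ᵥ A *ᵥ z)) = Real.pi ^ Fintype.card ι / A.det := by
  obtain ⟨Q, d, hQ, rfl⟩ := exists_congruence_diagonal hA
  have e (z : ι → ℂ) : star z ⬝ᵥ (Qᴴ * diagonal (fun k => 1 + Complex.I * (d k : ℂ)) * Q) *ᵥ z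
      = ∑ k, (1 + Complex.I * (d k : ℂ)) * (‖(Q *ᵥ z) k‖ : ℂ) ^ 2 := by
    rw [Matrix.mul_assoc, ← mulVec_mulVec, ← mulVec_mulVec, dotProduct_mulVec, ← star_mulVec,
      dotProduct]
    refine Finset.sum_congr rfl fun k _ => ?_
    rw [mulVec_diagonal, ← Complex.mul_conj', Pi.star_apply, Complex.star_def]
    ring
  simp_rw [e]
  rw [integral_comp_mulVec hQ fun w => Complex.exp (-∑ k, (1 + Complex.I * (d k : ℂ))
    * (‖w k‖ : ℂ) ^ 2), integral_cexp_neg_sum_mul_normSq (by simp), det_mul, det_mul, det_diagonal,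
    det_conjTranspose, Finset.prod_div_distrib, Finset.prod_const, Finset.card_univ,
    Complex.star_def]
  have h1 : (Complex.normSq Q.det : ℂ) = conj Q.det * Q.det := Complex.normSq_eq_conj_mul_self
  push_cast
  rw [h1]
  have h2 : conj Q.det ≠ 0 := by simpa using hQ
  field_simp

end GaussianIntegral

/-! ### Coordinate-free Gaussian integrals on (V,j). -/

section GaussianIntegral

variable [FiniteDimensional ℝ V] (j : PCCS Ω)

/-- Uniqueness of Haar measure up to a scalar. That c does not depend on F is what allows it to be
computed later from a single integral. -/
lemma exists_coordinates_integral : ∃ c : ℝ, ∀ F : (Fin (Module.finrank ℂ j.Space) → ℂ) → ℂ,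
    ∫ z : j.Space, F ((stdOrthonormalBasis ℂ j.Space).toBasis.equivFun z) = c * ∫ w, F w := by
  let e := (stdOrthonormalBasis ℂ j.Space).toBasis.equivFun.toContinuousLinearEquiv
  have hmap : ((volume : Measure j.Space).map e).IsAddHaarMeasure :=
    e.isAddHaarMeasure_map volume
  have h := Measure.isAddLeftInvariant_eq_smul ((volume : Measure j.Space).map e)
    (volume : Measure (Fin (Module.finrank ℂ j.Space) → ℂ))
  refine ⟨(((volume : Measure j.Space).map e).addHaarScalarFactor
    (volume : Measure (Fin (Module.finrank ℂ j.Space) → ℂ)) : NNReal), fun F => ?_⟩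
  have h2 := e.toHomeomorph.measurableEmbedding.integral_map (μ := (volume : Measure j.Space)) F
  refine h2.symm.trans ?_
  change ∫ y, F y ∂((volume : Measure j.Space).map e) = _
  refine (congrArg (fun μ => ∫ y, F y ∂μ) h).trans ?_
  rw [integral_smul_nnreal_measure]
  exact Complex.real_smul

lemma integral_cexp_neg_herm_self :
    ∫ z : j.Space, Complex.exp (-j.herm z z) = Real.pi ^ Module.finrank ℂ j.Space := by
  have h := GaussianFourier.integral_cexp_neg_mul_sq_norm (V := j.Space) (b := 1) (by simp)
  rw [finrank_real_space] at h
  simp only [neg_mul, one_mul, div_one] at h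
  simp_rw [PCCS.herm_self]
  rw [h]
  push_cast
  rw [mul_div_cancel_left₀ _ (by norm_num : (2 : ℂ) ≠ 0), Complex.cpow_natCast]

lemma herm_eq_dotProduct (M : j.Space →ₗ[ℂ] j.Space) (z : j.Space) :
    j.herm (M z) z = dotProduct (star ((stdOrthonormalBasis ℂ j.Space).toBasis.equivFun z))
      (Matrix.mulVec (LinearMap.toMatrix (stdOrthonormalBasis ℂ j.Space).toBasis
        (stdOrthonormalBasis ℂ j.Space).toBasis M)
        ((stdOrthonormalBasis ℂ j.Space).toBasis.equivFun z)) := by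
  have h1 : Matrix.mulVec (LinearMap.toMatrix (stdOrthonormalBasis ℂ j.Space).toBasis
        (stdOrthonormalBasis ℂ j.Space).toBasis M)
        ((stdOrthonormalBasis ℂ j.Space).toBasis.equivFun z)
      = (stdOrthonormalBasis ℂ j.Space).toBasis.equivFun (M z) :=
    LinearMap.toMatrix_mulVec_repr _ _ M z
  rw [h1, ← j.inner_eq, ← (stdOrthonormalBasis ℂ j.Space).repr.inner_map_map]
  rw [PiLp.inner_apply, dotProduct]
  refine Finset.sum_congr rfl fun k _ => ?_
  rw [RCLike.inner_apply, mul_comm]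
  rfl

/-- The Gaussian integral of a complex linear map with positive real part. -/
lemma integral_cexp_neg_herm {M : j.Space →ₗ[ℂ] j.Space}
    (hM : ∀ z, z ≠ 0 → 0 < (j.herm (M z) z).re) :
    ∫ z : j.Space, Complex.exp (-j.herm (M z) z)
      = Real.pi ^ Module.finrank ℂ j.Space / LinearMap.det M := by
  obtain ⟨c, hc⟩ := exists_coordinates_integral j
  set b := stdOrthonormalBasis ℂ j.Space with hb
  have key (M : j.Space →ₗ[ℂ] j.Space) (hM : ∀ z, z ≠ 0 → 0 < (j.herm (M z) z).re) :
      ∫ z : j.Space, Complex.exp (-j.herm (M z) z)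
        = c * (Real.pi ^ Module.finrank ℂ j.Space / LinearMap.det M) := by
    simp_rw [herm_eq_dotProduct j M]
    rw [hc fun w => Complex.exp (-dotProduct (star w) (Matrix.mulVec
      (LinearMap.toMatrix b.toBasis b.toBasis M) w)), integral_cexp_neg_dotProduct_mulVec,
      LinearMap.det_toMatrix, Fintype.card_fin]
    intro x hx
    have := hM (b.toBasis.equivFun.symm x) (by simpa using hx)
    rw [herm_eq_dotProduct, ← hb] at this
    simpa using this
  -- The known integral for M = 1 forces c = 1.
  have h1 := key LinearMap.id fun z hz => by
    rw [LinearMap.id_apply, j.herm_self]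
    have : 0 < ‖z‖ := norm_pos_iff.2 hz
    exact_mod_cast pow_pos this 2
  simp only [LinearMap.id_apply, LinearMap.det_id, div_one] at h1
  rw [integral_cexp_neg_herm_self] at h1
  have hpi : (Real.pi : ℂ) ^ Module.finrank ℂ j.Space ≠ 0 :=
    pow_ne_zero _ (by exact_mod_cast Real.pi_ne_zero)
  have hc1 : (c : ℂ) = 1 := by
    have : (c : ℂ) * (Real.pi : ℂ) ^ Module.finrank ℂ j.Space
      = 1 * (Real.pi : ℂ) ^ Module.finrank ℂ j.Space := by rw [one_mul]; exact h1.symm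
    exact mul_right_cancel₀ hpi this
  rw [key M hM, hc1, one_mul]

end GaussianIntegral

/-! ### Determinants with respect to a complex structure -/

section Det

variable (j : PCCS Ω)

/-- On maps commuting with j, `linPart` only changes the type. Hence `PCCS.det`, which is defined
for all real endomorphisms, is there the usual complex determinant. -/
lemma PCCS.linPart_apply_of_comm {a : V →ₗ[ℝ] V} (ha : ∀ v, a (j.toLin v) = j.toLin (a v))
    (v : j.Space) : j.linPart a v = j.up (a (j.down v)) := by
  apply j.down.injective
  change (1 / 2 : ℝ) • (a (j.down v) - j.toLin (a (j.toLin (j.down v)))) = a (j.down v)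
  rw [ha, j.sq_eq]
  module

/-- The complex determinant of a real linear map commuting with `j`. -/
def PCCS.det (a : V →ₗ[ℝ] V) : ℂ := LinearMap.det (j.linPart a)

lemma PCCS.det_mul {a b : V →ₗ[ℝ] V} (ha : ∀ v, a (j.toLin v) = j.toLin (a v))
    (hb : ∀ v, b (j.toLin v) = j.toLin (b v)) : j.det (a * b) = j.det a * j.det b := by
  rw [PCCS.det, PCCS.det, PCCS.det, ← map_mul]
  congr 1
  ext v
  rw [Module.End.mul_apply, j.linPart_apply_of_comm hb, j.linPart_apply_of_comm ha,
    j.linPart_apply_of_comm fun v => by simp [ha, hb]]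
  rfl

lemma PCCS.det_one : j.det 1 = 1 := by
  rw [PCCS.det, ← map_one (LinearMap.det (M := j.Space) (A := ℂ))]
  congr 1
  ext v
  rw [j.linPart_apply_of_comm (a := 1) fun v => rfl]
  rfl

/-- The underlying real space of `(V,j)`. -/
def PCCS.realEquiv : V ≃ₗ[ℝ] j.Space where
  toFun := j.up
  invFun := j.down
  left_inv _ := rfl
  right_inv _ := rfl
  map_add' _ _ := rfl
  map_smul' r v := by
    change j.up (r • v) = ((r : ℂ) • j.up v)
    apply j.down.injective
    rw [j.down_smul]
    simp

variable [FiniteDimensional ℝ V]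

/-- The right side does not depend on the complex structure, so this compares the moduli of the j-
and j̃-determinants of maps commuting with both. -/
lemma PCCS.normSq_det {a : V →ₗ[ℝ] V} (ha : ∀ v, a (j.toLin v) = j.toLin (a v)) :
    Complex.normSq (j.det a) = LinearMap.det a := by
  rw [PCCS.det, ← Algebra.norm_complex_apply, ← LinearMap.det_restrictScalars,
    ← LinearMap.det_conj a j.realEquiv]
  congr 1
  ext v
  exact j.linPart_apply_of_comm ha v

lemma PCCS.det_eq_conj_of_adjoint {a b : V →ₗ[ℝ] V}
    (h : ∀ v w : j.Space, j.herm (j.linPart a v) w = j.herm v (j.linPart b w)) :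
    j.det b = conj (j.det a) := by
  have hb : j.linPart b = LinearMap.adjoint (j.linPart a) := by
    rw [LinearMap.eq_adjoint_iff]
    intro x y
    rw [j.inner_eq, j.inner_eq, h]
  rw [PCCS.det, PCCS.det, hb]
  set b := stdOrthonormalBasis ℂ j.Space
  rw [← LinearMap.det_toMatrix b.toBasis, ← LinearMap.det_toMatrix b.toBasis,
    LinearMap.toMatrix_adjoint, Matrix.det_conjTranspose]
  rfl

end Det

/-- Determinants of endomorphisms that correspond under an antilinear isomorphism. -/
lemma det_eq_conj_of_semilinear {M N : Type*} [AddCommGroup M] [Module ℂ M] [FiniteDimensional ℂ M]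
    [AddCommGroup N] [Module ℂ N] (e : M ≃ₛₗ[starRingEnd ℂ] N) {f : M →ₗ[ℂ] M} {f' : N →ₗ[ℂ] N}
    (h : ∀ x, e (f x) = f' (e x)) : LinearMap.det f' = conj (LinearMap.det f) := by
  let b := Module.finBasis ℂ M
  -- Coordinates in the transported basis e(b_k); conjugation compensates the antilinearity of e.
  let L : N ≃ₗ[ℂ] (Fin (Module.finrank ℂ M) → ℂ) :=
    { toFun := fun x k => conj (b.repr (e.symm x) k)
      invFun := fun y => e (b.equivFun.symm fun k => conj (y k))
      left_inv := fun x => by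
        simp only [Complex.conj_conj]
        change e (b.equivFun.symm (b.equivFun (e.symm x))) = x
        simp
      right_inv := fun y => by
        ext k
        beta_reduce
        rw [LinearEquiv.symm_apply_apply]
        change conj (b.equivFun (b.equivFun.symm fun k => conj (y k)) k) = y k
        simp only [LinearEquiv.apply_symm_apply, Complex.conj_conj]
      map_add' := fun x y => by
        ext k
        simp
      map_smul' := fun c x => by
        ext k
        simp [LinearEquiv.map_smulₛₗ] }
  let b' := Module.Basis.ofEquivFun L
  have hb' (k) : b' k = e (b k) := by
    apply L.injective
    have h1 : L (b' k) = Pi.single k 1 := by simp [b']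
    rw [h1]
    ext i
    simp [L, Finsupp.single_apply, Pi.single_apply, eq_comm]
  rw [← LinearMap.det_toMatrix b, ← LinearMap.det_toMatrix b', RingHom.map_det]
  congr 1
  ext i k
  rw [LinearMap.toMatrix_apply, hb', ← h]
  simp [b', L, LinearMap.toMatrix_apply]

/-! ### Hermitian structures -/

/-- A real inner product with an orthogonal complex structure. -/
structure HermitianStructure (V : Type*) [AddCommGroup V] [Module ℝ V] where
  form : V →ₗ[ℝ] V →ₗ[ℝ] ℝ
  toLin : V →ₗ[ℝ] V
  symm : ∀ v w, form v w = form w v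
  pos : ∀ v, v ≠ 0 → 0 < form v v
  map_form : ∀ v w, form (toLin v) (toLin w) = form v w
  sq_eq : ∀ v, toLin (toLin v) = -v

/-- The symplectic form `-B(v,Jw)` of a Hermitian structure. -/
def HermitianStructure.symplectic (X : HermitianStructure V) : SymplecticForm V where
  form := -(X.form.compl₂ X.toLin)
  alt v := by
    have h1 := X.map_form v (X.toLin v)
    rw [X.sq_eq, map_neg, X.symm] at h1
    simp only [LinearMap.neg_apply, LinearMap.compl₂_apply]
    linarith
  nondegenerate := by
    constructor
    · intro v hv
      by_contra h
      have := hv (X.toLin v)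
      simp only [LinearMap.neg_apply, LinearMap.compl₂_apply, X.sq_eq, map_neg, neg_neg] at this
      exact (X.pos v h).ne' this
    · intro v hv
      by_contra h
      have := hv (X.toLin v)
      simp only [LinearMap.neg_apply, LinearMap.compl₂_apply, X.map_form, neg_eq_zero] at this
      exact (X.pos v h).ne' this

/-- The complex structure of a Hermitian structure is positive and compatible. -/
def HermitianStructure.pccs (X : HermitianStructure V) : PCCS X.symplectic where
  toLin := X.toLin
  map_form v w := by
    simp only [symplectic, LinearMap.neg_apply, LinearMap.compl₂_apply, X.map_form]
  sq_eq := X.sq_eq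
  pos v hv := by
    simpa only [symplectic, LinearMap.neg_apply, LinearMap.compl₂_apply, X.sq_eq, map_neg,
      neg_neg] using X.pos v hv

lemma HermitianStructure.herm_eq (X : HermitianStructure V) (v w : X.pccs.Space) :
    X.pccs.herm v w = (X.form (X.pccs.down v) (X.pccs.down w) : ℂ)
      + Complex.I * (X.form (X.pccs.down v) (X.toLin (X.pccs.down w)) : ℂ) := by
  have h1 (a b : V) : X.symplectic.form a b = -X.form a (X.toLin b) := rfl
  have h2 : X.pccs.toLin = X.toLin := rfl
  rw [PCCS.herm, h1, h1, h2, X.sq_eq]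
  simp

/-! ### Two commuting complex structures -/

section Twist

variable (j : PCCS Ω) (jt : CompatibleComplexStructure Ω)
  (hcomm : ∀ v, jt.toLin (j.toLin v) = j.toLin (jt.toLin v))

lemma CompatibleComplexStructure.form_left (v w : V) :
    Ω.form (jt.toLin v) w = -Ω.form v (jt.toLin w) := by
  rw [← jt.map_form v (jt.toLin w), jt.sq_eq, map_neg, neg_neg]

/-- The inner product `Ω(v,jw)` with the complex structure `j̃`. -/
def PCCS.twistStructure : HermitianStructure V where
  form := Ω.form.compl₂ j.toLin
  toLin := jt.toLin
  symm v w := j.form_symm v w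
  pos := j.pos
  map_form v w := by
    simp only [LinearMap.compl₂_apply]
    rw [← hcomm, jt.map_form]
  sq_eq := jt.sq_eq

/-- `V` with the complex structure `j̃` and the inner product `Ω(v,jw)`. -/
abbrev PCCS.twist : PCCS (j.twistStructure jt hcomm).symplectic := (j.twistStructure jt hcomm).pccs

lemma PCCS.twist_toLin : (j.twist jt hcomm).toLin = jt.toLin := rfl

lemma PCCS.twist_herm (v w : (j.twist jt hcomm).Space) :
    (j.twist jt hcomm).herm v w
      = (Ω.form ((j.twist jt hcomm).down v) (j.toLin ((j.twist jt hcomm).down w)) : ℂ)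
      + Complex.I * (Ω.form ((j.twist jt hcomm).down v)
        (j.toLin (jt.toLin ((j.twist jt hcomm).down w))) : ℂ) :=
  HermitianStructure.herm_eq _ v w

/-- The projection to `V_+ = {v | j̃v = jv}`. -/
def PCCS.plus : V →ₗ[ℝ] V := (1 / 2 : ℝ) • (1 - j.toLin * jt.toLin)

/-- The projection to `V_- = {v | j̃v = -jv}`. -/
def PCCS.minusProj : V →ₗ[ℝ] V := (1 / 2 : ℝ) • (1 + j.toLin * jt.toLin)

lemma PCCS.plus_apply (v : V) : j.plus jt v = (1 / 2 : ℝ) • (v - j.toLin (jt.toLin v)) := rfl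

lemma PCCS.minusProj_apply (v : V) :
    j.minusProj jt v = (1 / 2 : ℝ) • (v + j.toLin (jt.toLin v)) := rfl

/-- The involution that is `1` on `V_+` and `-1` on `V_-`. -/
def PCCS.sign : V →ₗ[ℝ] V := -(j.toLin * jt.toLin)

lemma PCCS.sign_apply (v : V) : j.sign jt v = -j.toLin (jt.toLin v) := rfl

/-- The `j`-linear part `(a - jaj)/2` of a real linear map. -/
def PCCS.cPart (a : V →ₗ[ℝ] V) : V →ₗ[ℝ] V := (1 / 2 : ℝ) • (a - j.toLin * a * j.toLin)

/-- The `j`-antilinear part `(a + jaj)/2` of a real linear map. -/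
def PCCS.dPart (a : V →ₗ[ℝ] V) : V →ₗ[ℝ] V := (1 / 2 : ℝ) • (a + j.toLin * a * j.toLin)

lemma PCCS.cPart_apply (a : V →ₗ[ℝ] V) (v : V) :
    j.cPart a v = (1 / 2 : ℝ) • (a v - j.toLin (a (j.toLin v))) := rfl

lemma PCCS.dPart_apply (a : V →ₗ[ℝ] V) (v : V) :
    j.dPart a v = (1 / 2 : ℝ) • (a v + j.toLin (a (j.toLin v))) := rfl

/-- The map that is `C_a` on `V_-` and the identity on `V_+`. -/
def PCCS.mPart (a : V →ₗ[ℝ] V) : V →ₗ[ℝ] V := j.plus jt + j.cPart a * j.minusProj jt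

/-- The map that is `C_a` on `V_+` and the identity on `V_-`. -/
def PCCS.pPart (a : V →ₗ[ℝ] V) : V →ₗ[ℝ] V := j.cPart a * j.plus jt + j.minusProj jt

/-- The map that is `a` on `V_-` and the identity on `V_+`. -/
def PCCS.nPart (a : V →ₗ[ℝ] V) : V →ₗ[ℝ] V := j.plus jt + a * j.minusProj jt

lemma PCCS.mPart_apply (a : V →ₗ[ℝ] V) (v : V) :
    j.mPart jt a v = j.plus jt v + j.cPart a (j.minusProj jt v) := rfl

lemma PCCS.pPart_apply (a : V →ₗ[ℝ] V) (v : V) :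
    j.pPart jt a v = j.cPart a (j.plus jt v) + j.minusProj jt v := rfl

lemma PCCS.nPart_apply (a : V →ₗ[ℝ] V) (v : V) :
    j.nPart jt a v = j.plus jt v + a (j.minusProj jt v) := rfl

include hcomm

section Comm

variable {a b : V →ₗ[ℝ] V} (ha : ∀ v, a (jt.toLin v) = jt.toLin (a v))
  (hb : ∀ v, b (jt.toLin v) = jt.toLin (b v))

lemma PCCS.sign_comm (v : V) : j.sign jt (jt.toLin v) = jt.toLin (j.sign jt v) := by
  simp only [sign_apply, ← hcomm, jt.sq_eq, map_neg]

lemma PCCS.plus_comm (v : V) : j.plus jt (jt.toLin v) = jt.toLin (j.plus jt v) := by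
  simp only [plus_apply, ← hcomm, jt.sq_eq, map_neg, map_smul, map_sub]

lemma PCCS.minusProj_comm (v : V) :
    j.minusProj jt (jt.toLin v) = jt.toLin (j.minusProj jt v) := by
  simp only [minusProj_apply, ← hcomm, jt.sq_eq, map_neg, map_smul, map_add]

include ha

lemma PCCS.cPart_comm (v : V) : j.cPart a (jt.toLin v) = jt.toLin (j.cPart a v) := by
  simp only [cPart_apply, ← hcomm, ha, map_smul, map_sub]

lemma PCCS.dPart_comm (v : V) : j.dPart a (jt.toLin v) = jt.toLin (j.dPart a v) := by
  simp only [dPart_apply, ← hcomm, ha, map_smul, map_add]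

lemma PCCS.mPart_comm (v : V) : j.mPart jt a (jt.toLin v) = jt.toLin (j.mPart jt a v) := by
  simp only [mPart_apply, j.plus_comm jt hcomm, j.minusProj_comm jt hcomm,
    j.cPart_comm jt hcomm ha, map_add]

lemma PCCS.pPart_comm (v : V) : j.pPart jt a (jt.toLin v) = jt.toLin (j.pPart jt a v) := by
  simp only [pPart_apply, j.plus_comm jt hcomm, j.minusProj_comm jt hcomm,
    j.cPart_comm jt hcomm ha, map_add]

lemma PCCS.nPart_comm (v : V) : j.nPart jt a (jt.toLin v) = jt.toLin (j.nPart jt a v) := by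
  simp only [nPart_apply, j.plus_comm jt hcomm, j.minusProj_comm jt hcomm, ha, map_add]

/-- On V_- one has a = C_a + D_a, where C_a preserves V_- and D_a, being j-antilinear and j̃-linear,
maps V_- to V_+. The correction is therefore block triangular. -/
lemma PCCS.nPart_eq :
    j.nPart jt a = j.mPart jt a * (1 + j.plus jt * j.dPart a * j.minusProj jt) := by
  ext v
  simp only [Module.End.mul_apply, LinearMap.add_apply, Module.End.one_apply, mPart_apply,
    nPart_apply, plus_apply, minusProj_apply, cPart_apply, dPart_apply, map_add, map_sub, map_smul,
    ← hcomm, ha, j.sq_eq, jt.sq_eq, map_neg]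
  module

/-- The same triangular factorisation with V_+ and V_- exchanged. -/
lemma PCCS.mul_plus_add_minus_eq : a * j.plus jt + j.minusProj jt
    = j.pPart jt a * (1 + j.minusProj jt * j.dPart a * j.plus jt) := by
  ext v
  simp only [Module.End.mul_apply, LinearMap.add_apply, Module.End.one_apply, pPart_apply,
    plus_apply, minusProj_apply, cPart_apply, dPart_apply, map_add, map_sub, map_smul,
    ← hcomm, ha, j.sq_eq, jt.sq_eq, map_neg]
  module

include hb in
lemma PCCS.pPart_mul_mPart :
    j.pPart jt a * j.mPart jt b = j.cPart a * j.plus jt + j.cPart b * j.minusProj jt := by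
  ext v
  simp only [Module.End.mul_apply, LinearMap.add_apply, pPart_apply, mPart_apply,
    plus_apply, minusProj_apply, cPart_apply, map_add, map_sub, map_smul,
    ← hcomm, ha, hb, j.sq_eq, jt.sq_eq, map_neg]
  module

omit ha

lemma PCCS.sign_mul_sign : j.sign jt * j.sign jt = 1 := by
  ext v
  simp only [Module.End.mul_apply, Module.End.one_apply, sign_apply, ← hcomm, map_neg, j.sq_eq,
    jt.sq_eq, neg_neg]

lemma PCCS.det_sign_sq : (j.twist jt hcomm).det (j.sign jt) * (j.twist jt hcomm).det (j.sign jt)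
    = 1 := by
  rw [← PCCS.det_mul _ (j.sign_comm jt hcomm) (j.sign_comm jt hcomm), j.sign_mul_sign jt hcomm,
    PCCS.det_one]

/-- An operator conjugate to its inverse by an involution and having a square root of that kind has
determinant one. -/
lemma PCCS.det_eq_one_of_sign {s r : V →ₗ[ℝ] V} (hs : ∀ v, s (jt.toLin v) = jt.toLin (s v))
    (hr : r = s * s) (h1 : s * (j.sign jt * s * j.sign jt) = 1) :
    (j.twist jt hcomm).det r = 1 := by
  have hε := j.sign_comm jt hcomm
  have hεs : ∀ v, (j.sign jt * s) (jt.toLin v) = jt.toLin ((j.sign jt * s) v) := fun v => by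
    simp only [Module.End.mul_apply, hs, hε]
  have hεsε : ∀ v, (j.sign jt * s * j.sign jt) (jt.toLin v)
      = jt.toLin ((j.sign jt * s * j.sign jt) v) := fun v => by
    simp only [Module.End.mul_apply, hs, hε]
  have h2 := congrArg (j.twist jt hcomm).det h1
  rw [PCCS.det_mul _ hs hεsε, PCCS.det_mul _ hεs hε, PCCS.det_mul _ hε hs, PCCS.det_one] at h2
  rw [hr, PCCS.det_mul _ hs hs]
  linear_combination h2 - (j.twist jt hcomm).det s ^ 2 * j.det_sign_sq jt hcomm

include hb

/-- With N = P_+ b P_- one has N² = 0, so 1 + N/2 is a square root of 1 + N. The involution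
anticommutes with N and so conjugates this root to its inverse. -/
lemma PCCS.det_one_add_plus_minus :
    (j.twist jt hcomm).det (1 + j.plus jt * b * j.minusProj jt) = 1 := by
  refine j.det_eq_one_of_sign jt hcomm (s := 1 + (1 / 2 : ℝ) • (j.plus jt * b * j.minusProj jt))
    (fun v => ?_) ?_ ?_
  · simp only [Module.End.mul_apply, LinearMap.add_apply, Module.End.one_apply,
      LinearMap.smul_apply, j.plus_comm jt hcomm, j.minusProj_comm jt hcomm, hb, map_add, map_smul]
  · ext v
    simp only [Module.End.mul_apply, LinearMap.add_apply, Module.End.one_apply,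
      LinearMap.smul_apply, plus_apply, minusProj_apply, map_add, map_sub, map_smul,
      ← hcomm, hb, j.sq_eq, jt.sq_eq, map_neg]
    module
  · ext v
    simp only [Module.End.mul_apply, LinearMap.add_apply, Module.End.one_apply, sign_apply,
      LinearMap.smul_apply, plus_apply, minusProj_apply, map_add, map_sub, map_smul,
      ← hcomm, hb, j.sq_eq, jt.sq_eq, map_neg]
    module

lemma PCCS.det_one_add_minus_plus :
    (j.twist jt hcomm).det (1 + j.minusProj jt * b * j.plus jt) = 1 := by
  refine j.det_eq_one_of_sign jt hcomm (s := 1 + (1 / 2 : ℝ) • (j.minusProj jt * b * j.plus jt))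
    (fun v => ?_) ?_ ?_
  · simp only [Module.End.mul_apply, LinearMap.add_apply, Module.End.one_apply,
      LinearMap.smul_apply, j.plus_comm jt hcomm, j.minusProj_comm jt hcomm, hb, map_add, map_smul]
  · ext v
    simp only [Module.End.mul_apply, LinearMap.add_apply, Module.End.one_apply,
      LinearMap.smul_apply, plus_apply, minusProj_apply, map_add, map_sub, map_smul,
      ← hcomm, hb, j.sq_eq, jt.sq_eq, map_neg]
    module
  · ext v
    simp only [Module.End.mul_apply, LinearMap.add_apply, Module.End.one_apply, sign_apply,
      LinearMap.smul_apply, plus_apply, minusProj_apply, map_add, map_sub, map_smul,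
      ← hcomm, hb, j.sq_eq, jt.sq_eq, map_neg]
    module

lemma PCCS.det_nPart :
    (j.twist jt hcomm).det (j.nPart jt b) = (j.twist jt hcomm).det (j.mPart jt b) := by
  rw [j.nPart_eq jt hcomm hb, PCCS.det_mul _ (j.mPart_comm jt hcomm hb),
    j.det_one_add_plus_minus jt hcomm (j.dPart_comm jt hcomm hb), mul_one]
  intro v
  change (1 + j.plus jt * j.dPart b * j.minusProj jt) (jt.toLin v)
    = jt.toLin ((1 + j.plus jt * j.dPart b * j.minusProj jt) v)
  simp only [Module.End.mul_apply, LinearMap.add_apply, Module.End.one_apply,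
    j.plus_comm jt hcomm, j.minusProj_comm jt hcomm, j.dPart_comm jt hcomm hb, map_add]

lemma PCCS.det_mul_plus_add_minus :
    (j.twist jt hcomm).det (b * j.plus jt + j.minusProj jt)
      = (j.twist jt hcomm).det (j.pPart jt b) := by
  rw [j.mul_plus_add_minus_eq jt hcomm hb, PCCS.det_mul _ (j.pPart_comm jt hcomm hb),
    j.det_one_add_minus_plus jt hcomm (j.dPart_comm jt hcomm hb), mul_one]
  intro v
  change (1 + j.minusProj jt * j.dPart b * j.plus jt) (jt.toLin v)
    = jt.toLin ((1 + j.minusProj jt * j.dPart b * j.plus jt) v)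
  simp only [Module.End.mul_apply, LinearMap.add_apply, Module.End.one_apply,
    j.plus_comm jt hcomm, j.minusProj_comm jt hcomm, j.dPart_comm jt hcomm hb, map_add]

end Comm

end Twist

/-! ### Determinants of pseudo-unitary maps and of their j-linear parts. -/

section PseudoUnitary

variable [FiniteDimensional ℝ V] (j : PCCS Ω) (jt : CompatibleComplexStructure Ω)
  (hcomm : ∀ v, jt.toLin (j.toLin v) = j.toLin (jt.toLin v)) (g h : pseudoUnitary jt)

/-- The linear map of an element of the pseudo-unitary group. -/
abbrev puLin {jt : CompatibleComplexStructure Ω} (g : pseudoUnitary jt) :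
    V →ₗ[ℝ] V := (g.1.1 : V →ₗ[ℝ] V)

lemma puLin_comm {jt : CompatibleComplexStructure Ω} (g : pseudoUnitary jt) (v : V) :
    (puLin g) (jt.toLin v) = jt.toLin ((puLin g) v) := g.2 v

lemma puLin_form_left {jt : CompatibleComplexStructure Ω} (g : pseudoUnitary jt)
    (v w : V) : Ω.form ((puLin g) v) w = Ω.form v ((puLin g⁻¹) w) := Sp.form_left g.1 v w

lemma puLin_inv_apply {jt : CompatibleComplexStructure Ω} (g : pseudoUnitary jt)
    (v : V) : (puLin g⁻¹) ((puLin g) v) = v := Sp.inv_apply g.1 v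

lemma puLin_apply_inv {jt : CompatibleComplexStructure Ω} (g : pseudoUnitary jt)
    (v : V) : (puLin g) ((puLin g⁻¹) v) = v := Sp.apply_inv g.1 v

include hcomm in
-- The adjoint of C_g for the positive form is C_{g⁻¹}, and the splitting into V_+ and V_- is
-- orthogonal.
lemma PCCS.det_mPart_inv : (j.twist jt hcomm).det (j.mPart jt (puLin g⁻¹))
    = conj ((j.twist jt hcomm).det (j.mPart jt (puLin g))) := by
  refine PCCS.det_eq_conj_of_adjoint _ fun v w => ?_
  rw [PCCS.linPart_apply_of_comm _ (j.mPart_comm jt hcomm (puLin_comm g)),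
    PCCS.linPart_apply_of_comm _ (j.mPart_comm jt hcomm (puLin_comm g⁻¹)), PCCS.twist_herm,
    PCCS.twist_herm]
  simp only [PCCS.down_up, mPart_apply, plus_apply, minusProj_apply, cPart_apply, map_add, map_sub,
    map_smul, ← hcomm, (puLin_comm g), (puLin_comm g⁻¹), j.sq_eq, jt.sq_eq, map_neg, LinearMap.add_apply,
    LinearMap.sub_apply, LinearMap.smul_apply, LinearMap.neg_apply, smul_eq_mul, (puLin_form_left g),
    j.form_left, jt.form_left]
  push_cast
  ring

include hcomm in
-- The Hermitian form preserved by g is indefinite and differs from the positive one by the sign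
-- involution ε. The positive adjoint of g is thus εg⁻¹ε, and ε drops out of the determinant.
lemma PCCS.det_lin_inv : (j.twist jt hcomm).det (puLin g⁻¹)
    = conj ((j.twist jt hcomm).det (puLin g)) := by
  have h1 : (j.twist jt hcomm).det (j.sign jt * (puLin g⁻¹) * j.sign jt)
      = conj ((j.twist jt hcomm).det (puLin g)) := by
    refine PCCS.det_eq_conj_of_adjoint _ fun v w => ?_
    rw [PCCS.linPart_apply_of_comm _ (puLin_comm g), PCCS.linPart_apply_of_comm _ (fun v => by
      simp only [Module.End.mul_apply, PCCS.twist_toLin, j.sign_comm jt hcomm, (puLin_comm g⁻¹)]),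
      PCCS.twist_herm, PCCS.twist_herm]
    simp only [PCCS.down_up, Module.End.mul_apply, sign_apply, map_neg, (puLin_form_left g), j.sq_eq,
      jt.sq_eq, ← hcomm, (puLin_comm g⁻¹), neg_neg]
  have h2 := j.det_sign_sq jt hcomm
  rw [PCCS.det_mul _ (fun v => by
    simp only [Module.End.mul_apply, PCCS.twist_toLin, j.sign_comm jt hcomm, (puLin_comm g⁻¹)])
    (j.sign_comm jt hcomm), PCCS.det_mul _ (j.sign_comm jt hcomm) (puLin_comm g⁻¹)] at h1
  linear_combination h1 - (j.twist jt hcomm).det (puLin g⁻¹) * h2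

include hcomm in
-- Composing g with the map that is g⁻¹ on V_- and 1 on V_+ gives the map that is g on V_+ and 1 on
-- V_-. Up to unipotent factors this expresses the V_+ block of C_g through Det g and the V_- block
-- of C_{g⁻¹}.
lemma PCCS.det_pPart : (j.twist jt hcomm).det (j.pPart jt (puLin g))
    = (j.twist jt hcomm).det (puLin g) * conj ((j.twist jt hcomm).det (j.mPart jt (puLin g))) := by
  rw [← j.det_mul_plus_add_minus jt hcomm (puLin_comm g), ← j.det_mPart_inv jt hcomm,
    ← j.det_nPart jt hcomm (puLin_comm g⁻¹), ← PCCS.det_mul _ (puLin_comm g) (j.nPart_comm jt hcomm (puLin_comm g⁻¹))]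
  congr 1
  ext v
  simp only [Module.End.mul_apply, LinearMap.add_apply, nPart_apply, map_add, (puLin_apply_inv g)]

lemma PCCS.normSq_det_lin : Complex.normSq ((j.twist jt hcomm).det (puLin g)) = 1 := by
  have h1 : (j.twist jt hcomm).det (puLin g⁻¹) * (j.twist jt hcomm).det (puLin g) = 1 := by
    rw [← PCCS.det_mul _ (puLin_comm g⁻¹) (puLin_comm g), ← PCCS.det_one (j.twist jt hcomm)]
    congr 1
    ext v
    exact (puLin_inv_apply g) v
  rw [j.det_lin_inv jt hcomm, ← Complex.normSq_eq_conj_mul_self] at h1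
  exact_mod_cast h1

include hcomm in
lemma PCCS.det_cPart : (j.twist jt hcomm).det (j.cPart (puLin g))
    = (j.twist jt hcomm).det (puLin g) * conj ((j.twist jt hcomm).det (j.mPart jt (puLin g)))
      * (j.twist jt hcomm).det (j.mPart jt (puLin g)) := by
  rw [← j.det_pPart jt hcomm g, ← PCCS.det_mul _ (j.pPart_comm jt hcomm (puLin_comm g))
    (j.mPart_comm jt hcomm (puLin_comm g)), j.pPart_mul_mPart jt hcomm (puLin_comm g) (puLin_comm g)]
  congr 1
  ext v
  simp only [Module.End.mul_apply, LinearMap.add_apply, ← map_add]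
  congr 1
  rw [plus_apply, minusProj_apply]
  module

lemma PCCS.cPart_comm_self (a : V →ₗ[ℝ] V) (v : V) :
    j.cPart a (j.toLin v) = j.toLin (j.cPart a v) := by
  simp only [cPart_apply, j.sq_eq, map_neg, map_smul, map_sub]
  module

lemma PCCS.det_C (g : Sp Ω) :
    LinearMap.det (j.C g : j.Space →ₗ[ℂ] j.Space) = j.det (j.cPart (g.1 : V →ₗ[ℝ] V)) := by
  rw [PCCS.det]
  congr 1
  ext v
  rw [j.linPart_apply_of_comm (j.cPart_comm_self _)]
  rfl

include hcomm in
-- The j- and j̃-determinants of C_g have the same modulus, as their squared moduli are the real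
-- determinant. Over j̃ the two blocks contribute equally, because |Det g| = 1.
lemma PCCS.norm_det_C : ‖LinearMap.det (j.C g.1 : j.Space →ₗ[ℂ] j.Space)‖
    = ‖(j.twist jt hcomm).det (j.mPart jt (puLin g))‖ ^ 2 := by
  rw [← sq_eq_sq₀ (norm_nonneg _) (by positivity), ← Complex.normSq_eq_norm_sq, j.det_C,
    j.normSq_det (j.cPart_comm_self _),
    ← (j.twist jt hcomm).normSq_det (j.cPart_comm jt hcomm (puLin_comm g)), j.det_cPart jt hcomm g,
    Complex.normSq_mul, Complex.normSq_mul, j.normSq_det_lin, Complex.normSq_conj,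
    Complex.normSq_eq_norm_sq]
  ring

lemma PCCS.det_mPart_ne_zero : (j.twist jt hcomm).det (j.mPart jt (puLin g)) ≠ 0 := by
  intro h
  have h1 := j.norm_det_C jt hcomm g
  rw [h] at h1
  have h2 : LinearMap.det (j.C g.1 : j.Space →ₗ[ℂ] j.Space) ≠ 0 :=
    (LinearEquiv.isUnit_det' (j.C g.1)).ne_zero
  apply h2
  simpa using h1

/-! ### The determinant on `V_-` -/

include hcomm in
lemma PCCS.mPart_comm_self (v : V) :
    j.mPart jt (puLin g) (j.toLin v) = j.toLin (j.mPart jt (puLin g) v) := by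
  have hp (v : V) : j.plus jt (j.toLin v) = j.toLin (j.plus jt v) := by
    simp only [plus_apply, hcomm, map_smul, map_sub]
  have hm (v : V) : j.minusProj jt (j.toLin v) = j.toLin (j.minusProj jt v) := by
    simp only [minusProj_apply, hcomm, map_smul, map_add]
  simp only [mPart_apply, hp, hm, j.cPart_comm_self, map_add]

/-- The subspace `V_-` as a complex subspace for `j̃`. -/
def PCCS.twistMinus : Submodule ℂ (j.twist jt hcomm).Space where
  carrier := {v | jt.toLin ((j.twist jt hcomm).down v) = -j.toLin ((j.twist jt hcomm).down v)}
  zero_mem' := by simp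
  add_mem' := by
    intro v w hv hw
    simp only [Set.mem_ofPred_eq, map_add] at *
    rw [hv, hw]
    abel
  smul_mem' := by
    intro z v hv
    simp only [Set.mem_ofPred_eq] at *
    simp only [PCCS.down_smul, PCCS.twist_toLin, map_add, map_smul, hcomm, hv, map_neg, j.sq_eq,
      neg_neg]
    module

/-- The identity of `V_-` as an antilinear map between the two complex structures. -/
def PCCS.minusEquiv : j.minus jt hcomm ≃ₛₗ[starRingEnd ℂ] j.twistMinus jt hcomm where
  toFun v := ⟨(j.twist jt hcomm).up (j.down v.1), v.2⟩
  invFun v := ⟨j.up ((j.twist jt hcomm).down v.1), v.2⟩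
  left_inv _ := rfl
  right_inv _ := rfl
  map_add' _ _ := rfl
  map_smul' c v := by
    apply Subtype.ext
    apply (j.twist jt hcomm).down.injective
    have hv : jt.toLin (j.down v.1) = -j.toLin (j.down v.1) := v.2
    change c.re • j.down v.1 + c.im • j.toLin (j.down v.1)
      = (conj c).re • j.down v.1 + (conj c).im • jt.toLin (j.down v.1)
    rw [hv, Complex.conj_re, Complex.conj_im]
    module

lemma PCCS.mPart_of_mem {v : V} (hv : jt.toLin v = -j.toLin v) (a : V →ₗ[ℝ] V) :
    j.mPart jt a v = j.cPart a v := by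
  have h1 : j.plus jt v = 0 := by
    rw [plus_apply, hv, map_neg, j.sq_eq]; simp
  have h2 : j.minusProj jt v = v := by
    rw [minusProj_apply, hv, map_neg, j.sq_eq]; module
  rw [mPart_apply, h1, h2, zero_add]

include hcomm in
lemma PCCS.mPart_sub_mem (v : V) : jt.toLin (j.mPart jt (puLin g) v - v)
    = -j.toLin (j.mPart jt (puLin g) v - v) := by
  simp only [mPart_apply, plus_apply, minusProj_apply, cPart_apply, map_add, map_sub, map_smul,
    ← hcomm, (puLin_comm g), j.sq_eq, jt.sq_eq, map_neg]
  module

/-- The determinant of a map that is the identity modulo an invariant subspace. -/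
lemma det_eq_det_restrict {M : Type*} [AddCommGroup M] [Module ℂ M] [FiniteDimensional ℂ M]
    {W : Submodule ℂ M} {f : M →ₗ[ℂ] M} (hf : ∀ v ∈ W, f v ∈ W) (h : ∀ v, f v - v ∈ W) :
    LinearMap.det f = LinearMap.det (f.restrict hf) := by
  rw [LinearMap.det_eq_det_mul_det W f hf]
  have : W.mapQ W f hf = LinearMap.id := by
    ext v
    simp only [LinearMap.comp_apply, Submodule.mkQ_apply, Submodule.mapQ_apply, LinearMap.id_apply]
    exact (Submodule.Quotient.eq W).2 (h v)
  rw [this, LinearMap.det_id, mul_one]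

include hcomm in
lemma PCCS.mPart_mem {v : V} (hv : jt.toLin v = -j.toLin v) :
    jt.toLin (j.mPart jt (puLin g) v) = -j.toLin (j.mPart jt (puLin g) v) := by
  have h1 := j.mPart_sub_mem jt hcomm g v
  rw [map_sub, map_sub, hv] at h1
  have : jt.toLin (j.mPart jt (puLin g) v) = (jt.toLin (j.mPart jt (puLin g) v) - -j.toLin v)
    - j.toLin v := by abel
  rw [this, h1]
  abel

/-- Replaces a restriction that makes sense only for group elements by a map defined for every
endomorphism, as smoothness requires. -/
lemma PCCS.det_CMinus_eq_det_mPart :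
    LinearMap.det (j.CMinus jt hcomm g) = j.det (j.mPart jt (puLin g)) := by
  have hc := j.mPart_comm_self jt hcomm g
  have hf : ∀ v ∈ j.minus jt hcomm, j.linPart (j.mPart jt (puLin g)) v ∈ j.minus jt hcomm := by
    intro v hv
    rw [j.linPart_apply_of_comm hc]
    exact j.mPart_mem jt hcomm g hv
  rw [PCCS.det, det_eq_det_restrict hf fun v => by
    rw [j.linPart_apply_of_comm hc]
    exact j.mPart_sub_mem jt hcomm g (j.down v)]
  congr 1
  ext v
  change j.C g.1 v.1 = j.linPart (j.mPart jt (puLin g)) v.1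
  rw [j.linPart_apply_of_comm hc, j.mPart_of_mem jt v.2]
  rfl

/-- Since j̃ = -j on V_-, the identity of V_- is antilinear between the two structures, whence the
conjugate. -/
lemma PCCS.det_CMinus : LinearMap.det (j.CMinus jt hcomm g)
    = conj ((j.twist jt hcomm).det (j.mPart jt (puLin g))) := by
  have hc := j.mPart_comm jt hcomm (puLin_comm g)
  have hf : ∀ v ∈ j.twistMinus jt hcomm,
      (j.twist jt hcomm).linPart (j.mPart jt (puLin g)) v ∈ j.twistMinus jt hcomm := by
    intro v hv
    rw [PCCS.linPart_apply_of_comm _ hc]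
    exact j.mPart_mem jt hcomm g hv
  have h1 : (j.twist jt hcomm).det (j.mPart jt (puLin g))
      = LinearMap.det (((j.twist jt hcomm).linPart (j.mPart jt (puLin g))).restrict hf) := by
    rw [PCCS.det, det_eq_det_restrict hf fun v => by
      rw [PCCS.linPart_apply_of_comm _ hc]
      exact j.mPart_sub_mem jt hcomm g _]
  rw [h1, det_eq_conj_of_semilinear (j.minusEquiv jt hcomm) (f := j.CMinus jt hcomm g),
    Complex.conj_conj]
  intro v
  apply Subtype.ext
  change (j.twist jt hcomm).up (j.cPart (puLin g) (j.down v.1))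
    = (j.twist jt hcomm).linPart (j.mPart jt (puLin g)) ((j.twist jt hcomm).up (j.down v.1))
  rw [PCCS.linPart_apply_of_comm _ hc, PCCS.down_up, j.mPart_of_mem jt v.2]

end PseudoUnitary

/-! ### The operator of the mixed Gaussian integral, and the two Hermitian forms. -/

section Mixed

variable [FiniteDimensional ℝ V] (j : PCCS Ω) (jt : CompatibleComplexStructure Ω)
  (hcomm : ∀ v, jt.toLin (j.toLin v) = j.toLin (jt.toLin v)) (g h : pseudoUnitary jt)

/-- `Z_g` as a real linear map. -/
def PCCS.zPart (g : Sp Ω) : V →ₗ[ℝ] V where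
  toFun v := j.down (j.Z g (j.up v))
  map_add' v w := by rw [map_add, map_add, map_add]
  map_smul' r v := by
    have : j.up (r • v) = (r : ℂ) • j.up v := j.realEquiv.map_smul r v
    rw [this, LinearMap.map_smulₛₗ, PCCS.down_smul]
    simp

lemma PCCS.zPart_apply (g : Sp Ω) (v : V) : j.zPart g v = j.down (j.Z g (j.up v)) := rfl

lemma PCCS.zPart_inv_cPart (g : Sp Ω) (v : V) :
    j.zPart g⁻¹ (j.cPart (g.1 : V →ₗ[ℝ] V) v) = -j.dPart (g.1 : V →ₗ[ℝ] V) v :=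
  j.Z_inv_C g (j.up v)

lemma PCCS.cPart_surjective (g : Sp Ω) : Function.Surjective (j.cPart (g.1 : V →ₗ[ℝ] V)) :=
  (j.C g).surjective

include hcomm in
lemma PCCS.zPart_inv_comm (v : V) : j.zPart g.1⁻¹ (jt.toLin v) = jt.toLin (j.zPart g.1⁻¹ v) := by
  obtain ⟨v, rfl⟩ := j.cPart_surjective g.1 v
  rw [← j.cPart_comm jt hcomm (puLin_comm g), zPart_inv_cPart, zPart_inv_cPart,
    j.dPart_comm jt hcomm (puLin_comm g), map_neg]

lemma PCCS.zPart_anti (g : Sp Ω) (v : V) : j.zPart g (j.toLin v) = -j.toLin (j.zPart g v) := by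
  have h1 (x : V) : j.up (j.toLin x) = Complex.I • j.up x := by
    apply j.down.injective
    rw [j.down_smul]
    simp
  have h2 (x : j.Space) : j.down (Complex.I • x) = j.toLin (j.down x) := by
    rw [j.down_smul]
    simp
  rw [zPart_apply, h1, LinearMap.map_smulₛₗ, Complex.conj_I, neg_smul, map_neg, h2, zPart_apply]

include hcomm in
-- Z anticommutes with j and commutes with j̃, so it exchanges V_+ and V_-.
lemma PCCS.plus_zPart (v : V) :
    j.plus jt (j.zPart g.1⁻¹ v) = j.zPart g.1⁻¹ (j.minusProj jt v) := by
  simp only [plus_apply, minusProj_apply, map_smul, map_add, j.zPart_anti,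
    j.zPart_inv_comm jt hcomm]
  module

include hcomm in
lemma PCCS.minusProj_zPart (v : V) :
    j.minusProj jt (j.zPart g.1⁻¹ v) = j.zPart g.1⁻¹ (j.plus jt v) := by
  simp only [plus_apply, minusProj_apply, map_smul, map_sub, j.zPart_anti,
    j.zPart_inv_comm jt hcomm]
  module

/-- The operator of the Gaussian integral `⟨φ_g, φ_h⟩`. -/
def PCCS.mixed : V →ₗ[ℝ] V :=
  1 + j.plus jt * j.zPart h.1⁻¹ + j.minusProj jt * j.zPart g.1⁻¹

lemma PCCS.mixed_apply (v : V) : j.mixed jt g h v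
    = v + j.plus jt (j.zPart h.1⁻¹ v) + j.minusProj jt (j.zPart g.1⁻¹ v) := rfl

include hcomm in
lemma PCCS.mixed_comm (v : V) : j.mixed jt g h (jt.toLin v) = jt.toLin (j.mixed jt g h v) := by
  simp only [mixed_apply, j.zPart_inv_comm jt hcomm, j.plus_comm jt hcomm,
    j.minusProj_comm jt hcomm, map_add]

include hcomm in
-- From Z_{g⁻¹}C_g = -D_g, the left side is C_g - D_g on V_+ and C_h - D_h on V_-. As C preserves
-- and D exchanges the two subspaces, conjugation by the sign involution turns these into g on V_+
-- and h on V_-.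
lemma PCCS.mixed_mul : j.mixed jt g h * (j.pPart jt (puLin g) * j.mPart jt (puLin h))
    = j.sign jt * (puLin g * j.nPart jt (puLin (g⁻¹ * h))) * j.sign jt := by
  have hk (v : V) : puLin g (puLin (g⁻¹ * h) v) = puLin h v := Sp.apply_inv g.1 _
  rw [j.pPart_mul_mPart jt hcomm (puLin_comm g) (puLin_comm h)]
  ext v
  simp only [Module.End.mul_apply, mixed_apply, j.plus_zPart jt hcomm, j.minusProj_zPart jt hcomm,
    nPart_apply, map_add, hk]
  have h1 : j.minusProj jt ((j.cPart (puLin g) * j.plus jt + j.cPart (puLin h) * j.minusProj jt) v)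
      = j.cPart (puLin h) (j.minusProj jt v) := by
    simp only [Module.End.mul_apply, LinearMap.add_apply, plus_apply, minusProj_apply, cPart_apply,
      map_add, map_sub, map_smul, ← hcomm, puLin_comm, j.sq_eq, jt.sq_eq, map_neg]
    module
  have h2 : j.plus jt ((j.cPart (puLin g) * j.plus jt + j.cPart (puLin h) * j.minusProj jt) v)
      = j.cPart (puLin g) (j.plus jt v) := by
    simp only [Module.End.mul_apply, LinearMap.add_apply, plus_apply, minusProj_apply, cPart_apply,
      map_add, map_sub, map_smul, ← hcomm, puLin_comm, j.sq_eq, jt.sq_eq, map_neg]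
    module
  rw [h1, h2, zPart_inv_cPart, zPart_inv_cPart]
  simp only [Module.End.mul_apply, LinearMap.add_apply, plus_apply, minusProj_apply, cPart_apply,
    dPart_apply, sign_apply, map_add, map_sub, map_smul, ← hcomm, puLin_comm, j.sq_eq, jt.sq_eq,
    map_neg]
  module

lemma PCCS.det_mixed : (j.twist jt hcomm).det (j.mixed jt g h)
    = (j.twist jt hcomm).det (j.mPart jt (puLin (g⁻¹ * h)))
      / (conj ((j.twist jt hcomm).det (j.mPart jt (puLin g)))
        * (j.twist jt hcomm).det (j.mPart jt (puLin h))) := by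
  have hp := j.pPart_comm jt hcomm (puLin_comm g)
  have hm := j.mPart_comm jt hcomm (puLin_comm h)
  have hn := j.nPart_comm jt hcomm (puLin_comm (g⁻¹ * h))
  have hs := j.sign_comm jt hcomm
  have hg := puLin_comm g
  have h1 := congrArg (j.twist jt hcomm).det (j.mixed_mul jt hcomm g h)
  rw [PCCS.det_mul _ (j.mixed_comm jt hcomm g h)
      (fun v => by simp only [Module.End.mul_apply, PCCS.twist_toLin, hp, hm]),
    PCCS.det_mul _ hp hm, j.det_pPart jt hcomm,
    PCCS.det_mul _ (fun v => by simp only [Module.End.mul_apply, PCCS.twist_toLin, hs, hg, hn]) hs,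
    PCCS.det_mul _ hs (fun v => by simp only [Module.End.mul_apply, PCCS.twist_toLin, hg, hn]),
    PCCS.det_mul _ hg hn, j.det_nPart jt hcomm (puLin_comm (g⁻¹ * h))] at h1
  have h2 := j.det_sign_sq jt hcomm
  have h3 : (j.twist jt hcomm).det (puLin g) ≠ 0 := by
    intro h
    have := j.normSq_det_lin jt hcomm g
    rw [h] at this
    simp at this
  have h4 := j.det_mPart_ne_zero jt hcomm g
  have h5 := j.det_mPart_ne_zero jt hcomm h
  have h6 : conj ((j.twist jt hcomm).det (j.mPart jt (puLin g))) ≠ 0 := by simpa using h4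
  rw [eq_div_iff (mul_ne_zero h6 h5)]
  apply mul_left_cancel₀ h3
  linear_combination h1 + (j.twist jt hcomm).det (puLin g)
    * (j.twist jt hcomm).det (j.mPart jt (puLin (g⁻¹ * h))) * h2

/-! ### Comparison of the two Hermitian forms -/

/-- The identity map between the two complex structures on `V`. -/
def PCCS.toTwist (z : j.Space) : (j.twist jt hcomm).Space := (j.twist jt hcomm).up (j.down z)

/-- `V_±`-projections on `(V,j)`. -/
def PCCS.plusSpace (z : j.Space) : j.Space := j.up (j.plus jt (j.down z))

def PCCS.minusSpace (z : j.Space) : j.Space := j.up (j.minusProj jt (j.down z))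

lemma PCCS.plusSpace_add_minusSpace (z : j.Space) : j.plusSpace jt z + j.minusSpace jt z = z := by
  apply j.down.injective
  simp only [map_add, plusSpace, minusSpace, down_up, plus_apply, minusProj_apply]
  module

/-- The two Hermitian forms agree on V_+ and are conjugate to each other on V_-. -/
lemma PCCS.herm_eq_twist (z y : j.Space) : j.herm z y
    = (j.twist jt hcomm).herm (j.toTwist jt hcomm z) (j.toTwist jt hcomm (j.plusSpace jt y))
      + (j.twist jt hcomm).herm (j.toTwist jt hcomm (j.minusSpace jt y)) (j.toTwist jt hcomm z) := by
  rw [← (j.twist jt hcomm).herm_conj (j.toTwist jt hcomm z) (j.toTwist jt hcomm (j.minusSpace jt y)),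
    PCCS.twist_herm, PCCS.twist_herm, PCCS.herm]
  simp only [toTwist, plusSpace, minusSpace, down_up, plus_apply, minusProj_apply, map_add, map_sub,
    map_smul, map_mul, Complex.conj_I, Complex.conj_ofReal, ← hcomm, j.sq_eq, jt.sq_eq, map_neg,
    smul_eq_mul]
  push_cast
  ring

include hcomm

lemma PCCS.plus_plus (v : V) : j.plus jt (j.plus jt v) = j.plus jt v := by
  simp only [plus_apply, map_sub, map_smul, ← hcomm, j.sq_eq, jt.sq_eq, map_neg]
  module

lemma PCCS.minusProj_plus (v : V) : j.minusProj jt (j.plus jt v) = 0 := by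
  simp only [plus_apply, minusProj_apply, map_sub, map_smul, ← hcomm, j.sq_eq, jt.sq_eq, map_neg]
  module

lemma PCCS.plus_minusProj (v : V) : j.plus jt (j.minusProj jt v) = 0 := by
  simp only [plus_apply, minusProj_apply, map_add, map_smul, ← hcomm, j.sq_eq, jt.sq_eq, map_neg]
  module

lemma PCCS.minusProj_minusProj (v : V) : j.minusProj jt (j.minusProj jt v) = j.minusProj jt v := by
  simp only [minusProj_apply, map_add, map_smul, ← hcomm, j.sq_eq, jt.sq_eq, map_neg]
  module

lemma PCCS.herm_plusSpace_left (z y : j.Space) :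
    j.herm (j.plusSpace jt z) y = j.herm z (j.plusSpace jt y) := by
  simp only [PCCS.herm, plusSpace, down_up, plus_apply, map_sub, map_smul, LinearMap.smul_apply,
    LinearMap.sub_apply, j.form_left, jt.form_left, ← hcomm, j.sq_eq, map_neg, neg_neg]

lemma PCCS.herm_minusSpace_left (z y : j.Space) :
    j.herm (j.minusSpace jt z) y = j.herm z (j.minusSpace jt y) := by
  simp only [PCCS.herm, minusSpace, down_up, minusProj_apply, map_add, map_smul,
    LinearMap.smul_apply, LinearMap.add_apply, j.form_left, jt.form_left, ← hcomm, j.sq_eq, map_neg,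
    neg_neg]

lemma PCCS.herm_plus (z y : j.Space) : j.herm z (j.plusSpace jt y)
    = (j.twist jt hcomm).herm (j.toTwist jt hcomm z) (j.toTwist jt hcomm (j.plusSpace jt y)) := by
  have h1 : j.plusSpace jt (j.plusSpace jt y) = j.plusSpace jt y := j.plus_plus jt hcomm _
  have h2 : j.toTwist jt hcomm (j.minusSpace jt (j.plusSpace jt y)) = 0 :=
    j.minusProj_plus jt hcomm _
  rw [j.herm_eq_twist jt hcomm, h1, h2, PCCS.herm_zero_left, add_zero]

lemma PCCS.herm_minus (z y : j.Space) : j.herm z (j.minusSpace jt y)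
    = (j.twist jt hcomm).herm (j.toTwist jt hcomm (j.minusSpace jt y)) (j.toTwist jt hcomm z) := by
  have h1 : j.minusSpace jt (j.minusSpace jt y) = j.minusSpace jt y :=
    j.minusProj_minusProj jt hcomm _
  have h2 : j.toTwist jt hcomm (j.plusSpace jt (j.minusSpace jt y)) = 0 :=
    j.plus_minusProj jt hcomm _
  rw [j.herm_eq_twist jt hcomm, h1, h2, PCCS.herm_zero_right, zero_add]

/-- Z is symmetric and exchanges V_+ and V_-, so the two halves of its quadratic form coincide. -/
lemma PCCS.herm_minus_eq_herm_plus (z : j.Space) :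
    j.herm z (j.minusSpace jt (j.Z g.1⁻¹ z)) = j.herm z (j.plusSpace jt (j.Z g.1⁻¹ z)) := by
  have h1 : j.plusSpace jt (j.Z g.1⁻¹ z) = j.Z g.1⁻¹ (j.minusSpace jt z) :=
    j.plus_zPart jt hcomm g (j.down z)
  rw [h1, j.Z_symm, j.herm_minusSpace_left jt hcomm]

/-- The left side involves only the V_+ component, where the two Hermitian forms agree; this lets a
j-quadratic exponent be read as sesquilinear for j̃. -/
lemma PCCS.two_herm_plus (z : j.Space) :
    2 * j.herm z (j.plusSpace jt (j.Z g.1⁻¹ z)) = j.herm z (j.Z g.1⁻¹ z) := by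
  conv_rhs => rw [← j.plusSpace_add_minusSpace jt (j.Z g.1⁻¹ z), j.herm_add_right,
    j.herm_minus_eq_herm_plus jt hcomm]
  ring

lemma PCCS.two_herm_minus (z : j.Space) :
    2 * j.herm z (j.minusSpace jt (j.Z g.1⁻¹ z)) = j.herm z (j.Z g.1⁻¹ z) := by
  rw [j.herm_minus_eq_herm_plus jt hcomm, j.two_herm_plus jt hcomm]

lemma PCCS.herm_toTwist_self (z : j.Space) :
    (j.twist jt hcomm).herm (j.toTwist jt hcomm z) (j.toTwist jt hcomm z) = (‖z‖ : ℂ) ^ 2 := by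
  rw [← j.herm_self, PCCS.twist_herm, PCCS.herm]
  have h0 : Ω.form (j.down z) (j.down z) = 0 := Ω.alt _
  have h1 : Ω.form (j.down z) (j.toLin (jt.toLin (j.down z))) = 0 := by
    have := j.form_symm (j.down z) (jt.toLin (j.down z))
    rw [jt.form_left, ← hcomm] at this
    rw [← hcomm]
    linarith
  simp only [toTwist, down_up, h0, h1]
  simp

/-- The quadratic exponent in `⟨φ_g, φ_h⟩`. -/
lemma PCCS.herm_mixed (z : j.Space) :
    (j.twist jt hcomm).herm (j.toTwist jt hcomm z)
      ((j.twist jt hcomm).linPart (j.mixed jt g h) (j.toTwist jt hcomm z))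
    = (‖z‖ : ℂ) ^ 2 + j.herm z (j.Z h.1⁻¹ z) / 2 + conj (j.herm z (j.Z g.1⁻¹ z)) / 2 := by
  rw [PCCS.linPart_apply_of_comm _ (j.mixed_comm jt hcomm g h)]
  have e : (j.twist jt hcomm).up (j.mixed jt g h ((j.twist jt hcomm).down (j.toTwist jt hcomm z)))
      = j.toTwist jt hcomm z + j.toTwist jt hcomm (j.plusSpace jt (j.Z h.1⁻¹ z))
        + j.toTwist jt hcomm (j.minusSpace jt (j.Z g.1⁻¹ z)) := rfl
  rw [e, PCCS.herm_add_right, PCCS.herm_add_right, j.herm_toTwist_self jt hcomm, ← j.herm_plus jt hcomm]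
  rw [← (j.twist jt hcomm).herm_conj (j.toTwist jt hcomm (j.minusSpace jt (j.Z g.1⁻¹ z))),
    ← j.herm_minus jt hcomm, ← j.two_herm_plus jt hcomm h, ← j.two_herm_minus jt hcomm g, map_mul,
    map_ofNat]
  ring

/-- Half of each quadratic form enters, and each Z is strictly contracting, so together they cannot
cancel |z|². -/
lemma PCCS.re_herm_mixed_pos (x : (j.twist jt hcomm).Space) (hx : x ≠ 0) :
    0 < ((j.twist jt hcomm).herm ((j.twist jt hcomm).linPart (j.mixed jt g h) x) x).re := by
  obtain ⟨z, hzx⟩ : ∃ z, x = j.toTwist jt hcomm z := ⟨j.up ((j.twist jt hcomm).down x), rfl⟩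
  have hz : 0 < ‖z‖ := norm_pos_iff.2 fun h => hx (by rw [hzx, h]; rfl)
  rw [hzx, ← PCCS.herm_conj, j.herm_mixed jt hcomm, Complex.conj_re]
  obtain ⟨c, hc, h1⟩ := j.exists_re_herm_Z_le g.1
  obtain ⟨d, hd, h2⟩ := j.exists_re_herm_Z_le h.1
  have h3 := (abs_le.1 (h1 z)).1
  have h4 := (abs_le.1 (h2 z)).1
  have e : ((‖z‖ : ℂ) ^ 2 + j.herm z (j.Z h.1⁻¹ z) / 2 + conj (j.herm z (j.Z g.1⁻¹ z)) / 2).re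
      = ‖z‖ ^ 2 + (j.herm z (j.Z h.1⁻¹ z)).re / 2 + (j.herm z (j.Z g.1⁻¹ z)).re / 2 := by
    rw [Complex.add_re, Complex.add_re, Complex.div_ofNat_re, Complex.div_ofNat_re, Complex.conj_re,
      ← Complex.ofReal_pow, Complex.ofReal_re]
  rw [e]
  nlinarith [mul_pos hc (pow_pos hz 2), mul_pos hd (pow_pos hz 2)]

end Mixed

/-! ### The inner product of two Gaussian vectors -/

section KeyIdentity

variable [FiniteDimensional ℝ V] (j : PCCS Ω) (jt : CompatibleComplexStructure Ω)
  (hcomm : ∀ v, jt.toLin (j.toLin v) = j.toLin (jt.toLin v)) (g h : pseudoUnitary jt)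

/-- `toTwist` is an isometry. -/
def PCCS.twistIsometry : j.Space ≃ₗᵢ[ℝ] (j.twist jt hcomm).Space where
  toFun := j.toTwist jt hcomm
  invFun x := j.up ((j.twist jt hcomm).down x)
  left_inv _ := rfl
  right_inv _ := rfl
  map_add' _ _ := rfl
  map_smul' r z := (j.realEquiv.symm.trans (j.twist jt hcomm).realEquiv).map_smul r z
  norm_map' z := by
    rw [← sq_eq_sq₀ (norm_nonneg _) (norm_nonneg _)]
    apply Complex.ofReal_injective
    push_cast
    change ((‖j.toTwist jt hcomm z‖ : ℝ) : ℂ) ^ 2 = _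
    rw [← PCCS.herm_self]
    exact j.herm_toTwist_self jt hcomm z

lemma PCCS.finrank_twist :
    Module.finrank ℂ (j.twist jt hcomm).Space = Module.finrank ℂ j.Space := by
  have h1 := (j.twistIsometry jt hcomm).toLinearEquiv.finrank_eq
  rw [finrank_real_space, finrank_real_space] at h1
  omega

include hcomm in
-- Z sends V_+ into V_-, which is orthogonal to it. This removes the constant term of the exponent
-- in `gaussFun_mul_fockDensity`.
lemma PCCS.herm_Z_inv_of_plus {w : j.Space} (hw : j.plusSpace jt w = w) :
    j.herm w (j.Z g.1⁻¹ w) = 0 := by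
  have h1 := j.two_herm_plus jt hcomm g w
  rw [← j.herm_plusSpace_left jt hcomm, hw] at h1
  linear_combination h1

include hcomm in
lemma PCCS.herm_Z_inv_of_minus {w : j.Space} (hw : j.minusSpace jt w = w) :
    j.herm w (j.Z g.1⁻¹ w) = 0 := by
  have h1 := j.two_herm_minus jt hcomm g w
  rw [← j.herm_minusSpace_left jt hcomm, hw] at h1
  linear_combination h1

include hcomm in
lemma PCCS.herm_Z_of_plus {w : j.Space} (hw : j.plusSpace jt w = w) :
    j.herm (j.Z g.1 w) w = 0 := by
  have h1 := j.herm_Z_inv_of_plus jt hcomm g⁻¹ hw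
  rw [InvMemClass.coe_inv, inv_inv] at h1
  rw [← j.herm_conj, h1, map_zero]

include hcomm in
lemma PCCS.herm_Z_of_minus {w : j.Space} (hw : j.minusSpace jt w = w) :
    j.herm (j.Z g.1 w) w = 0 := by
  have h1 := j.herm_Z_inv_of_minus jt hcomm g⁻¹ hw
  rw [InvMemClass.coe_inv, inv_inv] at h1
  rw [← j.herm_conj, h1, map_zero]

include hcomm in
lemma PCCS.C_plusSpace (z : j.Space) : j.C g.1 (j.plusSpace jt z) = j.plusSpace jt (j.C g.1 z) := by
  apply j.down.injective
  change j.cPart (puLin g) (j.plus jt (j.down z)) = j.plus jt (j.cPart (puLin g) (j.down z))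
  simp only [plus_apply, cPart_apply, map_sub, map_smul, ← hcomm, puLin_comm, j.sq_eq,
    map_neg]
  module

include hcomm in
lemma PCCS.C_minusSpace (z : j.Space) :
    j.C g.1 (j.minusSpace jt z) = j.minusSpace jt (j.C g.1 z) := by
  apply j.down.injective
  change j.cPart (puLin g) (j.minusProj jt (j.down z))
    = j.minusProj jt (j.cPart (puLin g) (j.down z))
  simp only [minusProj_apply, cPart_apply, map_sub, map_add, map_smul, ← hcomm, puLin_comm, j.sq_eq,
    map_neg]
  module

include hcomm in
lemma PCCS.plusSpace_C_symm {z : j.Space} (hz : j.plusSpace jt z = z) :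
    j.plusSpace jt ((j.C g.1).symm z) = (j.C g.1).symm z := by
  apply (j.C g.1).injective
  rw [j.C_plusSpace jt hcomm, LinearEquiv.apply_symm_apply, hz]

include hcomm in
lemma PCCS.minusSpace_C_symm {z : j.Space} (hz : j.minusSpace jt z = z) :
    j.minusSpace jt ((j.C g.1).symm z) = (j.C g.1).symm z := by
  apply (j.C g.1).injective
  rw [j.C_minusSpace jt hcomm, LinearEquiv.apply_symm_apply, hz]

include hcomm in
lemma PCCS.herm_of_plus_of_minus {w v : j.Space} (hw : j.plusSpace jt w = w)
    (hv : j.minusSpace jt v = v) : j.herm w v = 0 := by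
  have h1 : j.plusSpace jt v = 0 := by
    rw [← hv]
    exact j.plus_minusProj jt hcomm _
  rw [← hw, j.herm_plusSpace_left jt hcomm, h1, j.herm_zero_right]

include hcomm in
lemma gaussFun_of_plus_of_minus (hbar : ℝ) {w v : j.Space} (hw : j.plusSpace jt w = w)
    (hv : j.minusSpace jt v = v) : gaussFun j hbar g.1 v w = 1 := by
  rw [gaussFun, j.herm_of_plus_of_minus jt hcomm (j.plusSpace_C_symm jt hcomm g hw) hv,
    j.herm_Z_inv_of_plus jt hcomm g hw, j.herm_Z_of_minus jt hcomm g hv]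
  simp

variable (hbar : ℝ) [hpos : Fact (0 < hbar)]

/-- The integrand of `⟨φ_g(w), φ_h(v)⟩` for `w ∈ V_+`, `v ∈ V_-`. -/
lemma gaussFun_mul_fockDensity {w v : j.Space} (hw : j.plusSpace jt w = w)
    (hv : j.minusSpace jt v = v) (z : j.Space) :
    conj (conj (gaussFun j hbar g.1 w z) * gaussFun j hbar h.1 v z * (fockDensity j hbar z : ℂ))
    = ((((2 * Real.pi * hbar) ^ Module.finrank ℂ j.Space)⁻¹ : ℝ) : ℂ)
      * (Complex.exp ((j.twist jt hcomm).herm (j.toTwist jt hcomm z)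
          (j.toTwist jt hcomm ((j.C g⁻¹.1).symm w + (j.C h⁻¹.1).symm v)) / (2 * hbar))
        * Complex.exp (-(j.twist jt hcomm).herm
          (((1 / (2 * hbar) : ℂ) • (j.twist jt hcomm).linPart (j.mixed jt g h))
            (j.toTwist jt hcomm z)) (j.toTwist jt hcomm z))) := by
  have hb : (hbar : ℂ) ≠ 0 := by exact_mod_cast hpos.out.ne'
  have hp := j.plusSpace_C_symm jt hcomm g⁻¹ hw
  have hq := j.minusSpace_C_symm jt hcomm h⁻¹ hv
  have h1 := j.herm_plus jt hcomm z ((j.C (g⁻¹).1).symm w)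
  have h2 := j.herm_minus jt hcomm z ((j.C (h⁻¹).1).symm v)
  rw [hp] at h1
  rw [hq] at h2
  have h3 := congrArg conj (j.herm_mixed jt hcomm g h z)
  rw [PCCS.herm_conj] at h3
  have e : j.toTwist jt hcomm ((j.C g⁻¹.1).symm w + (j.C h⁻¹.1).symm v)
    = j.toTwist jt hcomm ((j.C g⁻¹.1).symm w) + j.toTwist jt hcomm ((j.C h⁻¹.1).symm v) := rfl
  rw [LinearMap.smul_apply, PCCS.herm_smul_left, h3, e, PCCS.herm_add_right, ← h1,
    ← PCCS.herm_conj _ (j.toTwist jt hcomm ((j.C h⁻¹.1).symm v)), ← h2]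
  rw [map_mul, map_mul, Complex.conj_conj, Complex.conj_ofReal, fockDensity, gaussFun, gaussFun,
    j.herm_Z_of_plus jt hcomm g hw, j.herm_Z_of_minus jt hcomm h hv, j.herm_C_symm_left,
    j.herm_C_symm_left]
  push_cast
  rw [mul_left_comm, ← Complex.exp_conj, ← Complex.exp_add, ← Complex.exp_add, ← Complex.exp_add]
  simp only [map_add, map_sub, map_mul, map_div₀, map_one, map_ofNat, map_pow,
    Complex.conj_ofReal, Complex.conj_conj, map_zero]
  congr 2
  field_simp
  ring

lemma integrable_gaussFun_mul_fockDensity (w v : j.Space) :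
    Integrable fun z => conj (conj (gaussFun j hbar g.1 w z) * gaussFun j hbar h.1 v z
      * (fockDensity j hbar z : ℂ)) := by
  have h1 := (gaussVec j hbar g.1 w).2.2.star
  have h2 := (gaussVec j hbar h.1 v).2.2
  have h3 := MemLp.integrable_mul h1 h2
  have h4 := (integrable_fockMeasure_iff j hbar _).1 h3
  exact (Complex.conjCLE : ℂ →L[ℝ] ℂ).integrable_comp h4

/-- For w in V_+ and v in V_- the linear terms of the exponent are all j̃-antiholomorphic, so
conjugation makes them holomorphic; the mean value property then replaces their exponential by 1.
The factors π, ħ and 2 cancel against the normalisation h^{-n}. -/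
lemma inner_gaussVec_of_plus_of_minus {w v : j.Space} (hw : j.plusSpace jt w = w)
    (hv : j.minusSpace jt v = v) :
    inner ℂ (gaussVec j hbar g.1 w) (gaussVec j hbar h.1 v)
      = conj (((j.twist jt hcomm).det (j.mixed jt g h))⁻¹) := by
  have hb : (hbar : ℂ) ≠ 0 := by exact_mod_cast hpos.out.ne'
  have hpi : (Real.pi : ℂ) ≠ 0 := by exact_mod_cast Real.pi_ne_zero
  rw [← Complex.conj_conj (inner ℂ _ _)]
  congr 1
  rw [Fock.inner_eq_integral, integral_fockMeasure, ← integral_conj]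
  have hint := integrable_gaussFun_mul_fockDensity j jt g h hbar w v
  change ∫ z, conj (conj (gaussFun j hbar g.1 w z) * gaussFun j hbar h.1 v z
    * (fockDensity j hbar z : ℂ)) = _
  simp_rw [gaussFun_mul_fockDensity j jt hcomm g h hbar hw hv] at hint ⊢
  set p := j.toTwist jt hcomm ((j.C g⁻¹.1).symm w + (j.C h⁻¹.1).symm v)
  set M := (1 / (2 * hbar) : ℂ) • (j.twist jt hcomm).linPart (j.mixed jt g h) with hM
  let f : (j.twist jt hcomm).Space → ℂ := fun x =>
    Complex.exp ((j.twist jt hcomm).herm x p / (2 * hbar))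
  let ρ : (j.twist jt hcomm).Space → ℂ := fun x =>
    Complex.exp (-(j.twist jt hcomm).herm (M x) x)
  have hc : ((((2 * Real.pi * hbar) ^ Module.finrank ℂ j.Space)⁻¹ : ℝ) : ℂ) ≠ 0 := by
    push_cast
    exact inv_ne_zero (pow_ne_zero _ (by simp [hb, hpi]))
  have hmp := (j.twistIsometry jt hcomm).measurePreserving
  have hemb : MeasurableEmbedding (j.twistIsometry jt hcomm) :=
    (j.twistIsometry jt hcomm).toHomeomorph.measurableEmbedding
  have hint2 : Integrable ((fun x => f x * ρ x) ∘ j.twistIsometry jt hcomm) :=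
    (integrable_const_mul_iff (IsUnit.mk0 _ hc) _).1 hint
  have hint3 := (hmp.integrable_comp_emb hemb).1 hint2
  rw [integral_const_mul]
  change _ * ∫ z, (fun x => f x * ρ x) (j.twistIsometry jt hcomm z) = _
  rw [hmp.integral_comp hemb (fun x => f x * ρ x)]
  have hMc : Continuous M := LinearMap.continuous_of_finiteDimensional _
  have hρ : Continuous ρ := by
    have : Continuous fun x => (j.twist jt hcomm).herm (M x) x :=
      continuous_id.inner hMc
    exact Complex.continuous_exp.comp this.neg
  have hrot : ∀ c : ℂ, ‖c‖ = 1 → ∀ x, ρ (c • x) = ρ x := by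
    intro c hc x
    simp only [ρ, map_smul, PCCS.herm_smul_left, PCCS.herm_smul_right]
    rw [← mul_assoc, Complex.conj_mul', hc]
    simp
  rw [integral_mul_of_rotation_invariant _ (differentiable_herm_div _ p (2 * (hbar : ℂ))).cexp
    hρ hrot hint3]
  have hpM : ∀ x, x ≠ 0 → 0 < ((j.twist jt hcomm).herm (M x) x).re := by
    intro x hx
    have e : (1 / (2 * hbar) : ℂ) = ((1 / (2 * hbar) : ℝ) : ℂ) := by push_cast; ring
    rw [hM, LinearMap.smul_apply, PCCS.herm_smul_left, e, Complex.re_ofReal_mul]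
    exact mul_pos (by have := hpos.out; positivity) (j.re_herm_mixed_pos jt hcomm g h x hx)
  have h6 := integral_cexp_neg_herm _ hpM
  rw [h6, hM, LinearMap.det_smul, PCCS.finrank_twist, PCCS.herm_zero_left, zero_div, Complex.exp_zero,
    one_mul]
  change _ = ((LinearMap.det ((j.twist jt hcomm).linPart (j.mixed jt g h)))⁻¹)
  push_cast
  rw [mul_pow, mul_pow, div_pow, mul_pow, one_pow]
  have := pow_ne_zero (Module.finrank ℂ j.Space) hb
  have := pow_ne_zero (Module.finrank ℂ j.Space) hpi
  field_simp

include hcomm in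
-- The first condition leaves a = -P_+v + c with c in V_-. Since P_- k = C_k on V_-, and C_k is
-- invertible there, c can be chosen to cancel the V_- component of w + ka.
lemma exists_act_mem (k : pseudoUnitary jt) (w v : j.Space) :
    ∃ a : j.Space, j.plusSpace jt (w + j.act k.1 a) = w + j.act k.1 a
      ∧ j.minusSpace jt (v + a) = v + a := by
  have hadd (x y : j.Space) : j.minusSpace jt (x + y) = j.minusSpace jt x + j.minusSpace jt y :=
    map_add (j.minusProj jt) _ _
  have hact (x y : j.Space) : j.act k.1 (x + y) = j.act k.1 x + j.act k.1 y :=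
    map_add k.1.1 _ _
  have hmm (x : j.Space) : j.minusSpace jt (j.minusSpace jt x) = j.minusSpace jt x :=
    j.minusProj_minusProj jt hcomm _
  set y := w + j.act k.1 (-j.plusSpace jt v) with hy
  set c := (j.C k.1).symm (j.minusSpace jt (-y)) with hc
  have hcm : j.minusSpace jt c = c := j.minusSpace_C_symm jt hcomm k (hmm _)
  have hkc : j.minusSpace jt (j.act k.1 c) = j.C k.1 c := by
    rw [← hcm]
    apply j.down.injective
    change j.minusProj jt (puLin k (j.minusProj jt (j.down c)))
      = j.cPart (puLin k) (j.minusProj jt (j.down c))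
    simp only [PCCS.minusProj_apply, PCCS.cPart_apply, map_add, map_smul, ← hcomm, puLin_comm,
      j.sq_eq, jt.sq_eq, map_neg]
    module
  refine ⟨-j.plusSpace jt v + c, ?_, ?_⟩
  · rw [hact, ← add_assoc, ← hy]
    have h0 : j.minusSpace jt (y + j.act k.1 c) = 0 := by
      rw [hadd, hkc, hc, LinearEquiv.apply_symm_apply, ← hadd, add_neg_cancel]
      exact map_zero (j.minusProj jt)
    have h1 := j.plusSpace_add_minusSpace jt (y + j.act k.1 c)
    rwa [h0, add_zero] at h1
  · have h1 := j.plusSpace_add_minusSpace jt v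
    have h2 : v + (-j.plusSpace jt v + c) = j.minusSpace jt v + c := by
      nth_rewrite 1 [← h1]
      abel
    rw [h2, hadd, hmm, hcm]

/-- The intertwining relation evaluated at w + ka: the kernel has the translation covariance of a
matrix coefficient. -/
lemma gaussFun_act (k : Sp Ω) (a w v : j.Space) : gaussFun j hbar k v w
    = conj (shiftFactor j hbar (j.act k a) w) * shiftFactor j hbar a v
      * gaussFun j hbar k (v + a) (w + j.act k a) := by
  have hb : (hbar : ℂ) ≠ 0 := by exact_mod_cast hpos.out.ne'
  have h1 := congrFun (congrArg Subtype.val (fockShift_gaussVec j hbar k a v)) (w + j.act k a)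
  rw [fockShift_apply, add_sub_cancel_right] at h1
  change _ * gaussFun j hbar k v w = _ * gaussFun j hbar k (v + a) (w + j.act k a) at h1
  rw [mul_assoc, ← h1, ← mul_assoc, shiftFactor, ← Complex.exp_conj, ← Complex.exp_add]
  have e : conj (-(‖j.act k a‖ : ℂ) ^ 2 / (4 * hbar) - j.herm (j.act k a) w / (2 * hbar))
      + (j.herm (w + j.act k a) (j.act k a) / (2 * hbar) - (‖j.act k a‖ : ℂ) ^ 2 / (4 * hbar))
      = 0 := by
    simp only [map_sub, map_div₀, map_neg, map_pow, map_mul, map_ofNat, Complex.conj_ofReal,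
      PCCS.herm_conj, PCCS.herm_add_left, PCCS.herm_self]
    field_simp
    ring
  rw [e, Complex.exp_zero, one_mul]

/-- Translating both vectors by ha multiplies the inner product by the factor that governs the
kernel of k = g⁻¹h under (w, v) ↦ (w + ka, v + a). It therefore suffices to treat one position of
the orbit, chosen with w in V_+ and v in V_-, where that kernel equals 1. -/
lemma inner_gaussVec (w v : j.Space) :
    inner ℂ (gaussVec j hbar g.1 w) (gaussVec j hbar h.1 v)
      = conj (((j.twist jt hcomm).det (j.mixed jt g h))⁻¹)
        * gaussFun j hbar (g⁻¹ * h : pseudoUnitary jt).1 v w := by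
  obtain ⟨a, ha1, ha2⟩ := exists_act_mem j jt hcomm (g⁻¹ * h) w v
  have hact : j.act g.1 (j.act (g⁻¹ * h : pseudoUnitary jt).1 a) = j.act h.1 a :=
    Sp.apply_inv g.1 _
  have h1 := (fockShift j hbar (j.act h.1 a)).inner_map_map (gaussVec j hbar g.1 w)
    (gaussVec j hbar h.1 v)
  rw [← h1, fockShift_gaussVec, ← hact, fockShift_gaussVec, inner_smul_left, inner_smul_right,
    inner_gaussVec_of_plus_of_minus j jt hcomm g h hbar ha1 ha2, gaussFun_act j hbar _ a w v,
    gaussFun_of_plus_of_minus j jt hcomm _ hbar ha1 ha2]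
  ring

end KeyIdentity

/-! ### The lift of the pseudo-unitary group -/

section Lift

variable [FiniteDimensional ℝ V] (j : PCCS Ω) (jt : CompatibleComplexStructure Ω)
  (hcomm : ∀ v, jt.toLin (j.toLin v) = j.toLin (jt.toLin v)) (g h : pseudoUnitary jt)
  (hbar : ℝ) [hpos : Fact (0 < hbar)]

/-- The image `F(g) e_v` of a coherent state. -/
def liftVec (v : j.Space) : Fock j hbar :=
  (LinearMap.det (j.CMinus jt hcomm g))⁻¹ • gaussVec j hbar g.1 v

lemma PCCS.C_one (v : j.Space) : j.C (1 : Sp Ω) v = v := by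
  apply j.down.injective
  change (1 / 2 : ℝ) • (j.down v - j.toLin (j.toLin (j.down v))) = j.down v
  rw [j.sq_eq]
  module

lemma PCCS.Z_one (v : j.Space) : j.Z (1 : Sp Ω) v = 0 := by
  apply (j.C (1 : Sp Ω)).injective
  rw [map_zero]
  refine ((j.C (1 : Sp Ω)).apply_symm_apply _).trans ?_
  apply j.down.injective
  change (1 / 2 : ℝ) • (j.down v + j.toLin (j.toLin (j.down v))) = 0
  rw [j.sq_eq]
  module

lemma gaussVec_one (v : j.Space) : gaussVec j hbar (1 : Sp Ω) v = coherent j hbar v := by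
  ext z
  have h1 : (j.C (1 : Sp Ω)).symm z = z := by
    rw [LinearEquiv.symm_apply_eq, j.C_one]
  change Complex.exp _ = Complex.exp _
  rw [h1, inv_one, j.Z_one, j.Z_one, j.herm_zero_left, j.herm_zero_right]
  congr 1
  have hb : (hbar : ℂ) ≠ 0 := by exact_mod_cast hpos.out.ne'
  field_simp
  ring

lemma liftVec_one (v : j.Space) : liftVec j jt hcomm 1 hbar v = coherent j hbar v := by
  have h1 : j.CMinus jt hcomm 1 = LinearMap.id := by
    refine LinearMap.ext fun v => Subtype.ext ?_
    exact j.C_one v.1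
  rw [liftVec, h1, LinearMap.det_id, inv_one, one_smul]
  exact gaussVec_one j hbar v

/-- The scalars λ_g and λ_h cancel the denominator conj m(g) · m(h) of `PCCS.det_mixed`, and the
numerator leaves the scalar of g⁻¹h. -/
lemma inner_liftVec (w v : j.Space) :
    inner ℂ (liftVec j jt hcomm g hbar w) (liftVec j jt hcomm h hbar v)
      = inner ℂ (liftVec j jt hcomm 1 hbar w) (liftVec j jt hcomm (g⁻¹ * h) hbar v) := by
  rw [liftVec_one, inner_coherent]
  change _ = (LinearMap.det (j.CMinus jt hcomm (g⁻¹ * h)))⁻¹ * gaussFun j hbar _ v w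
  rw [liftVec, liftVec, inner_smul_left, inner_smul_right, inner_gaussVec j jt hcomm, j.det_mixed,
    j.det_CMinus, j.det_CMinus, j.det_CMinus]
  have h4 := j.det_mPart_ne_zero jt hcomm g
  have h5 := j.det_mPart_ne_zero jt hcomm h
  have h4' : conj ((j.twist jt hcomm).det (j.mPart jt (puLin g))) ≠ 0 := by simpa using h4
  have h5' : conj ((j.twist jt hcomm).det (j.mPart jt (puLin h))) ≠ 0 := by simpa using h5
  simp only [map_inv₀, map_div₀, map_mul, Complex.conj_conj]
  field_simp

lemma exists_liftUnitary : ∃ U : pseudoUnitary jt →* (Fock j hbar ≃ₗᵢ[ℂ] Fock j hbar),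
    ∀ g v, U g (coherent j hbar v) = liftVec j jt hcomm g hbar v := by
  have htot : (Submodule.span ℂ (Set.range (liftVec j jt hcomm 1 hbar))).topologicalClosure
      = ⊤ := by
    rw [← span_coherent_topologicalClosure j hbar, funext (liftVec_one j jt hcomm hbar)]
  obtain ⟨U, hU⟩ := exists_unitary_of_kernel (φ := fun g => liftVec j jt hcomm g hbar) htot
    fun g h w v => inner_liftVec j jt hcomm g h hbar w v
  exact ⟨U, fun g v => by rw [← hU, liftVec_one]⟩

/-- The unitary representation of the pseudo-unitary group on the Fock space. -/
def liftUnitary : pseudoUnitary jt →* (Fock j hbar ≃ₗᵢ[ℂ] Fock j hbar) :=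
  (exists_liftUnitary j jt hcomm hbar).choose

lemma liftUnitary_coherent (v : j.Space) : liftUnitary j jt hcomm hbar g (coherent j hbar v)
    = liftVec j jt hcomm g hbar v :=
  (exists_liftUnitary j jt hcomm hbar).choose_spec g v

lemma fockRep_eq (a : Heisenberg Ω) (f : Fock j hbar) : fockRep j hbar a f
    = Complex.exp (-(Complex.I * a.central) / hbar) • fockShift j hbar (j.up a.vec) f := by
  ext z
  change Complex.exp _ * _ = Complex.exp _ * _
  rw [fockShift_apply, ← mul_assoc, ← Complex.exp_add]
  congr 2
  ring

/-- A coherent state and its Gaussian acquire the same factor under translation, so the operator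
intertwines on a total family. -/
lemma fockRep_act_liftVec (a : Heisenberg Ω) (v : j.Space) :
    fockRep j hbar (Sp.act g.1 a) (liftVec j jt hcomm g hbar v)
      = liftUnitary j jt hcomm hbar g (fockRep j hbar a (coherent j hbar v)) := by
  rw [fockRep_eq, fockRep_eq, fockShift_coherent, map_smul, map_smul, liftUnitary_coherent, liftVec,
    map_smul]
  have := fockShift_gaussVec j hbar g.1 (j.up a.vec) v
  change _ • _ • fockShift j hbar (j.act g.1 (j.up a.vec)) _ = _
  rw [this, liftVec, smul_comm (LinearMap.det _)⁻¹]
  rfl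

lemma eq_of_apply_coherent {A B : Fock j hbar ≃ₗᵢ[ℂ] Fock j hbar}
    (h : ∀ v, A (coherent j hbar v) = B (coherent j hbar v)) : A = B := by
  have h1 : (A.toContinuousLinearEquiv : Fock j hbar →L[ℂ] Fock j hbar)
      = B.toContinuousLinearEquiv := by
    refine ContinuousLinearMap.ext_on (s := Set.range (coherent j hbar)) ?_ ?_
    · rw [dense_iff_closure_eq, ← Submodule.topologicalClosure_coe,
        span_coherent_topologicalClosure]
      rfl
    · rintro _ ⟨v, rfl⟩
      exact h v
  ext f : 1
  exact DFunLike.congr_fun h1 f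

lemma liftUnitary_mem : (liftUnitary j jt hcomm hbar g, g.1) ∈ MpC j hbar := by
  intro a
  rw [eq_mul_inv_iff_mul_eq]
  apply eq_of_apply_coherent
  intro v
  change fockRep j hbar (Sp.act g.1 a) (liftUnitary j jt hcomm hbar g (coherent j hbar v)) = _
  rw [liftUnitary_coherent, fockRep_act_liftVec]
  rfl

/-- The lift `F` of the inclusion of the pseudo-unitary group in the symplectic group. -/
def lift : pseudoUnitary jt →* MpC j hbar :=
  ((liftUnitary j jt hcomm hbar).prod (pseudoUnitary jt).subtype).codRestrict (MpC j hbar)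
    fun g => liftUnitary_mem j jt hcomm g hbar

lemma σ_comp_lift : (MpC.σ j hbar).comp (lift j jt hcomm hbar) = (pseudoUnitary jt).subtype := rfl

lemma lift_injective : Function.Injective (lift j jt hcomm hbar) := by
  intro g h hgh
  exact Subtype.ext (congrArg (MpC.σ j hbar) hgh)

lemma berezin_lift (z v : j.Space) : berezin (lift j jt hcomm hbar g).1.1 z v
    = (LinearMap.det (j.CMinus jt hcomm g))⁻¹ * gaussFun j hbar g.1 v z := by
  change (liftUnitary j jt hcomm hbar g (coherent j hbar v)).1 z = _
  rw [liftUnitary_coherent]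
  rfl

lemma lam_lift : MpC.lam (lift j jt hcomm hbar g) = (LinearMap.det (j.CMinus jt hcomm g))⁻¹ := by
  rw [MpC.lam, berezin_lift, gaussFun]
  simp [PCCS.herm_zero_left]

lemma hasParameters_lift : MpC.HasParameters (lift j jt hcomm hbar g) g.1
    (LinearMap.det (j.CMinus jt hcomm g))⁻¹ := by
  refine ⟨rfl, ?_, fun z v => berezin_lift j jt hcomm g hbar z v⟩
  rw [norm_mul, norm_pow, norm_inv, j.norm_det_C jt hcomm, j.det_CMinus, RCLike.norm_conj]
  have := norm_ne_zero_iff.2 (j.det_mPart_ne_zero jt hcomm g)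
  field_simp

end Lift

/-! ### Smoothness of the lift -/

section Smooth

variable [FiniteDimensional ℝ V] (j : PCCS Ω)

/-- The determinant is polynomial in matrix entries. As V carries no norm here, smoothness of f is
tested against linear functionals. -/
lemma PCCS.contDiff_det {E : Type*} [NormedAddCommGroup E] [NormedSpace ℝ E]
    {f : E → V →ₗ[ℝ] V} (hf : ∀ (l : V →ₗ[ℝ] ℝ) (v : V), ContDiff ℝ ∞ fun x => l (f x v)) :
    ContDiff ℝ ∞ fun x => j.det (f x) := by
  let b := Module.finBasis ℂ j.Space
  have hdet : (fun x => j.det (f x))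
      = fun x => (LinearMap.toMatrix b b (j.linPart (f x))).det := by
    funext x
    rw [LinearMap.det_toMatrix, PCCS.det]
  have hentry (l : V →ₗ[ℝ] ℝ) (v : j.Space) :
      ContDiff ℝ ∞ fun x => l (j.down (j.linPart (f x) v)) := by
    have : (fun x => l (j.down (j.linPart (f x) v))) = fun x => (1 / 2 : ℝ) *
        (l (f x (j.down v)) - (l ∘ₗ j.toLin) (f x (j.toLin (j.down v)))) := by
      funext x
      change l ((1 / 2 : ℝ) • (_ - _)) = _
      rw [map_smul, map_sub, smul_eq_mul]
      rfl
    rw [this]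
    exact contDiff_const.mul ((hf _ _).sub (hf _ _))
  rw [hdet]
  simp_rw [Matrix.det_apply]
  refine ContDiff.sum fun τ _ => ContDiff.const_smul _ (contDiff_prod fun i _ => ?_)
  simp_rw [LinearMap.toMatrix_apply]
  let L : V →ₗ[ℝ] ℂ := ((b.coord (τ i)).restrictScalars ℝ).comp j.realEquiv.toLinearMap
  have h1 := hentry (Complex.reLm ∘ₗ L) (b i)
  have h2 := hentry (Complex.imLm ∘ₗ L) (b i)
  have : (fun x => b.repr (j.linPart (f x) (b i)) (τ i))
      = fun x => ((Complex.reLm ∘ₗ L) (j.down (j.linPart (f x) (b i))) : ℂ)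
        + ((Complex.imLm ∘ₗ L) (j.down (j.linPart (f x) (b i))) : ℂ) * Complex.I := by
    funext x
    exact (Complex.re_add_im _).symm
  rw [this]
  exact (Complex.ofRealCLM.contDiff.comp h1).add
    ((Complex.ofRealCLM.contDiff.comp h2).mul contDiff_const)

lemma PCCS.contDiff_det_mPart (jt : CompatibleComplexStructure Ω) {n : ℕ}
    (e : (V →ₗ[ℝ] V) ≃ₗ[ℝ] (Fin n → ℝ)) :
    ContDiff ℝ ∞ fun x => j.det (j.mPart jt (e.symm x)) := by
  refine j.contDiff_det fun l v => ?_
  have hlin (l : V →ₗ[ℝ] ℝ) (v : V) : ContDiff ℝ ∞ fun x => l (e.symm x v) :=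
    (LinearMap.toContinuousLinearMap (l ∘ₗ LinearMap.applyₗ v ∘ₗ e.symm.toLinearMap)).contDiff
  have : (fun x => l (j.mPart jt (e.symm x) v)) = fun x => l (j.plus jt v) + (1 / 2 : ℝ) *
      (l (e.symm x (j.minusProj jt v))
        - (l ∘ₗ j.toLin) (e.symm x (j.toLin (j.minusProj jt v)))) := by
    funext x
    rw [mPart_apply, cPart_apply, map_add, map_smul, map_sub, smul_eq_mul]
    rfl
  rw [this]
  exact contDiff_const.add (contDiff_const.mul ((hlin _ _).sub (hlin _ _)))

lemma isSmooth_lift (jt : CompatibleComplexStructure Ω)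
    (hcomm : ∀ v, jt.toLin (j.toLin v) = j.toLin (jt.toLin v)) (hbar : ℝ) [Fact (0 < hbar)] :
    IsSmooth (lift j jt hcomm hbar) := by
  intro e
  have he (h : pseudoUnitary jt) : e.symm (e (h.1.1 : V →ₗ[ℝ] V)) = puLin h := e.symm_apply_apply _
  -- The determinant of `mPart` extends Det C_g^- smoothly to all of End(V) and does not vanish on
  -- the group.
  refine ⟨fun x => (x, (j.det (j.mPart jt (e.symm x)))⁻¹),
    contDiffOn_id.prodMk ((j.contDiff_det_mPart jt e).contDiffOn.inv ?_), fun h => ?_⟩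
  · rintro _ ⟨h, rfl⟩
    beta_reduce
    rw [he, ← j.det_CMinus_eq_det_mPart jt hcomm, j.det_CMinus]
    simpa using j.det_mPart_ne_zero jt hcomm h
  · beta_reduce
    rw [he, ← j.det_CMinus_eq_det_mPart jt hcomm, lam_lift]
    rfl

end Smooth

/-! ### Existence of a commuting positive complex structure -/

section Existence

variable [FiniteDimensional ℝ V] (jt : CompatibleComplexStructure Ω)

/-- A Hermitian structure with a given complex structure. -/
lemma exists_hermitianStructure : ∃ X : HermitianStructure V, X.toLin = jt.toLin := by
  let b := Module.finBasis ℝ V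
  let B : V →ₗ[ℝ] V →ₗ[ℝ] ℝ := ∑ i, (b.coord i).smulRight (b.coord i)
  have hB (v w : V) : B v w = ∑ i, b.coord i v * b.coord i w := by
    simp [B]
  have hsymm (v w : V) : B v w = B w v := by
    rw [hB, hB]
    exact Finset.sum_congr rfl fun i _ => mul_comm _ _
  have hnn (v : V) : 0 ≤ B v v := by
    rw [hB]
    exact Finset.sum_nonneg fun i _ => mul_self_nonneg _
  have hpos (v : V) (hv : v ≠ 0) : 0 < B v v := by
    refine lt_of_le_of_ne (hnn v) fun h => hv (b.ext_elem fun i => ?_)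
    rw [hB] at h
    have := (Finset.sum_eq_zero_iff_of_nonneg fun i _ => mul_self_nonneg _).1 h.symm i
      (Finset.mem_univ i)
    simpa using this
  -- Adding the pullback by j̃ makes the inner product j̃-invariant, since j̃² = -1 acts trivially
  -- on bilinear forms.
  refine ⟨⟨B + B.compl₁₂ jt.toLin jt.toLin, jt.toLin, fun v w => ?_, fun v hv => ?_, fun v w => ?_,
    jt.sq_eq⟩, rfl⟩
  · simp only [LinearMap.add_apply, LinearMap.compl₁₂_apply]
    rw [hsymm, hsymm (jt.toLin v)]
  · simp only [LinearMap.add_apply, LinearMap.compl₁₂_apply]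
    exact add_pos_of_pos_of_nonneg (hpos v hv) (hnn _)
  · simp only [LinearMap.add_apply, LinearMap.compl₁₂_apply, jt.sq_eq, map_neg, LinearMap.neg_apply,
      neg_neg]
    ring

lemma CompatibleComplexStructure.form_symm (v w : V) :
    Ω.form v (jt.toLin w) = Ω.form w (jt.toLin v) := by
  rw [← Ω.neg_swap, jt.form_left, neg_neg]

/-- Complex coordinates in which the Hermitian form of `j̃` is diagonal. -/
lemma exists_diagonal : ∃ (n : ℕ) (c : V ≃ₗ[ℝ] (Fin n → ℂ)) (μ : Fin n → ℝ),
    (∀ v i, c (jt.toLin v) i = Complex.I * c v i) ∧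
    ∀ v w, Ω.form v (jt.toLin w) = (∑ i, μ i * (c v i * conj (c w i))).re := by
  obtain ⟨X, hX⟩ := exists_hermitianStructure jt
  have hnd : LinearMap.BilinForm.Nondegenerate X.form := by
    constructor
    · intro v hv
      by_contra h
      exact (X.pos v h).ne' (hv v)
    · intro v hv
      by_contra h
      exact (X.pos v h).ne' (hv v)
  -- S represents Ω(v, j̃w) against the inner product. It commutes with j̃ and is self-adjoint, so
  -- an orthonormal eigenbasis diagonalises the form.
  let S : V →ₗ[ℝ] V := (LinearMap.BilinForm.toDual X.form hnd).symm.toLinearMap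
    ∘ₗ Ω.form.compl₂ jt.toLin
  have hS (v w : V) : X.form (S v) w = Ω.form v (jt.toLin w) :=
    LinearMap.BilinForm.apply_toDual_symm_apply (hB := hnd) _ _
  have hXl (v w : V) : X.form (jt.toLin v) w = -X.form v (jt.toLin w) := by
    have := X.map_form v (jt.toLin w)
    rw [hX, jt.sq_eq, map_neg] at this
    linarith
  have hSj (v : V) : S (X.pccs.toLin v) = X.pccs.toLin (S v) := by
    have e : X.pccs.toLin = jt.toLin := hX
    rw [e, ← sub_eq_zero]
    refine hnd.1 _ fun w => ?_
    rw [map_sub, LinearMap.sub_apply, hS, hXl, hS, jt.sq_eq, jt.map_form, map_neg]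
    ring
  have hT (v : X.pccs.Space) : X.pccs.linPart S v = X.pccs.up (S (X.pccs.down v)) :=
    X.pccs.linPart_apply_of_comm hSj v
  have hherm (v w : X.pccs.Space) : X.pccs.herm (X.pccs.linPart S v) w
      = (Ω.form (X.pccs.down v) (jt.toLin (X.pccs.down w)) : ℂ)
        - Complex.I * (Ω.form (X.pccs.down v) (X.pccs.down w) : ℂ) := by
    rw [hT, X.herm_eq, PCCS.down_up, hX, hS, hS, jt.sq_eq, map_neg]
    push_cast
    ring
  have hsym : (X.pccs.linPart S).IsSymmetric := by
    intro v w
    rw [PCCS.inner_eq, PCCS.inner_eq, ← PCCS.herm_conj, hherm, hherm, jt.form_symm,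
      ← Ω.neg_swap (X.pccs.down v)]
    simp
  refine ⟨Module.finrank ℂ X.pccs.Space,
    X.pccs.realEquiv.trans (((hsym.eigenvectorBasis rfl).toBasis.equivFun).restrictScalars ℝ),
    hsym.eigenvalues rfl, fun v i => ?_, fun v w => ?_⟩
  · have e : X.pccs.realEquiv (jt.toLin v) = Complex.I • X.pccs.realEquiv v := by
      apply X.pccs.down.injective
      rw [PCCS.down_smul]
      change jt.toLin v = (0 : ℝ) • v + (1 : ℝ) • X.toLin v
      rw [hX]
      simp
    change (hsym.eigenvectorBasis rfl).toBasis.equivFun (X.pccs.realEquiv (jt.toLin v)) i = _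
    rw [e, map_smul]
    rfl
  · have h1 := congrArg Complex.re (hherm (X.pccs.up v) (X.pccs.up w))
    have h2 := (hsym.eigenvectorBasis rfl).repr.inner_map_map (X.pccs.up w)
      (X.pccs.linPart S (X.pccs.up v))
    rw [PCCS.inner_eq] at h2
    rw [← h2] at h1
    have h3 : Ω.form v (jt.toLin w) = ((Ω.form v (jt.toLin w) : ℂ)
        - Complex.I * (Ω.form v w : ℂ)).re := by simp
    rw [h3]
    refine h1.symm.trans ?_
    congr 1
    rw [PiLp.inner_apply]
    refine Finset.sum_congr rfl fun i _ => ?_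
    rw [hsym.eigenvectorBasis_apply_self_apply, RCLike.inner_apply, mul_assoc]
    rfl

/-- In diagonalising coordinates j̃ is multiplication by i. Using -i on the lines where μ_i < 0
keeps the map symplectic and commuting with j̃, and makes every diagonal entry positive. -/
lemma exists_commuting_pccs :
    ∃ j : PCCS Ω, ∀ v, jt.toLin (j.toLin v) = j.toLin (jt.toLin v) := by
  obtain ⟨n, c, μ, hc, hμ⟩ := exists_diagonal jt
  let s (i : Fin n) : ℝ := if 0 < μ i then 1 else -1
  have hs (i : Fin n) : (s i : ℂ) * s i = 1 := by
    simp only [s]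
    split_ifs <;> simp
  -- A zero entry would put a basis vector in the kernel of Ω.
  have hμ0 (i : Fin n) : μ i ≠ 0 := by
    intro h0
    have hz : c.symm (Pi.single i 1) = 0 := by
      by_contra hne
      refine hne (Ω.nondegenerate.1 _ fun w => ?_)
      have h1 := hμ (c.symm (Pi.single i 1)) (-jt.toLin w)
      rw [map_neg, jt.sq_eq, neg_neg] at h1
      rw [h1, Finset.sum_eq_zero, Complex.zero_re]
      intro k _
      rw [LinearEquiv.apply_symm_apply]
      by_cases hk : k = i
      · rw [hk, h0]; simp
      · rw [Pi.single_eq_of_ne hk]; simp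
    rw [LinearEquiv.map_eq_zero_iff] at hz
    have := congrFun hz i
    simp at this
  have hsμ (i : Fin n) : 0 < s i * μ i := by
    simp only [s]
    split_ifs with h
    · simpa using h
    · have := lt_of_le_of_ne (not_lt.1 h) (hμ0 i)
      linarith
  let J : V →ₗ[ℝ] V := c.symm.toLinearMap ∘ₗ
    (LinearMap.pi fun i => (LinearMap.mulLeft ℝ ((s i : ℂ) * Complex.I)) ∘ₗ LinearMap.proj i)
    ∘ₗ c.toLinearMap
  have hJ (v : V) (i : Fin n) : c (J v) i = s i * Complex.I * c v i := by
    simp [J, mul_assoc]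
  -- Ω(v, w) is recovered from the diagonal form Ω(v, j̃·) by inserting -j̃w.
  have hΩ (v w : V) : Ω.form v w = (∑ i, μ i * (c v i * conj (-(Complex.I * c w i)))).re := by
    have h1 := hμ v (-jt.toLin w)
    rw [map_neg, jt.sq_eq, neg_neg] at h1
    rw [h1]
    simp only [map_neg, Pi.neg_apply, hc]
  have hI : Complex.I * Complex.I = -1 := Complex.I_mul_I
  refine ⟨⟨⟨J, fun v w => ?_, fun v => ?_⟩, fun v hv => ?_⟩, fun v => ?_⟩
  · rw [hΩ, hΩ]
    congr 1
    refine Finset.sum_congr rfl fun i _ => ?_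
    simp only [hJ, map_neg, map_mul, Complex.conj_I, Complex.conj_ofReal]
    linear_combination (-μ i * c v i * conj (c w i) * Complex.I * s i * s i) * hI + (μ i * c v i * conj (c w i) * Complex.I) * hs i
  · apply c.injective
    ext i
    rw [hJ, hJ, map_neg, Pi.neg_apply]
    linear_combination (c v i * s i * s i) * hI - c v i * hs i
  · change 0 < Ω.form v (J v)
    have h1 : Ω.form v (J v) = ∑ i, s i * μ i * Complex.normSq (c v i) := by
      rw [hΩ, Complex.re_sum]
      refine Finset.sum_congr rfl fun i _ => ?_
      rw [← Complex.ofReal_re (s i * μ i * Complex.normSq (c v i))]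
      congr 1
      push_cast
      rw [hJ, ← Complex.mul_conj]
      simp only [map_neg, map_mul, Complex.conj_I, Complex.conj_ofReal]
      linear_combination (-μ i * c v i * conj (c v i) * s i) * hI
    rw [h1]
    obtain ⟨i, hi⟩ : ∃ i, c v i ≠ 0 := by
      by_contra! h
      exact hv (c.map_eq_zero_iff.1 (funext h))
    exact Finset.sum_pos' (fun i _ => mul_nonneg (hsμ i).le (Complex.normSq_nonneg _))
      ⟨i, Finset.mem_univ i, mul_pos (hsμ i) (Complex.normSq_pos.2 hi)⟩
  · change jt.toLin (J v) = J (jt.toLin v)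
    apply c.injective
    ext i
    rw [hc, hJ, hJ, hc]
    ring

end Existence

end Mpc

end

theorem mainTheorem2 {V : Type*} [AddCommGroup V] [Module ℝ V] [FiniteDimensional ℝ V]
    (Ω : Mpc.SymplecticForm V) (hbar : ℝ) [Fact (0 < hbar)]
    (jt : Mpc.CompatibleComplexStructure Ω) :
    (∃ j : Mpc.PCCS Ω, ∀ v, jt.toLin (j.toLin v) = j.toLin (jt.toLin v)) ∧
    ∀ (j : Mpc.PCCS Ω) (hcomm : ∀ v, jt.toLin (j.toLin v) = j.toLin (jt.toLin v)),
      ∃ F : Mpc.pseudoUnitary jt →* Mpc.MpC j hbar,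
        Function.Injective F ∧
        (Mpc.MpC.σ j hbar).comp F = (Mpc.pseudoUnitary jt).subtype ∧
        Mpc.IsSmooth F ∧
        ∀ g : Mpc.pseudoUnitary jt,
          Mpc.MpC.HasParameters (F g) g.1 (LinearMap.det (j.CMinus jt hcomm g))⁻¹ := by
  refine ⟨Mpc.exists_commuting_pccs jt, fun j hcomm => ⟨Mpc.lift j jt hcomm hbar,
    Mpc.lift_injective j jt hcomm hbar, Mpc.σ_comp_lift j jt hcomm hbar,
    Mpc.isSmooth_lift j jt hcomm hbar, fun g => Mpc.hasParameters_lift j jt hcomm g hbar⟩⟩
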